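/- **Verhulst model: reduction of the American put on a zero-coupon bond, and the coupled system for price and exercise boundary.** *Part A (the coupled system).* Let $H>0$, let $\alpha,\beta:[0,H]\to\mathbb R$ be continuous, let $y,g$ be continuous on $[0,H]$, $C^1$ on $(0,H]$ with $y',g'$ integrable, let $f$ be locally Lipschitz on $[y(0),\infty)$ with exponentially growing Lipschitz constant, and let $|\lambda(\tau,x)|\le m(\tau)e^{A|x|}$ with $m$ continuous on $(0,H]$ and integrable. Let $U$ be a classical solution of $$U_\tau=U_{xx}+\left[\alpha(\tau)e^{x}+\beta(\tau)e^{2x}\right]U+\lambda(\tau,x),\quad 0<\tau<H,\ x>y(\tau),\qquad U(0,x)=f(x),\quad U(\tau,y(\tau))=g(\tau),$$ that is: $U$ is continuous on $\{0\le\tau\le H,\ x\ge y(\tau)\}$, of class $C^{1,2}$ in $\{0<\tau<H,\ x>y(\tau)\}$, $U_x$ exists and is continuous on $\{0<\tau\le H,\ x\ge y(\tau)\}$ (one-sided at $x=y(\tau)$), $\Psi(\tau):=U_x(\tau,y(\tau)+)$ is integrable on $(0,H)$, and $|U|\le Ce^{A|x|}$ (in particular this holds if $U\to0$ as $x\to\infty$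 uniformly in $\tau$). Then, all integrals being absolutely convergent, for all $0<\tau\le H$ and $x>y(\tau)$ $$\begin{aligned}U(\tau,x)&=\frac1{2\sqrt{\pi\tau}}\int_{y(0)}^\infty f(\xi)\Big[e^{-\frac{(\xi-x)^2}{4\tau}}-e^{-\frac{(\xi+x-2y(\tau))^2}{4\tau}}\Big]d\xi -\int_0^\tau\frac{\Psi(s)+y'(s)g(s)}{2\sqrt{\pi(\tau-s)}}\Big[e^{-\frac{(x-y(s))^2}{4(\tau-s)}}-e^{-\frac{(x-2y(\tau)+y(s))^2}{4(\tau-s)}}\Big]ds\\ &+\int_0^\tau\frac{g(s)}{4\sqrt{\pi(\tau-s)^3}}\Big[(x-y(s))e^{-\frac{(x-y(s))^2}{4(\tau-s)}}+(y(s)+x-2y(\tau))e^{-\frac{(x+y(s)-2y(\tau))^2}{4(\tau-s)}}\Big]ds\\ &+\int_0^\tau\!\int_{y(s)}^\infty\frac1{2\sqrt{\pi(\tau-s)}}\Big[e^{-\frac{(\xi-x)^2}{4(\tau-s)}}-e^{-\frac{(\xi-2y(\tau)+x)^2}{4(\tau-s)}}\Big]\Big\{\lambda(s,\xi)+[\alpha(s)e^{\xi}+\beta(s)e^{2\xi}]U(s,\xi)\Big\}d\xi\,ds,\end{aligned}\tag{1}$$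 and for all $0<\tau\le H$ $$\begin{aligned}\Psi(\tau)&=\int_{y(0)}^\infty f'(\xi)\frac{e^{-\frac{(\xi-y(\tau))^2}{4\tau}}}{\sqrt{\pi\tau}}d\xi+\int_0^\tau\Psi(s)\frac{(y(\tau)-y(s))e^{-\frac{(y(\tau)-y(s))^2}{4(\tau-s)}}}{2\sqrt{\pi(\tau-s)^3}}ds-\int_0^\tau g'(s)\frac{e^{-\frac{(y(\tau)-y(s))^2}{4(\tau-s)}}}{\sqrt{\pi(\tau-s)}}ds\\ &+\int_0^\tau\!\int_{y(s)}^\infty\Big\{\lambda(s,\xi)+[\alpha(s)e^{\xi}+\beta(s)e^{2\xi}]U(s,\xi)\Big\}\frac{\xi-y(\tau)}{2\sqrt{\pi(\tau-s)^3}}e^{-\frac{(\xi-y(\tau))^2}{4(\tau-s)}}d\xi\,ds.\end{aligned}\tag{2}$$ *Part B (the American put).* Let $0<T\le Q$, $K,R\in\mathbb R$, $\kappa,\sigma\in C^1[0,Q]$ positive and $\theta,s\in C[0,Q]$. Write $\mathcal Lv=v_t+\tfrac12\sigma^2r^2v_{rr}+\kappa r(\theta-r)v_r-(s+Rr)v$,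 which is the pricing operator of the Verhulst model $d\bar r=\kappa\bar r(\theta-\bar r)dt+\sigma\bar r\,dW$ with short rate $s(t)+R\bar r$. Let $F(t,r)$ be a bond price: $F\in C^1([0,Q]\times(0,\infty))$, $C^{1,2}$ in $(0,Q)\times(0,\infty)$, $\mathcal LF=0$, $F(Q,r)=1$. Let $(P,r_B)$ solve the free boundary problem of the American put with strike $K$, maturity $T$ and continuation region $r>r_B(t)$: $$\mathcal LP=0\ (0<t<T,\ r>r_B(t)),\quad P(T,r)=(K-F(T,r))^+\ (r\ge r_B(T)),\quad P(t,r_B(t))=K-F(t,r_B(t)),\quad P_r(t,r_B(t))=-F_r(t,r_B(t))\ (t<T),$$ where $r_B>0$ is continuous on $[0,T]$ and $C^1$ on $[0,T)$ with integrable derivative, $P$ is continuous on the closed region and $C^{1,2}$ in its interior, $P_r$ is continuous up to $r=r_B(t)$ for $t<T$, $P$ has at most polynomial growth in $r$ uniformly in $t$, and $r\mapsto(K-F(T,r))^+$ is locally Lipschitz on $[r_B(T),\infty)$ with polynomially growing Lipschitz constant. Put $\tau(t)=\frac12\int_t^T\sigma^2$, let $t(\tau)$ be its inverse on $[0,T]$,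 and put $H=\tau(0)$, $x=\log r+\int_0^t(\frac{\sigma^2}2-\kappa\theta)$, $y(\tau)=\log r_B(t)+\int_0^t(\frac{\sigma^2}2-\kappa\theta)$ at $t=t(\tau)$, $F_B(t)=F(t,r_B(t))$, $E(t,r)=\exp\big(\frac{\kappa(t)}{\sigma^2(t)}r+\int_T^ts\big)$, and define $u$ by $$P(t,r)=E(t,r)\,u(\tau,x)+K-F_B(t).$$ Then: 1. $u$ solves, in the sense of Part A, the problem $$u_\tau=u_{xx}+[\alpha e^x+\beta e^{2x}]u+\lambda,\quad u(\tau,y(\tau))=0,\quad u(0,x)=f(x):=e^{-\frac{\kappa(T)}{\sigma^2(T)}r}\big[(K-F(T,r))^+-(K-F_B(T))\big]$$ (in the formula for $f$, $r$ corresponds to $x$ at $t=T$), where, at $t=t(\tau)$ and with $r$ corresponding to $x$, $$\alpha=\frac{2\gamma}{\sigma^2}e^{-\int_0^t(\frac{\sigma^2}2-\kappa\theta)},\quad\beta=-\frac{\kappa^2}{\sigma^4}e^{-\int_0^t(\sigma^2-2\kappa\theta)},\quad\gamma=-R+\frac{\kappa^2\theta}{\sigma^2}+\frac d{dt}\frac{\kappa}{\sigma^2},$$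 $$\lambda=-\frac{2}{\sigma^2E(t,r)}\Big\{(s+Rr)[K-F_B(t)]+\tfrac{d}{dt}F_B(t)\Big\}.$$ If $F(T,r)\ge K$ for $r\ge r_B(T)$ and $F_B(T)=K$, then $f=0$ on $[y(0),\infty)$. 2. $u(\tau,x)\to0$ as $x\to\infty$ for every $\tau\in[0,H]$; moreover, if $P(t,r)\to K$ as $r\to\infty$ for some $t\in[0,T]$, then $E\,u\to F_B(t)$ as $x\to\infty$ at $\tau=\tau(t)$. 3. $\Psi(\tau)=u_x(\tau,y(\tau)+)=-r_B(t)F_r(t,r_B(t))/E(t,r_B(t))$, $t=t(\tau)$, for $0<\tau\le H$. 4. $U=u$ and $y$ satisfy the coupled system (1), (2) with these $\alpha,\beta,\lambda,f$ and with $g=0$. -/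

import Mathlib

open Set MeasureTheory Filter Topology

noncomputable section

/-! ### Classical regularity -/

/-- `v` is of class `C^{1,2}` on the set `D` of pairs (time, space). -/
structure IsC12On (D : Set (ℝ × ℝ)) (v : ℝ → ℝ → ℝ) : Prop where
  diff_time : ∀ p ∈ D, DifferentiableAt ℝ (fun t => v t p.2) p.1
  diff_space : ∀ p ∈ D, DifferentiableAt ℝ (v p.1) p.2
  diff_space_two : ∀ p ∈ D, DifferentiableAt ℝ (deriv (v p.1)) p.2
  cont_time : ContinuousOn (fun p : ℝ × ℝ => deriv (fun t => v t p.2) p.1) D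
  cont_space : ContinuousOn (fun p : ℝ × ℝ => deriv (v p.1) p.2) D
  cont_space_two : ContinuousOn (fun p : ℝ × ℝ => deriv (deriv (v p.1)) p.2) D

/-! ### The moving boundary problem with the potential `α e^x + β e^{2x}` -/

/-- The potential `α(τ) e^x + β(τ) e^{2x}`. -/
def potential (α β : ℝ → ℝ) (τ x : ℝ) : ℝ :=
  α τ * Real.exp x + β τ * Real.exp (2 * x)

/-- The gradient `Ψ(τ, y(τ)) = ∂U/∂x` at `x = y(τ)`, taken from the side `x ≥ y(τ)`
on which `U` is considered. -/
def boundaryGradient (U : ℝ → ℝ → ℝ) (y : ℝ → ℝ) (τ : ℝ) : ℝ :=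
  derivWithin (U τ) (Ici (y τ)) (y τ)

/-- `U` is a classical solution, on the horizon `0 ≤ τ ≤ H`, of
`U_τ = U_xx + [α e^x + β e^{2x}] U + lam` for `x > y(τ)`, with `U(0,x) = f(x)` and
`U(τ, y(τ)) = g(τ)`. The boundary `y` may have an unbounded (integrable) speed at `τ = 0`.
At `x → ∞` only an exponential bound is asked for, which holds in particular when
`U → 0` uniformly in `τ`. -/
structure IsMovingBoundarySolution (H : ℝ) (α β : ℝ → ℝ) (lam : ℝ → ℝ → ℝ)
    (f g y : ℝ → ℝ) (U : ℝ → ℝ → ℝ) : Prop where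
  horizon_pos : 0 < H
  -- coefficients
  alpha_cont : ContinuousOn α (Icc 0 H)
  beta_cont : ContinuousOn β (Icc 0 H)
  -- the boundary curve and the boundary value
  y_cont : ContinuousOn y (Icc 0 H)
  y_smooth : ContDiffOn ℝ 1 y (Ioc 0 H)
  y_speed : IntervalIntegrable (deriv y) volume 0 H
  g_cont : ContinuousOn g (Icc 0 H)
  g_smooth : ContDiffOn ℝ 1 g (Ioc 0 H)
  g_speed : IntervalIntegrable (deriv g) volume 0 H
  -- the initial value and the source
  f_lipschitz : ∃ C A : ℝ, ∀ x ∈ Ici (y 0), ∀ z ∈ Ici (y 0),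
    |f x - f z| ≤ C * Real.exp (A * max |x| |z|) * |x - z|
  source_bound : ∃ (A : ℝ) (m : ℝ → ℝ), ContinuousOn m (Ioc 0 H) ∧
    IntervalIntegrable m volume 0 H ∧
    ∀ τ ∈ Ioo 0 H, ∀ x, y τ < x → |lam τ x| ≤ m τ * Real.exp (A * |x|)
  -- regularity and growth of the solution
  cont : ContinuousOn (fun p : ℝ × ℝ => U p.1 p.2) {p | p.1 ∈ Icc 0 H ∧ y p.1 ≤ p.2}
  c12 : IsC12On {p | p.1 ∈ Ioo 0 H ∧ y p.1 < p.2} U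
  grad_diff : ∀ τ ∈ Ioc 0 H, ∀ x, y τ ≤ x → DifferentiableWithinAt ℝ (U τ) (Ici (y τ)) x
  grad_cont : ContinuousOn (fun p : ℝ × ℝ => derivWithin (U p.1) (Ici (y p.1)) p.2)
    {p | p.1 ∈ Ioc 0 H ∧ y p.1 ≤ p.2}
  grad_int : IntervalIntegrable (boundaryGradient U y) volume 0 H
  growth : ∃ C A : ℝ, ∀ τ ∈ Icc 0 H, ∀ x, y τ ≤ x → |U τ x| ≤ C * Real.exp (A * |x|)
  -- the equation and its side conditions
  pde : ∀ τ ∈ Ioo 0 H, ∀ x, y τ < x →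
    deriv (fun s => U s x) τ =
      deriv (deriv (U τ)) x + potential α β τ x * U τ x + lam τ x
  initial : ∀ x, y 0 ≤ x → U 0 x = f x
  boundary : ∀ τ ∈ Icc 0 H, U τ (y τ) = g τ

/-! ### The integral equations -/

/-- Heat kernel with its image reflected in the point `y(τ)`:
`[exp(-(ξ-x)²/(4(τ-s))) - exp(-(ξ+x-2y(τ))²/(4(τ-s)))] / (2 √(π(τ-s)))`. -/
def imageKernel (y : ℝ → ℝ) (τ x s ξ : ℝ) : ℝ :=
  1 / (2 * √(Real.pi * (τ - s))) *
    (Real.exp (-(ξ - x) ^ 2 / (4 * (τ - s)))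
      - Real.exp (-(ξ + x - 2 * y τ) ^ 2 / (4 * (τ - s))))

/-- The kernel that multiplies the boundary value `g(s)` in the equation for `U`. -/
def rebateKernel (y : ℝ → ℝ) (τ x s : ℝ) : ℝ :=
  1 / (4 * √(Real.pi * (τ - s) ^ 3)) *
    ((x - y s) * Real.exp (-(x - y s) ^ 2 / (4 * (τ - s)))
      + (y s + x - 2 * y τ) * Real.exp (-(x + y s - 2 * y τ) ^ 2 / (4 * (τ - s))))

/-- `exp(-(ξ-y(τ))²/(4(τ-s))) / √(π(τ-s))`. -/
def boundaryKernel (y : ℝ → ℝ) (τ s ξ : ℝ) : ℝ :=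
  Real.exp (-(ξ - y τ) ^ 2 / (4 * (τ - s))) / √(Real.pi * (τ - s))

/-- `(ξ-y(τ)) / (2 √(π(τ-s)³)) · exp(-(ξ-y(τ))²/(4(τ-s)))`. -/
def boundaryGradientKernel (y : ℝ → ℝ) (τ s ξ : ℝ) : ℝ :=
  (ξ - y τ) / (2 * √(Real.pi * (τ - s) ^ 3)) * Real.exp (-(ξ - y τ) ^ 2 / (4 * (τ - s)))

/-- The total source `lam + [α e^ξ + β e^{2ξ}] U`. -/
def totalSource (α β : ℝ → ℝ) (lam U : ℝ → ℝ → ℝ) (s ξ : ℝ) : ℝ :=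
  lam s ξ + potential α β s ξ * U s ξ

/-- The integral equation for `U` in the open continuation region, all of whose integrals
converge absolutely. -/
def SatisfiesPriceEquation (H : ℝ) (α β : ℝ → ℝ) (lam : ℝ → ℝ → ℝ)
    (f g y : ℝ → ℝ) (U : ℝ → ℝ → ℝ) : Prop :=
  ∀ τ ∈ Ioc 0 H, ∀ x, y τ < x →
    IntegrableOn (fun ξ => f ξ * imageKernel y τ x 0 ξ) (Ioi (y 0)) ∧
    IntervalIntegrable (fun s => (boundaryGradient U y s + deriv y s * g s)
      * imageKernel y τ x s (y s)) volume 0 τ ∧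
    IntervalIntegrable (fun s => g s * rebateKernel y τ x s) volume 0 τ ∧
    IntegrableOn (fun p : ℝ × ℝ => imageKernel y τ x p.1 p.2 * totalSource α β lam U p.1 p.2)
      {p | p.1 ∈ Ioo 0 τ ∧ y p.1 < p.2} ∧
    U τ x =
      (∫ ξ in Ioi (y 0), f ξ * imageKernel y τ x 0 ξ)
      - (∫ s in (0 : ℝ)..τ, (boundaryGradient U y s + deriv y s * g s)
          * imageKernel y τ x s (y s))
      + (∫ s in (0 : ℝ)..τ, g s * rebateKernel y τ x s)
      + ∫ s in (0 : ℝ)..τ, ∫ ξ in Ioi (y s),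
          imageKernel y τ x s ξ * totalSource α β lam U s ξ

/-- The nonlinear Volterra equation for the boundary `y`, all of whose integrals
converge absolutely. -/
def SatisfiesBoundaryEquation (H : ℝ) (α β : ℝ → ℝ) (lam : ℝ → ℝ → ℝ)
    (f g y : ℝ → ℝ) (U : ℝ → ℝ → ℝ) : Prop :=
  ∀ τ ∈ Ioc 0 H,
    IntegrableOn (fun ξ => deriv f ξ * boundaryKernel y τ 0 ξ) (Ioi (y 0)) ∧
    IntervalIntegrable (fun s => boundaryGradient U y s
      * ((y τ - y s) * Real.exp (-(y τ - y s) ^ 2 / (4 * (τ - s)))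
          / (2 * √(Real.pi * (τ - s) ^ 3)))) volume 0 τ ∧
    IntervalIntegrable (fun s => deriv g s * boundaryKernel y τ s (y s)) volume 0 τ ∧
    IntegrableOn (fun p : ℝ × ℝ => totalSource α β lam U p.1 p.2
      * boundaryGradientKernel y τ p.1 p.2) {p | p.1 ∈ Ioo 0 τ ∧ y p.1 < p.2} ∧
    boundaryGradient U y τ =
      (∫ ξ in Ioi (y 0), deriv f ξ * boundaryKernel y τ 0 ξ)
      + (∫ s in (0 : ℝ)..τ, boundaryGradient U y s
          * ((y τ - y s) * Real.exp (-(y τ - y s) ^ 2 / (4 * (τ - s)))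
              / (2 * √(Real.pi * (τ - s) ^ 3))))
      - (∫ s in (0 : ℝ)..τ, deriv g s * boundaryKernel y τ s (y s))
      + ∫ s in (0 : ℝ)..τ, ∫ ξ in Ioi (y s),
          totalSource α β lam U s ξ * boundaryGradientKernel y τ s ξ

/-! ### The time-dependent Verhulst model -/

/-- Coefficients of the model `dr̄ = κ r̄ (θ - r̄) dt + σ r̄ dW`, with the short rate
`s(t) + R r̄`. -/
structure VerhulstModel where
  κ : ℝ → ℝ
  θ : ℝ → ℝ
  σ : ℝ → ℝ
  s : ℝ → ℝ
  R : ℝ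

namespace VerhulstModel

/-- Standing assumptions on the coefficients up to the bond maturity `Q`. -/
structure Admissible (M : VerhulstModel) (Q : ℝ) : Prop where
  kappa_smooth : ContDiffOn ℝ 1 M.κ (Icc 0 Q)
  sigma_smooth : ContDiffOn ℝ 1 M.σ (Icc 0 Q)
  theta_cont : ContinuousOn M.θ (Icc 0 Q)
  s_cont : ContinuousOn M.s (Icc 0 Q)
  kappa_pos : ∀ t ∈ Icc 0 Q, 0 < M.κ t
  sigma_pos : ∀ t ∈ Icc 0 Q, 0 < M.σ t

/-- The pricing equation
`v_t + ½ σ² r² v_rr + κ r (θ - r) v_r = (s + R r) v` at the point `(t, r)`. -/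
def PricingPDE (M : VerhulstModel) (v : ℝ → ℝ → ℝ) (t r : ℝ) : Prop :=
  deriv (fun k => v k r) t + 1 / 2 * M.σ t ^ 2 * r ^ 2 * deriv (deriv (v t)) r
      + M.κ t * r * (M.θ t - r) * deriv (v t) r
    = (M.s t + M.R * r) * v t r

/-- `F t r` is a classical price of the zero-coupon bond with maturity `Q`: it solves the pricing
equation with `F(Q, r) = 1`. -/
structure IsBondPrice (M : VerhulstModel) (Q : ℝ) (F : ℝ → ℝ → ℝ) : Prop where
  c1 : ContDiffOn ℝ 1 (fun p : ℝ × ℝ => F p.1 p.2) (Icc 0 Q ×ˢ Ioi 0)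
  c12 : IsC12On (Ioo 0 Q ×ˢ Ioi 0) F
  pde : ∀ t ∈ Ioo 0 Q, ∀ r, 0 < r → M.PricingPDE F t r
  terminal : ∀ r, 0 < r → F Q r = 1

/-- `(P, rB)` solves the free boundary problem of the American put with strike `K` and
maturity `T` on the bond `F`, with the continuation region `r > rB(t)`. The boundary may have an
unbounded (integrable) speed at maturity. -/
structure IsAmericanPut (M : VerhulstModel) (T K : ℝ) (F : ℝ → ℝ → ℝ)
    (P : ℝ → ℝ → ℝ) (rB : ℝ → ℝ) : Prop where
  -- the exercise boundary
  rB_pos : ∀ t ∈ Icc 0 T, 0 < rB t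
  rB_cont : ContinuousOn rB (Icc 0 T)
  rB_smooth : ContDiffOn ℝ 1 rB (Ico 0 T)
  rB_speed : IntervalIntegrable (deriv rB) volume 0 T
  -- regularity and growth of the price in the continuation region
  cont : ContinuousOn (fun p : ℝ × ℝ => P p.1 p.2) {p | p.1 ∈ Icc 0 T ∧ rB p.1 ≤ p.2}
  c12 : IsC12On {p | p.1 ∈ Ioo 0 T ∧ rB p.1 < p.2} P
  delta_diff : ∀ t ∈ Ico 0 T, ∀ r, rB t ≤ r → DifferentiableWithinAt ℝ (P t) (Ici (rB t)) r
  delta_cont : ContinuousOn (fun p : ℝ × ℝ => derivWithin (P p.1) (Ici (rB p.1)) p.2)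
    {p | p.1 ∈ Ico 0 T ∧ rB p.1 ≤ p.2}
  growth : ∃ (C : ℝ) (n : ℕ), ∀ t ∈ Icc 0 T, ∀ r, rB t ≤ r → |P t r| ≤ C * (1 + r) ^ n
  payoff_lipschitz : ∃ (C : ℝ) (n : ℕ), ∀ r ∈ Ici (rB T), ∀ q ∈ Ici (rB T),
    |max (K - F T r) 0 - max (K - F T q) 0| ≤ C * (1 + max r q) ^ n * |r - q|
  -- pricing equation, payoff at maturity, value matching and smooth fit
  pde : ∀ t ∈ Ioo 0 T, ∀ r, rB t < r → M.PricingPDE P t r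
  terminal : ∀ r, rB T ≤ r → P T r = max (K - F T r) 0
  value_matching : ∀ t ∈ Icc 0 T, P t (rB t) = K - F t (rB t)
  smooth_fit : ∀ t ∈ Ico 0 T, derivWithin (P t) (Ici (rB t)) (rB t) = -deriv (F t) (rB t)

/-! The change of variables -/

/-- `τ(t) = ½ ∫_t^T σ²`. -/
def clock (M : VerhulstModel) (T t : ℝ) : ℝ := 1 / 2 * ∫ k in t..T, M.σ k ^ 2

/-- `t(τ)`, the inverse of `τ(t)` on `[0, T]`. -/
def timeOf (M : VerhulstModel) (T τ : ℝ) : ℝ := Function.invFunOn (M.clock T) (Icc 0 T) τ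

/-- `∫_0^t (σ²/2 - κ θ)`. -/
def shift (M : VerhulstModel) (t : ℝ) : ℝ := ∫ k in (0 : ℝ)..t, (M.σ k ^ 2 / 2 - M.κ k * M.θ k)

/-- `x = log r + ∫_0^t (σ²/2 - κ θ)`. -/
def logVar (M : VerhulstModel) (t r : ℝ) : ℝ := Real.log r + M.shift t

/-- `r` as a function of `(t, x)`. -/
def rateOf (M : VerhulstModel) (t x : ℝ) : ℝ := Real.exp (x - M.shift t)

/-- The factor `exp(κ/σ² · r + ∫_T^t s)` by which `p` is divided. -/
def gauge (M : VerhulstModel) (T t r : ℝ) : ℝ :=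
  Real.exp (M.κ t / M.σ t ^ 2 * r + ∫ k in T..t, M.s k)

/-- `u(τ,x) = [P - (K - F(t, rB(t)))] / exp(κ/σ² r + ∫_T^t s)` in the new variables. -/
def reducedPrice (M : VerhulstModel) (T K : ℝ) (F P : ℝ → ℝ → ℝ) (rB : ℝ → ℝ) (τ x : ℝ) : ℝ :=
  (P (M.timeOf T τ) (M.rateOf (M.timeOf T τ) x)
      - (K - F (M.timeOf T τ) (rB (M.timeOf T τ))))
    / M.gauge T (M.timeOf T τ) (M.rateOf (M.timeOf T τ) x)

/-- The exercise boundary `y(τ)` in the new variables. -/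
def reducedBoundary (M : VerhulstModel) (T : ℝ) (rB : ℝ → ℝ) (τ : ℝ) : ℝ :=
  M.logVar (M.timeOf T τ) (rB (M.timeOf T τ))

/-- `γ(t) = -R + κ² θ / σ² + d/dt (κ/σ²)`. -/
def gammaCoeff (M : VerhulstModel) (T t : ℝ) : ℝ :=
  -M.R + M.κ t ^ 2 * M.θ t / M.σ t ^ 2 + derivWithin (fun k => M.κ k / M.σ k ^ 2) (Icc 0 T) t

/-- `α(τ) = 2 γ / σ² · exp(-∫_0^t (σ²/2 - κθ))`, `t = t(τ)`. -/
def alpha (M : VerhulstModel) (T τ : ℝ) : ℝ :=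
  2 * M.gammaCoeff T (M.timeOf T τ) / M.σ (M.timeOf T τ) ^ 2
    * Real.exp (-∫ k in (0 : ℝ)..M.timeOf T τ, (M.σ k ^ 2 / 2 - M.κ k * M.θ k))

/-- `β(τ) = - κ² / σ⁴ · exp(-∫_0^t (σ² - 2κθ))`, `t = t(τ)`. -/
def beta (M : VerhulstModel) (T τ : ℝ) : ℝ :=
  -(M.κ (M.timeOf T τ) ^ 2 / M.σ (M.timeOf T τ) ^ 4)
    * Real.exp (-∫ k in (0 : ℝ)..M.timeOf T τ, (M.σ k ^ 2 - 2 * M.κ k * M.θ k))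

/-- The source `(s + R r) [K - F(t, rB(t))] + d/dt F(t, rB(t))` of the equation for
`p = P - (K - F(t, rB(t)))`. -/
def sourceBar (M : VerhulstModel) (K : ℝ) (F : ℝ → ℝ → ℝ) (rB : ℝ → ℝ) (t r : ℝ) : ℝ :=
  (M.s t + M.R * r) * (K - F t (rB t)) + deriv (fun k => F k (rB k)) t

/-- The source of the reduced equation. -/
def source (M : VerhulstModel) (T K : ℝ) (F : ℝ → ℝ → ℝ) (rB : ℝ → ℝ) (τ x : ℝ) : ℝ :=
  -(2 / M.σ (M.timeOf T τ) ^ 2)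
    * M.sourceBar K F rB (M.timeOf T τ) (M.rateOf (M.timeOf T τ) x)
    / M.gauge T (M.timeOf T τ) (M.rateOf (M.timeOf T τ) x)

/-- The initial value of the reduced problem,
`[(K - F(T,r))⁺ - (K - F(T, rB(T)))] · exp(-κ(T)/σ(T)² r)` with `r = r(T, x)`. -/
def initialValue (M : VerhulstModel) (T K : ℝ) (F : ℝ → ℝ → ℝ) (rB : ℝ → ℝ) (x : ℝ) : ℝ :=
  (max (K - F T (M.rateOf T x)) 0 - (K - F T (rB T)))
    * Real.exp (-(M.κ T / M.σ T ^ 2 * M.rateOf T x))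

end VerhulstModel

end

/-! Coupled system. Move the potential into the source: with h = lam + potential · U the equation is
the heat equation U_τ = U_ξξ + h beyond the curve y. If φ solves the backward heat equation, then
(φU)_s = (φU_ξ − φ_ξU)_ξ + φh. Integration over ξ > y(s) and 0 < s < b gives Green's identity
(`green_identity_initial`): the moments ∫φU at times b and 0 differ by ∫∫φh minus the time integral
of (Ψ + y'g)φ − gφ_ξ along the boundary, where y'g comes from the motion of the domain.

Price equation. Take φ = G, the heat kernel with pole (τ, x), and let b → τ. The moment tends to
U(τ, x) if the pole lies beyond the boundary and to 0 if it lies below (`tendsto_moment_above`,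
`tendsto_moment_below`). Subtracting the representation for the reflected pole 2y(τ) − x from the
one for x gives the kernels of the price equation.

Boundary equation. The price equation is not differentiated. Instead the pole is put on the
boundary, at (τ, y(τ)), and φ = G_ξ. Since U − g(s) is approximately Ψ · (ξ − y(s)), the moment of U
− g against G_ξ tends to −Ψ(τ)/2: half of a Gaussian second moment (`tendsto_moment_gradient`).
Differentiating G(s, y(s)) g(s) along the curve (`boundary_balance`) trades the terms with g G_ξξ
and y' g G_ξ for g' G, and integration by parts moves the derivative onto f (`gradient_identity`).
Multiplication by −2 gives the equation.

Analytic points. No decay of U_ξ at infinity is assumed; that the flux vanishes there is extracted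
from the balance law itself in `half_strip_balance`. The speed y', the gradient Ψ and the source may
be unbounded but integrable at time 0, so Green's identity is proved between positive times and then
extended. Integrability up to the pole rests on the Gaussian bounds `exists_weighted_bound` and, on
the boundary, on |y(s) − y(τ)| ≤ L(τ − s).

American put. The clock normalizes the diffusion coefficient, and the shift in x = log r + ∫(σ²/2 −
κθ) removes every first-order term except −κ r v_x. Dividing by exp(κr/σ²) removes that one, since
½σ² · 2(κ/σ²)r = κr, at the price of a potential in r and r², that is in e^x and e^{2x}; the factor
exp(∫s) absorbs the killing rate s. Subtracting K − F_B makes the boundary value zero and creates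
the source. Value matching and smooth fit then give Ψ in closed form, and the gauge, exponential in
r, beats the polynomial growth of P. All requirements of the first part are checked in
`isMovingBoundarySolution`. -/

/-! ### Calculus with parameters and a balance law on a half strip. -/

/-- Chain rule along a curve for a function with continuous partial derivatives. -/
theorem hasDerivAt_comp_of_partials {D : Set (ℝ × ℝ)} (hD : IsOpen D) {v vt vx : ℝ → ℝ → ℝ}
    (ht : ∀ p ∈ D, HasDerivAt (fun t => v t p.2) (vt p.1 p.2) p.1)
    (hx : ∀ p ∈ D, HasDerivAt (v p.1) (vx p.1 p.2) p.2)
    (ct : ContinuousOn (fun p : ℝ × ℝ => vt p.1 p.2) D)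
    (cx : ContinuousOn (fun p : ℝ × ℝ => vx p.1 p.2) D)
    {a b : ℝ → ℝ} {a' b' k : ℝ} (ha : HasDerivAt a a' k) (hb : HasDerivAt b b' k)
    (hk : (a k, b k) ∈ D) :
    HasDerivAt (fun k => v (a k) (b k)) (a' * vt (a k) (b k) + b' * vx (a k) (b k)) k := by
  have hn : D ∈ 𝓝 (a k, b k) := hD.mem_nhds hk
  have key := hasStrictFDerivAt_uncurry_coprod (𝕜 := ℝ) (u := (a k, b k)) (f := v)
    (f₁ := fun s x => ContinuousLinearMap.toSpanSingleton ℝ (vt s x))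
    (f₂ := fun s x => ContinuousLinearMap.toSpanSingleton ℝ (vx s x))
    (by filter_upwards [hn] with p hp; exact (ht p hp).hasFDerivAt)
    (by filter_upwards [hn] with p hp; exact (hx p hp).hasFDerivAt)
    (by
      have := (ct.continuousAt hn)
      exact (ContinuousLinearMap.toSpanSingletonCLE (𝕜 := ℝ) (E := ℝ)).continuous.continuousAt.comp
        this)
    (by
      have := (cx.continuousAt hn)
      exact (ContinuousLinearMap.toSpanSingletonCLE (𝕜 := ℝ) (E := ℝ)).continuous.continuousAt.comp
        this)
  have hc : HasDerivAt (fun k => (a k, b k)) (a', b') k := ha.prodMk hb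
  have := key.hasFDerivAt.comp_hasDerivAt k hc
  convert! this using 1

theorem ContinuousOn.comp_vert {D : Set (ℝ × ℝ)} {F : ℝ → ℝ → ℝ}
    (hF : ContinuousOn (fun p : ℝ × ℝ => F p.1 p.2) D) {S : Set ℝ} {z : ℝ}
    (h : ∀ s ∈ S, (s, z) ∈ D) : ContinuousOn (fun s => F s z) S :=
  hF.comp (f := fun s : ℝ => (s, z)) (by fun_prop) h

theorem ContinuousOn.comp_horiz {D : Set (ℝ × ℝ)} {F : ℝ → ℝ → ℝ}
    (hF : ContinuousOn (fun p : ℝ × ℝ => F p.1 p.2) D) {S : Set ℝ} {s : ℝ}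
    (h : ∀ z ∈ S, (s, z) ∈ D) : ContinuousOn (F s) S :=
  hF.comp (f := fun z : ℝ => (s, z)) (by fun_prop) h

theorem hasDerivAt_intervalIntegral_param {a b : ℝ} (hab : a ≤ b) {F F' : ℝ → ℝ → ℝ}
    (hF : ∀ s ∈ Icc a b, ∀ z, 0 < z → HasDerivAt (F s) (F' s z) z)
    (hFc : ContinuousOn (fun p : ℝ × ℝ => F p.1 p.2) (Icc a b ×ˢ Ioi 0))
    (hFc' : ContinuousOn (fun p : ℝ × ℝ => F' p.1 p.2) (Icc a b ×ˢ Ioi 0)) {z : ℝ} (hz : 0 < z) :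
    HasDerivAt (fun z => ∫ s in a..b, F s z) (∫ s in a..b, F' s z) z := by
  have hI : uIoc a b ⊆ Icc a b := by rw [uIoc_of_le hab]; exact Ioc_subset_Icc_self
  -- The window `[z/2, 2z]` is a compact neighbourhood of `z` inside the open half line, so
  -- continuity of `F'` supplies a constant dominating function.
  obtain ⟨C, hC⟩ := (isCompact_Icc (a := a) (b := b)).prod (isCompact_Icc (a := z / 2) (b := 2 * z))
    |>.exists_bound_of_continuousOn (f := fun p : ℝ × ℝ => F' p.1 p.2)
    (hFc'.mono (by
      rintro ⟨s, w⟩ ⟨h1, h2⟩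
      exact ⟨h1, lt_of_lt_of_le (by positivity) h2.1⟩))
  have hsl : ∀ w, 0 < w → ContinuousOn (fun s => F s w) (Icc a b) := fun w hw =>
    hFc.comp_vert fun s hs => ⟨hs, hw⟩
  have hsl' : ContinuousOn (fun s => F' s z) (Icc a b) := hFc'.comp_vert fun s hs => ⟨hs, hz⟩
  refine (intervalIntegral.hasDerivAt_integral_of_dominated_loc_of_deriv_le
    (F := fun w s => F s w) (F' := fun w s => F' s w) (s := Icc (z / 2) (2 * z)) (bound := fun _ => C)
    (Icc_mem_nhds (by linarith) (by linarith)) ?_ ?_ ?_ ?_ ?_ ?_).2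
  · filter_upwards [eventually_gt_nhds hz] with w hw
    exact ((hsl w hw).mono hI).aestronglyMeasurable measurableSet_uIoc
  · exact ((hsl z hz).mono (by rw [uIcc_of_le hab])).intervalIntegrable
  · exact (hsl'.mono hI).aestronglyMeasurable measurableSet_uIoc
  · exact ae_of_all _ fun t ht w hw => hC (t, w) ⟨hI ht, hw⟩
  · exact intervalIntegrable_const
  · exact ae_of_all _ fun t ht w hw => hF t (hI ht) w (lt_of_lt_of_le (by positivity) hw.1)

/-- Integration of the balance law `p_s = B_z + q` over the half strip `[a,b] × (0,∞)`, where
the flux `B` is, up to a decaying remainder, the `z`-derivative of the decaying density `p`. -/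
theorem half_strip_balance {a b : ℝ} (hab : a ≤ b) {p B q pd R : ℝ → ℝ → ℝ} {C : ℝ}
    (hps : ∀ s ∈ Icc a b, ∀ z, 0 < z → HasDerivAt (fun s => p s z) (pd s z) s)
    (hBz : ∀ s ∈ Icc a b, ∀ z, 0 < z → HasDerivAt (B s) (pd s z - q s z) z)
    (hpz : ∀ s ∈ Icc a b, ∀ z, 0 < z → HasDerivAt (p s) (B s z - R s z) z)
    (cpd : ContinuousOn (fun r : ℝ × ℝ => pd r.1 r.2) (Icc a b ×ˢ Ioi 0))
    (cq : ContinuousOn (fun r : ℝ × ℝ => q r.1 r.2) (Icc a b ×ˢ Ioi 0))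
    (cp : ContinuousOn (fun r : ℝ × ℝ => p r.1 r.2) (Icc a b ×ˢ Ici 0))
    (cB : ContinuousOn (fun r : ℝ × ℝ => B r.1 r.2) (Icc a b ×ˢ Ici 0))
    (cR : ContinuousOn (fun r : ℝ × ℝ => R r.1 r.2) (Icc a b ×ˢ Ici 0))
    (bp : ∀ s ∈ Icc a b, ∀ z, 0 < z → |p s z| ≤ C * Real.exp (-z))
    (bq : ∀ s ∈ Icc a b, ∀ z, 0 < z → |q s z| ≤ C * Real.exp (-z))
    (bR : ∀ s ∈ Icc a b, ∀ z, 0 < z → |R s z| ≤ C * Real.exp (-z)) :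
    (∫ z in Ioi 0, p b z) - ∫ z in Ioi 0, p a z
      = -(∫ s in a..b, B s 0) + ∫ s in a..b, ∫ z in Ioi 0, q s z := by
  have hI : uIoc a b ⊆ Icc a b := by rw [uIoc_of_le hab]; exact Ioc_subset_Icc_self
  have hsub : Icc a b ×ˢ Ioi (0 : ℝ) ⊆ Icc a b ×ˢ Ici 0 := prod_mono le_rfl Ioi_subset_Ici_self
  have hexp : IntegrableOn (fun z : ℝ => C * Real.exp (-z)) (Ioi 0) :=
    (integrableOn_exp_neg_Ioi 0).const_mul C
  have ha : a ∈ Icc a b := left_mem_Icc.2 hab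
  have hb : b ∈ Icc a b := right_mem_Icc.2 hab
  have ii : ∀ {F : ℝ → ℝ → ℝ},
      ContinuousOn (fun r : ℝ × ℝ => F r.1 r.2) (Icc a b ×ˢ Ioi 0) → ∀ z, 0 < z →
      IntervalIntegrable (fun s => F s z) volume a b := fun hF z hz =>
    ContinuousOn.intervalIntegrable (by
      rw [uIcc_of_le hab]; exact hF.comp_vert fun s hs => ⟨hs, hz⟩)
  -- the product integrability of `q`
  have hqint : Integrable (Function.uncurry q)
      ((volume.restrict (uIoc a b)).prod (volume.restrict (Ioi (0 : ℝ)))) := by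
    have hd : Integrable (fun r : ℝ × ℝ => (1 : ℝ) * (C * Real.exp (-r.2)))
        ((volume.restrict (uIoc a b)).prod (volume.restrict (Ioi (0 : ℝ)))) := by
      refine Integrable.mul_prod (f := fun _ : ℝ => (1 : ℝ)) (g := fun z : ℝ => C * Real.exp (-z))
        ?_ hexp
      rw [uIoc_of_le hab]
      exact integrable_const _
    refine hd.mono' ?_ ?_
    · rw [Measure.prod_restrict]
      exact (cq.mono (prod_mono hI le_rfl)).aestronglyMeasurable
        (measurableSet_uIoc.prod measurableSet_Ioi)
    · rw [Measure.prod_restrict]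
      refine (ae_restrict_iff' (measurableSet_uIoc.prod measurableSet_Ioi)).2
        (ae_of_all _ fun r hr => ?_)
      simpa [Function.uncurry] using bq r.1 (hI hr.1) r.2 hr.2
  have hqbar : IntegrableOn (fun z => ∫ s in a..b, q s z) (Ioi 0) := by
    have := hqint.integral_prod_right
    simp only [intervalIntegral.integral_of_le hab, IntegrableOn]
    rwa [uIoc_of_le hab] at this
  have hpint : ∀ s ∈ Icc a b, IntegrableOn (p s) (Ioi 0) := fun s hs =>
    hexp.mono' (((cp.mono hsub).comp_horiz fun z hz => ⟨hs, hz⟩).aestronglyMeasurable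
      measurableSet_Ioi) ((ae_restrict_iff' measurableSet_Ioi).2 (ae_of_all _ fun z hz => bp s hs z hz))
  -- the derivative of the integrated flux
  have hder : ∀ z ∈ Ioi (0 : ℝ), HasDerivAt (fun z => ∫ s in a..b, B s z)
      (p b z - p a z - ∫ s in a..b, q s z) z := by
    intro z hz
    have h1 := hasDerivAt_intervalIntegral_param hab hBz (cB.mono hsub) (cpd.sub cq) hz
    have h2 : ∫ s in a..b, (pd s z - q s z) = p b z - p a z - ∫ s in a..b, q s z := by
      rw [intervalIntegral.integral_sub (ii cpd z hz) (ii cq z hz)]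
      rw [intervalIntegral.integral_eq_sub_of_hasDerivAt (f := fun s => p s z)
        (fun s hs => hps s (by rwa [uIcc_of_le hab] at hs) z hz) (ii cpd z hz)]
    rwa [h2] at h1
  have hdint : IntegrableOn (fun z => p b z - p a z - ∫ s in a..b, q s z) (Ioi 0) :=
    ((hpint b hb).sub (hpint a ha)).sub hqbar
  -- The derivative of the integrated flux is integrable, so a limit at infinity exists; its value
  -- is determined separately.
  obtain ⟨L, hL⟩ : ∃ L, Tendsto (fun z => ∫ s in a..b, B s z) atTop (𝓝 L) :=
    ⟨_, tendsto_limUnder_of_hasDerivAt_of_integrableOn_Ioi hder hdint⟩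
  -- the flux vanishes at infinity
  have hsmall : ∀ {F : ℝ → ℝ → ℝ}, (∀ s ∈ Icc a b, ∀ z, 0 < z → |F s z| ≤ C * Real.exp (-z)) →
      Tendsto (fun z => ∫ s in a..b, F s z) atTop (𝓝 0) := by
    intro F hF
    have h0 : Tendsto (fun z : ℝ => C * Real.exp (-z) * |b - a|) atTop (𝓝 0) := by
      have := (Real.tendsto_exp_neg_atTop_nhds_zero.const_mul C).mul_const |b - a|
      simpa using this
    refine squeeze_zero_norm' ?_ h0
    filter_upwards [eventually_gt_atTop 0] with z hz
    exact intervalIntegral.norm_integral_le_of_norm_le_const fun s hs => hF s (hI hs) z hz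
  -- There is no bound on `B` to use. Since `B = p_z + R`, the mean value theorem on `[z, z+1]`
  -- yields points `c z → ∞` where `∫ B - ∫ R` equals an increment of `∫ p`. Those increments and `∫
  -- R` tend to zero, hence so does the limit of `∫ B`, already known to exist.
  have hL0 : L = 0 := by
    have hπ : ∀ z, 0 < z → HasDerivAt (fun z => ∫ s in a..b, p s z)
        ((∫ s in a..b, B s z) - ∫ s in a..b, R s z) z := by
      intro z hz
      have h1 := hasDerivAt_intervalIntegral_param hab hpz (cp.mono hsub)
        ((cB.mono hsub).sub (cR.mono hsub)) hz
      rwa [intervalIntegral.integral_sub (ii (cB.mono hsub) z hz) (ii (cR.mono hsub) z hz)] at h1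
    have hlim : Tendsto (fun z => (∫ s in a..b, B s z) - ∫ s in a..b, R s z) atTop (𝓝 L) := by
      simpa using hL.sub (hsmall bR)
    have hmv : ∀ z : ℝ, 0 < z → ∃ c ∈ Ioo z (z + 1),
        ((∫ s in a..b, B s c) - ∫ s in a..b, R s c)
          = (∫ s in a..b, p s (z + 1)) - ∫ s in a..b, p s z := by
      intro z hz
      obtain ⟨c, hc, h⟩ := exists_hasDerivAt_eq_slope (fun z => ∫ s in a..b, p s z)
        (fun z => (∫ s in a..b, B s z) - ∫ s in a..b, R s z) (show z < z + 1 by linarith)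
        (fun w hw => (hπ w (lt_of_lt_of_le hz hw.1)).continuousAt.continuousWithinAt)
        (fun w hw => hπ w (hz.trans hw.1))
      exact ⟨c, hc, by rw [h]; simp⟩
    choose! c hc hceq using hmv
    have hctop : Tendsto c atTop atTop :=
      tendsto_atTop_mono' _ (by
        filter_upwards [eventually_gt_atTop 0] with z hz using (hc z hz).1.le) tendsto_id
    have e1 := hlim.comp hctop
    have e2 : Tendsto (fun z : ℝ => (∫ s in a..b, p s (z + 1)) - ∫ s in a..b, p s z) atTop (𝓝 0) := by
      have := ((hsmall bp).comp (tendsto_atTop_add_const_right atTop (1 : ℝ) tendsto_id)).sub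
        (hsmall bp)
      simpa using this
    refine tendsto_nhds_unique (e1.congr' ?_) e2
    filter_upwards [eventually_gt_atTop 0] with z hz using hceq z hz
  subst hL0
  -- The derivative of the flux is known only for `z > 0`; continuity up to `z = 0` is what the
  -- fundamental theorem on the half line asks for in addition.
  have hcont : ContinuousWithinAt (fun z => ∫ s in a..b, B s z) (Ici 0) 0 := by
    obtain ⟨M, hM⟩ := (isCompact_Icc (a := a) (b := b)).prod (isCompact_Icc (a := (0 : ℝ)) (b := 1))
      |>.exists_bound_of_continuousOn (f := fun r : ℝ × ℝ => B r.1 r.2)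
      (cB.mono (prod_mono le_rfl Icc_subset_Ici_self))
    have h1 : ∀ᶠ z in 𝓝[Ici 0] (0 : ℝ), z ∈ Icc (0 : ℝ) 1 := Icc_mem_nhdsGE one_pos
    refine intervalIntegral.continuousWithinAt_of_dominated_interval (F := fun z s => B s z)
      (bound := fun _ => M) ?_ ?_
      intervalIntegrable_const ?_
    · filter_upwards [h1] with z hz
      exact (cB.comp_vert fun s hs => ⟨hI hs, hz.1⟩).aestronglyMeasurable measurableSet_uIoc
    · filter_upwards [h1] with z hz
      exact ae_of_all _ fun s hs => hM (s, z) ⟨hI hs, hz⟩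
    · exact ae_of_all _ fun s hs => (cB.comp_horiz fun z hz => ⟨hI hs, hz⟩) 0 self_mem_Ici
  have hfin := integral_Ioi_of_hasDerivAt_of_tendsto hcont hder hdint hL
  have e1 : ∫ z in Ioi 0, (p b z - p a z - ∫ s in a..b, q s z)
      = (∫ z in Ioi 0, p b z) - (∫ z in Ioi 0, p a z) - ∫ z in Ioi 0, ∫ s in a..b, q s z := by
    have h1 : IntegrableOn (fun z => p b z - p a z) (Ioi 0) := (hpint b hb).sub (hpint a ha)
    rw [integral_sub h1 hqbar, integral_sub (hpint b hb) (hpint a ha)]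
  have e2 := intervalIntegral_integral_swap hqint
  rw [e1, ← e2] at hfin
  linarith


/-! ### Integration over the region beyond a moving boundary. -/

theorem integral_Ioi_add_left (F : ℝ → ℝ) (c : ℝ) :
    ∫ z in Ioi 0, F (c + z) = ∫ x in Ioi c, F x := by
  have := (measurePreserving_add_left volume c).setIntegral_preimage_emb
    (measurableEmbedding_addLeft c) F (Ioi c)
  rw [← this]
  simp

/-- Integrability over the region beyond a moving boundary, from a bound on the slices. -/
theorem integrableOn_region {τ : ℝ} (hτ : 0 ≤ τ) {y : ℝ → ℝ} (hy : ContinuousOn y (Ioo 0 τ))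
    {F k : ℝ → ℝ → ℝ} {N : ℝ → ℝ}
    (hF : ContinuousOn (fun p : ℝ × ℝ => F p.1 p.2) {p | p.1 ∈ Ioo 0 τ ∧ y p.1 < p.2})
    (hFk : ∀ s ∈ Ioo 0 τ, ∀ ξ, y s < ξ → |F s ξ| ≤ k s ξ)
    (hk0 : ∀ s ∈ Ioo 0 τ, ∀ ξ, 0 ≤ k s ξ)
    (hk : ∀ s ∈ Ioo 0 τ, Integrable (k s)) (hkN : ∀ s ∈ Ioo 0 τ, ∫ ξ, k s ξ ≤ N s)
    (hN : IntervalIntegrable N volume 0 τ) :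
    IntegrableOn (fun p : ℝ × ℝ => F p.1 p.2) {p | p.1 ∈ Ioo 0 τ ∧ y p.1 < p.2} ∧
    IntervalIntegrable (fun s => ∫ ξ in Ioi (y s), F s ξ) volume 0 τ := by
  set D : Set (ℝ × ℝ) := {p | p.1 ∈ Ioo 0 τ ∧ y p.1 < p.2} with hD
  have hopen : IsOpen D := by
    have h1 : ContinuousOn (fun p : ℝ × ℝ => p.2 - y p.1) (Prod.fst ⁻¹' Ioo 0 τ) :=
      continuousOn_snd.sub (hy.comp continuousOn_fst fun p hp => hp)
    have h2 := h1.isOpen_inter_preimage (isOpen_Ioo.preimage continuous_fst) (isOpen_Ioi (a := 0))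
    convert h2 using 1
    ext p
    simp [hD]
  have hDm : MeasurableSet D := hopen.measurableSet
  have hG : AEStronglyMeasurable (D.indicator fun p : ℝ × ℝ => F p.1 p.2)
      ((volume.restrict (Ioo 0 τ)).prod volume) := by
    have h1 : AEStronglyMeasurable (D.indicator fun p : ℝ × ℝ => F p.1 p.2)
        (volume : Measure (ℝ × ℝ)) :=
      (aestronglyMeasurable_indicator_iff hDm).2 (hF.aestronglyMeasurable hDm)
    have h2 : (volume.restrict (Ioo 0 τ)).prod (volume : Measure ℝ)
        ≤ (volume : Measure (ℝ × ℝ)) := by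
      have : (volume.restrict (Ioo 0 τ)).prod (volume : Measure ℝ)
          = (volume.prod volume).restrict (Ioo 0 τ ×ˢ univ) := by
        rw [← Measure.prod_restrict, Measure.restrict_univ]
      rw [this]
      exact Measure.restrict_le_self
    exact h1.mono_measure h2
  have hslice : ∀ s ∈ Ioo 0 τ, ∀ ξ, ‖D.indicator (fun p : ℝ × ℝ => F p.1 p.2) (s, ξ)‖ ≤ k s ξ := by
    intro s hs ξ
    by_cases h : (s, ξ) ∈ D
    · rw [indicator_of_mem h]; exact hFk s hs ξ h.2
    · rw [indicator_of_notMem h]; simpa using hk0 s hs ξ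
  have hmem : ∀ᵐ s ∂volume.restrict (Ioo 0 τ), s ∈ Ioo 0 τ := ae_restrict_mem measurableSet_Ioo
  have hint : Integrable (D.indicator fun p : ℝ × ℝ => F p.1 p.2)
      ((volume.restrict (Ioo 0 τ)).prod volume) := by
    have hsl : ∀ᵐ s ∂volume.restrict (Ioo 0 τ),
        Integrable (fun ξ => D.indicator (fun p : ℝ × ℝ => F p.1 p.2) (s, ξ)) := by
      filter_upwards [hG.prodMk_left, hmem] with s hs hs'
      exact (hk s hs').mono' hs (ae_of_all _ (hslice s hs'))
    refine (integrable_prod_iff hG).2 ⟨hsl, ?_⟩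
    have hN' : Integrable N (volume.restrict (Ioo 0 τ)) := by
      have := (intervalIntegrable_iff_integrableOn_Ioo_of_le hτ).1 hN
      exact this
    refine hN'.mono' hG.norm.integral_prod_right' ?_
    filter_upwards [hsl, hmem] with s hs hs'
    rw [Real.norm_of_nonneg (integral_nonneg fun _ => norm_nonneg _)]
    exact (integral_mono hs.norm (hk s hs') (hslice s hs')).trans (hkN s hs')
  constructor
  · rw [← integrable_indicator_iff hDm]
    have h3 : IntegrableOn (D.indicator fun p : ℝ × ℝ => F p.1 p.2) (Ioo 0 τ ×ˢ univ) := by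
      rw [IntegrableOn, Measure.volume_eq_prod, ← Measure.prod_restrict, Measure.restrict_univ]
      exact hint
    have h3' := (integrable_indicator_iff (measurableSet_Ioo.prod MeasurableSet.univ)).2 h3
    convert h3' using 1
    rw [indicator_indicator]
    congr 1
    ext p
    simp only [hD, mem_inter_iff, mem_ofPred_eq, mem_prod, mem_univ, and_true]
    tauto
  · rw [intervalIntegrable_iff_integrableOn_Ioo_of_le hτ]
    refine Integrable.congr hint.integral_prod_left ?_
    filter_upwards [hmem] with s hs
    rw [← integral_indicator measurableSet_Ioi]
    congr 1
    ext ξ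
    by_cases h : y s < ξ
    · rw [indicator_of_mem (show (s, ξ) ∈ D from ⟨hs, h⟩), indicator_of_mem (show ξ ∈ Ioi (y s) from h)]
    · rw [indicator_of_notMem (fun h' : (s, ξ) ∈ D => h h'.2),
        indicator_of_notMem (show ξ ∉ Ioi (y s) from h)]

/-! ### Test functions of the backward heat equation and Green's identity. -/

/-- `φ` solves the backward heat equation before time `τ`, with first and second space derivative
`φ1`, `φ2`, and decays faster than every exponential together with its gradient. -/
structure IsBackwardHeatTest (τ : ℝ) (φ φ1 φ2 : ℝ → ℝ → ℝ) : Prop where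
  space : ∀ s < τ, ∀ ξ, HasDerivAt (φ s) (φ1 s ξ) ξ
  space_two : ∀ s < τ, ∀ ξ, HasDerivAt (φ1 s) (φ2 s ξ) ξ
  time : ∀ s < τ, ∀ ξ, HasDerivAt (fun s => φ s ξ) (-φ2 s ξ) s
  cont : ContinuousOn (fun p : ℝ × ℝ => φ p.1 p.2) {p | p.1 < τ}
  cont_one : ContinuousOn (fun p : ℝ × ℝ => φ1 p.1 p.2) {p | p.1 < τ}
  cont_two : ContinuousOn (fun p : ℝ × ℝ => φ2 p.1 p.2) {p | p.1 < τ}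
  decay : ∀ b < τ, ∀ A, ∃ C, ∀ s ∈ Icc 0 b, ∀ ξ,
    |φ s ξ| ≤ C * Real.exp (-A * |ξ|) ∧ |φ1 s ξ| ≤ C * Real.exp (-A * |ξ|)

theorem IsBackwardHeatTest.hasDerivAt_curve {τ : ℝ} {φ φ1 φ2 : ℝ → ℝ → ℝ}
    (h : IsBackwardHeatTest τ φ φ1 φ2) {c : ℝ → ℝ} {c' s : ℝ} (hs : s < τ) (hc : HasDerivAt c c' s) :
    HasDerivAt (fun s => φ s (c s)) (-φ2 s (c s) + c' * φ1 s (c s)) s := by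
  have := hasDerivAt_comp_of_partials (D := {p : ℝ × ℝ | p.1 < τ})
    (isOpen_lt continuous_fst continuous_const) (v := φ) (vt := fun s ξ => -φ2 s ξ) (vx := φ1)
    (fun p hp => h.time p.1 hp p.2) (fun p hp => h.space p.1 hp p.2) h.cont_two.neg h.cont_one
    (hasDerivAt_id s) hc hs
  simpa using this



namespace IsMovingBoundarySolution

variable {H : ℝ} {α β : ℝ → ℝ} {lam : ℝ → ℝ → ℝ} {f g y : ℝ → ℝ} {U : ℝ → ℝ → ℝ}

theorem isOpen_region (hU : IsMovingBoundarySolution H α β lam f g y U) :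
    IsOpen {p : ℝ × ℝ | p.1 ∈ Ioo 0 H ∧ y p.1 < p.2} := by
  have h1 : ContinuousOn (fun p : ℝ × ℝ => p.2 - y p.1) (Prod.fst ⁻¹' Ioo 0 H) :=
    continuousOn_snd.sub ((hU.y_cont.mono Ioo_subset_Icc_self).comp continuousOn_fst fun p hp => hp)
  have h2 := h1.isOpen_inter_preimage (isOpen_Ioo.preimage continuous_fst) (isOpen_Ioi (a := 0))
  convert h2 using 1
  ext p
  simp

theorem hasDerivAt_y (hU : IsMovingBoundarySolution H α β lam f g y U) {s : ℝ} (hs : s ∈ Ioo 0 H) :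
    HasDerivAt y (deriv y s) s :=
  ((hU.y_smooth.differentiableOn one_ne_zero s ⟨hs.1, hs.2.le⟩).differentiableAt
    (Ioc_mem_nhds hs.1 hs.2)).hasDerivAt

theorem hasDerivAt_g (hU : IsMovingBoundarySolution H α β lam f g y U) {s : ℝ} (hs : s ∈ Ioo 0 H) :
    HasDerivAt g (deriv g s) s :=
  ((hU.g_smooth.differentiableOn one_ne_zero s ⟨hs.1, hs.2.le⟩).differentiableAt
    (Ioc_mem_nhds hs.1 hs.2)).hasDerivAt

theorem continuousOn_deriv_y (hU : IsMovingBoundarySolution H α β lam f g y U) :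
    ContinuousOn (deriv y) (Ioo 0 H) :=
  (hU.y_smooth.mono Ioo_subset_Ioc_self).continuousOn_deriv_of_isOpen isOpen_Ioo le_rfl

/-- The space derivative of `U`, one-sided on the boundary. -/
theorem hasDerivAt_space (hU : IsMovingBoundarySolution H α β lam f g y U) {s ξ : ℝ}
    (hs : s ∈ Ioc 0 H) (hξ : y s < ξ) :
    HasDerivAt (U s) (derivWithin (U s) (Ici (y s)) ξ) ξ :=
  (hU.grad_diff s hs ξ hξ.le).hasDerivWithinAt.hasDerivAt (Ici_mem_nhds hξ)

theorem derivWithin_eq {U : ℝ → ℝ → ℝ} {s ξ : ℝ} (hξ : y s < ξ) :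
    derivWithin (U s) (Ici (y s)) ξ = deriv (U s) ξ :=
  derivWithin_of_mem_nhds (Ici_mem_nhds hξ)

theorem hasDerivAt_space_two (hU : IsMovingBoundarySolution H α β lam f g y U) {s ξ : ℝ}
    (hs : s ∈ Ioo 0 H) (hξ : y s < ξ) :
    HasDerivAt (derivWithin (U s) (Ici (y s))) (deriv (deriv (U s)) ξ) ξ := by
  refine (hU.c12.diff_space_two (s, ξ) ⟨hs, hξ⟩).hasDerivAt.congr_of_eventuallyEq ?_
  filter_upwards [Ioi_mem_nhds hξ] with x hx using derivWithin_eq hx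

/-- Nothing is assumed about the continuity of `lam`. The equation itself writes the total source as
`U_τ - U_xx`, and both terms are continuous by the `C^{1,2}` regularity. -/
theorem continuousOn_totalSource (hU : IsMovingBoundarySolution H α β lam f g y U) :
    ContinuousOn (fun p : ℝ × ℝ => totalSource α β lam U p.1 p.2)
      {p | p.1 ∈ Ioo 0 H ∧ y p.1 < p.2} := by
  refine (hU.c12.cont_time.sub hU.c12.cont_space_two).congr fun p hp => ?_
  have := hU.pde p.1 hp.1 p.2 hp.2
  simp only [totalSource, Pi.sub_apply, this]
  ring

theorem totalSource_eq (hU : IsMovingBoundarySolution H α β lam f g y U) {s ξ : ℝ}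
    (hs : s ∈ Ioo 0 H) (hξ : y s < ξ) :
    totalSource α β lam U s ξ = deriv (fun s => U s ξ) s - deriv (deriv (U s)) ξ := by
  rw [hU.pde s hs ξ hξ, totalSource]
  ring

theorem exists_growth (hU : IsMovingBoundarySolution H α β lam f g y U) :
    ∃ C A : ℝ, 0 ≤ C ∧ 0 ≤ A ∧ ∀ τ ∈ Icc 0 H, ∀ x, y τ ≤ x → |U τ x| ≤ C * Real.exp (A * |x|) := by
  obtain ⟨C, A, h⟩ := hU.growth
  refine ⟨|C|, |A|, abs_nonneg _, abs_nonneg _, fun τ hτ x hx => (h τ hτ x hx).trans ?_⟩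
  gcongr
  · exact le_abs_self C
  · exact le_abs_self A

theorem exists_totalSource_bound (hU : IsMovingBoundarySolution H α β lam f g y U) :
    ∃ (A : ℝ) (M : ℝ → ℝ), 0 ≤ A ∧ (∀ s, 0 ≤ M s) ∧ ContinuousOn M (Ioc 0 H) ∧
      IntervalIntegrable M volume 0 H ∧
      ∀ s ∈ Ioo 0 H, ∀ ξ, y s < ξ → |totalSource α β lam U s ξ| ≤ M s * Real.exp (A * |ξ|) := by
  obtain ⟨A, m, hm, hmi, hb⟩ := hU.source_bound
  obtain ⟨C, B, hC, hB, hg⟩ := hU.exists_growth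
  obtain ⟨a, ha⟩ := isCompact_Icc.exists_bound_of_continuousOn hU.alpha_cont
  obtain ⟨b, hb'⟩ := isCompact_Icc.exists_bound_of_continuousOn hU.beta_cont
  -- The rate collects `|A|` from `lam`, `B` from the growth of `U`, and `2` from `e^{2ξ}` in the
  -- potential. Its size is harmless because test functions decay faster than every exponential.
  refine ⟨|A| + B + 2, fun s => |m s| + (|a| + |b|) * C, by positivity, fun s => by positivity,
    hm.abs.add continuousOn_const, hmi.abs.add intervalIntegrable_const, fun s hs ξ hξ => ?_⟩
  have hs' : s ∈ Icc 0 H := Ioo_subset_Icc_self hs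
  have h1 : |lam s ξ| ≤ |m s| * Real.exp ((|A| + B + 2) * |ξ|) := by
    refine (hb s hs ξ hξ).trans ?_
    gcongr
    · exact le_abs_self _
    · linarith [le_abs_self A]
  have e1 : Real.exp ξ ≤ Real.exp (2 * |ξ|) :=
    Real.exp_le_exp.2 (by linarith [le_abs_self ξ, abs_nonneg ξ])
  have e2 : Real.exp (2 * ξ) ≤ Real.exp (2 * |ξ|) :=
    Real.exp_le_exp.2 (by linarith [le_abs_self ξ])
  have h2 : |potential α β s ξ| ≤ (|a| + |b|) * Real.exp (2 * |ξ|) := by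
    unfold potential
    refine (abs_add_le _ _).trans ?_
    rw [abs_mul, abs_mul, Real.abs_exp, Real.abs_exp, add_mul]
    exact add_le_add
      (mul_le_mul ((ha s hs').trans (le_abs_self a)) e1 (Real.exp_pos _).le (abs_nonneg _))
      (mul_le_mul ((hb' s hs').trans (le_abs_self b)) e2 (Real.exp_pos _).le (abs_nonneg _))
  have h3 := hg s hs' ξ hξ.le
  have h4 : |potential α β s ξ * U s ξ| ≤ (|a| + |b|) * C * Real.exp ((|A| + B + 2) * |ξ|) := by
    rw [abs_mul]
    calc _ ≤ ((|a| + |b|) * Real.exp (2 * |ξ|)) * (C * Real.exp (B * |ξ|)) := by gcongr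
      _ = (|a| + |b|) * C * Real.exp ((B + 2) * |ξ|) := by
        rw [show (B + 2) * |ξ| = 2 * |ξ| + B * |ξ| by ring, Real.exp_add]; ring
      _ ≤ _ := by gcongr; linarith [abs_nonneg A]
  calc |totalSource α β lam U s ξ| ≤ |lam s ξ| + |potential α β s ξ * U s ξ| := abs_add_le _ _
    _ ≤ _ := by rw [add_mul]; exact add_le_add h1 h4

/-- Green's identity between two positive times. -/
theorem green_identity (hU : IsMovingBoundarySolution H α β lam f g y U) {τ a b : ℝ}
    {φ φ1 φ2 : ℝ → ℝ → ℝ} (hφ : IsBackwardHeatTest τ φ φ1 φ2) (ha : 0 < a) (hab : a ≤ b)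
    (hb : b < τ) (hbH : b < H) :
    (∫ ξ in Ioi (y b), φ b ξ * U b ξ) - ∫ ξ in Ioi (y a), φ a ξ * U a ξ
      = -(∫ s in a..b, ((boundaryGradient U y s + deriv y s * g s) * φ s (y s) - g s * φ1 s (y s)))
        + ∫ s in a..b, ∫ ξ in Ioi (y s), φ s ξ * totalSource α β lam U s ξ := by
  have hI : ∀ s ∈ Icc a b, s ∈ Ioo 0 H := fun s hs => ⟨ha.trans_le hs.1, hs.2.trans_lt hbH⟩
  have hτ : ∀ s ∈ Icc a b, s < τ := fun s hs => hs.2.trans_lt hb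
  have hyc : ContinuousOn y (Icc a b) := hU.y_cont.mono fun s hs => Ioo_subset_Icc_self (hI s hs)
  have hdyc : ContinuousOn (deriv y) (Icc a b) := hU.continuousOn_deriv_y.mono hI
  -- straightening the boundary
  have cmap : ContinuousOn (fun r : ℝ × ℝ => (r.1, y r.1 + r.2)) (Icc a b ×ˢ univ) :=
    continuousOn_fst.prodMk ((hyc.comp continuousOn_fst fun r hr => hr.1).add continuousOn_snd)
  have cmap1 : ContinuousOn (fun r : ℝ × ℝ => (r.1, y r.1 + r.2)) (Icc a b ×ˢ Ici 0) :=
    cmap.mono (prod_mono le_rfl (subset_univ _))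
  have cmap0 : ContinuousOn (fun r : ℝ × ℝ => (r.1, y r.1 + r.2)) (Icc a b ×ˢ Ioi 0) :=
    cmap.mono (prod_mono le_rfl (subset_univ _))
  have m0 : MapsTo (fun r : ℝ × ℝ => (r.1, y r.1 + r.2)) (Icc a b ×ˢ Ioi 0)
      {p | p.1 ∈ Ioo 0 H ∧ y p.1 < p.2} := fun r hr => ⟨hI _ hr.1, by simpa using hr.2⟩
  have m1 : MapsTo (fun r : ℝ × ℝ => (r.1, y r.1 + r.2)) (Icc a b ×ˢ Ici 0)
      {p | p.1 ∈ Icc 0 H ∧ y p.1 ≤ p.2} :=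
    fun r hr => ⟨Ioo_subset_Icc_self (hI _ hr.1), by simpa using hr.2⟩
  have m1' : MapsTo (fun r : ℝ × ℝ => (r.1, y r.1 + r.2)) (Icc a b ×ˢ Ici 0)
      {p | p.1 ∈ Ioc 0 H ∧ y p.1 ≤ p.2} :=
    fun r hr => ⟨Ioo_subset_Ioc_self (hI _ hr.1), by simpa using hr.2⟩
  have mτ : MapsTo (fun r : ℝ × ℝ => (r.1, y r.1 + r.2)) (Icc a b ×ˢ Ici 0) {p | p.1 < τ} :=
    fun r hr => hτ _ hr.1
  have mτ0 : MapsTo (fun r : ℝ × ℝ => (r.1, y r.1 + r.2)) (Icc a b ×ˢ Ioi 0) {p | p.1 < τ} :=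
    fun r hr => hτ _ hr.1
  have cU := hU.cont.comp cmap1 m1
  have cux := hU.grad_cont.comp cmap1 m1'
  have cφ := hφ.cont.comp cmap1 mτ
  have cφ1 := hφ.cont_one.comp cmap1 mτ
  have cφ2 := hφ.cont_two.comp cmap0 mτ0
  have cdy : ContinuousOn (fun r : ℝ × ℝ => deriv y r.1) (Icc a b ×ˢ Ici 0) :=
    hdyc.comp continuousOn_fst fun r hr => hr.1
  have ch := hU.continuousOn_totalSource.comp cmap0 m0
  have cut := hU.c12.cont_time.comp cmap0 m0
  have hsub : Icc a b ×ˢ Ioi (0 : ℝ) ⊆ Icc a b ×ˢ Ici 0 := prod_mono le_rfl Ioi_subset_Ici_self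
  -- the bounds
  obtain ⟨CU, AU, hCU, hAU, bU⟩ := hU.exists_growth
  obtain ⟨Ah, M, hAh, hM0, hMc, -, bh⟩ := hU.exists_totalSource_bound
  -- This rate of decay outweighs the growth of `U` and of the source and still leaves a factor
  -- `e^{-|ξ|}`, hence `e^{-z}` after the shift by the bounded `y s`.
  obtain ⟨Cφ, bφ⟩ := hφ.decay b hb (AU + Ah + 1)
  obtain ⟨CM, hCM⟩ := (isCompact_Icc (a := a) (b := b)).exists_bound_of_continuousOn
    (hMc.mono fun s hs => Ioo_subset_Ioc_self (hI s hs))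
  obtain ⟨Cy, hCy⟩ := (isCompact_Icc (a := a) (b := b)).exists_bound_of_continuousOn hyc
  obtain ⟨Cd, hCd⟩ := (isCompact_Icc (a := a) (b := b)).exists_bound_of_continuousOn hdyc
  have hCφ : 0 ≤ Cφ := by
    have := (abs_nonneg _).trans (bφ b ⟨by linarith, le_rfl⟩ 0).1
    simpa using this
  have hexp : ∀ s ∈ Icc a b, ∀ z, 0 < z → ∀ {B : ℝ}, B ≤ AU + Ah →
      Real.exp (-(AU + Ah + 1) * |y s + z|) * Real.exp (B * |y s + z|)
        ≤ Real.exp Cy * Real.exp (-z) := by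
    intro s hs z hz B hB
    rw [← Real.exp_add, ← Real.exp_add]
    apply Real.exp_le_exp.2
    have h1 := hCy s hs
    rw [Real.norm_eq_abs] at h1
    have h2 : z ≤ |y s + z| + |y s| := by
      calc z ≤ |z| := le_abs_self z
        _ = |(y s + z) - y s| := by ring_nf
        _ ≤ _ := abs_sub _ _
    nlinarith [abs_nonneg (y s + z)]
  have bUφ : ∀ s ∈ Icc a b, ∀ z, 0 < z → ∀ {w : ℝ},
      |w| ≤ Cφ * Real.exp (-(AU + Ah + 1) * |y s + z|) →
      |w * U s (y s + z)| ≤ Cφ * CU * Real.exp Cy * Real.exp (-z) := by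
    intro s hs z hz w hw
    have h1 := bU s (Ioo_subset_Icc_self (hI s hs)) (y s + z) (by linarith)
    rw [abs_mul]
    calc _ ≤ (Cφ * Real.exp (-(AU + Ah + 1) * |y s + z|)) * (CU * Real.exp (AU * |y s + z|)) := by
          gcongr
      _ = Cφ * CU * (Real.exp (-(AU + Ah + 1) * |y s + z|) * Real.exp (AU * |y s + z|)) := by ring
      _ ≤ Cφ * CU * (Real.exp Cy * Real.exp (-z)) :=
          mul_le_mul_of_nonneg_left (hexp s hs z hz (by linarith)) (by positivity)
      _ = _ := by ring
  have hs0 : ∀ s ∈ Icc a b, s ∈ Icc 0 b := fun s hs => ⟨ha.le.trans hs.1, hs.2⟩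
  set K := Cφ * CU * Real.exp Cy with hK
  have hK0 : 0 ≤ K := by positivity
  have hCd0 : 0 ≤ Cd := (norm_nonneg _).trans (hCd b (right_mem_Icc.2 hab))
  have hCM0 : 0 ≤ CM := (norm_nonneg _).trans (hCM b (right_mem_Icc.2 hab))
  set K' := K + Cφ * CM * Real.exp Cy + (2 * K + Cd * K) with hK'
  -- In the coordinate `z = ξ - y(s)` the domain is fixed. The density is `φU`; `B` is the Green
  -- flux `φU_ξ - φ_ξU` plus the transport term `y'φU` of the moving frame. Subtracting `(φU)_z`
  -- from `B` cancels the gradient of `U`, so the remainder `R = -2φ_ξU + y'φU` decays by the growth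
  -- bound on `U` alone.
  have key := half_strip_balance hab
    (p := fun s z => φ s (y s + z) * U s (y s + z))
    (B := fun s z => φ s (y s + z) * derivWithin (U s) (Ici (y s)) (y s + z)
      - φ1 s (y s + z) * U s (y s + z) + deriv y s * (φ s (y s + z) * U s (y s + z)))
    (q := fun s z => φ s (y s + z) * totalSource α β lam U s (y s + z))
    (pd := fun s z => (-φ2 s (y s + z) + deriv y s * φ1 s (y s + z)) * U s (y s + z)
      + φ s (y s + z) * (deriv (fun s' => U s' (y s + z)) s
        + deriv y s * derivWithin (U s) (Ici (y s)) (y s + z)))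
    (R := fun s z => -2 * (φ1 s (y s + z) * U s (y s + z))
      + deriv y s * (φ s (y s + z) * U s (y s + z))) (C := K')
    ?_ ?_ ?_ ?_ ?_ ?_ ?_ ?_ ?_ ?_ ?_
  · have e : ∀ s ∈ Icc a b, φ s (y s + 0) * derivWithin (U s) (Ici (y s)) (y s + 0)
        - φ1 s (y s + 0) * U s (y s + 0) + deriv y s * (φ s (y s + 0) * U s (y s + 0))
        = (boundaryGradient U y s + deriv y s * g s) * φ s (y s) - g s * φ1 s (y s) := by
      intro s hs
      rw [add_zero, hU.boundary s (Ioo_subset_Icc_self (hI s hs)), boundaryGradient]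
      ring
    rw [intervalIntegral.integral_congr (g := fun s => (boundaryGradient U y s + deriv y s * g s) *
      φ s (y s) - g s * φ1 s (y s)) (fun s hs => e s (by rwa [uIcc_of_le hab] at hs))] at key
    simpa only [integral_Ioi_add_left (fun ξ => φ b ξ * U b ξ) (y b),
      integral_Ioi_add_left (fun ξ => φ a ξ * U a ξ) (y a),
      fun s => integral_Ioi_add_left (fun ξ => φ s ξ * totalSource α β lam U s ξ) (y s)] using key
  · intro s hs z hz
    have hc : HasDerivAt (fun s => y s + z) (deriv y s) s := (hU.hasDerivAt_y (hI s hs)).add_const z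
    have h1 := hφ.hasDerivAt_curve (hτ s hs) hc
    have h2 := hasDerivAt_comp_of_partials hU.isOpen_region
      (v := U) (vt := fun s ξ => deriv (fun s' => U s' ξ) s) (vx := fun s ξ => deriv (U s) ξ)
      (fun p hp => (hU.c12.diff_time p hp).hasDerivAt)
      (fun p hp => (hU.c12.diff_space p hp).hasDerivAt) hU.c12.cont_time hU.c12.cont_space
      (hasDerivAt_id s) hc ⟨hI s hs, by simpa using hz⟩
    rw [derivWithin_eq (by linarith : y s < y s + z)]
    convert! h1.mul h2 using 1
    simp
  · intro s hs z hz
    have hlt : y s < y s + z := by linarith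
    have hz1 : HasDerivAt (fun z => y s + z) 1 z := (hasDerivAt_id z).const_add (y s)
    have d1 := (hφ.space s (hτ s hs) (y s + z)).comp z hz1
    have d2 := (hφ.space_two s (hτ s hs) (y s + z)).comp z hz1
    have d3 := (hU.hasDerivAt_space (Ioo_subset_Ioc_self (hI s hs)) hlt).comp z hz1
    have d4 := (hU.hasDerivAt_space_two (hI s hs) hlt).comp z hz1
    have := ((d1.mul d4).sub (d2.mul d3)).add ((d1.mul d3).const_mul (deriv y s))
    convert! this using 1
    rw [hU.totalSource_eq (hI s hs) hlt]
    simp only [Function.comp]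
    ring
  · intro s hs z hz
    have hlt : y s < y s + z := by linarith
    have hz1 : HasDerivAt (fun z => y s + z) 1 z := (hasDerivAt_id z).const_add (y s)
    have d1 := (hφ.space s (hτ s hs) (y s + z)).comp z hz1
    have d3 := (hU.hasDerivAt_space (Ioo_subset_Ioc_self (hI s hs)) hlt).comp z hz1
    convert! d1.mul d3 using 1
    simp only [Function.comp]
    ring
  · exact (((cφ2.neg.add ((cdy.mono hsub).mul (cφ1.mono hsub))).mul (cU.mono hsub))).add
      ((cφ.mono hsub).mul (cut.add ((cdy.mono hsub).mul (cux.mono hsub))))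
  · exact (cφ.mono hsub).mul ch
  · exact cφ.mul cU
  · exact ((cφ.mul cux).sub (cφ1.mul cU)).add (cdy.mul (cφ.mul cU))
  · exact ((continuousOn_const (c := (-2 : ℝ))).mul (cφ1.mul cU)).add (cdy.mul (cφ.mul cU))
  · intro s hs z hz
    refine (bUφ s hs z hz (bφ s (hs0 s hs) _).1).trans ?_
    have : K ≤ K' := by rw [hK']; nlinarith [Real.exp_pos Cy, mul_nonneg hCφ hCM0, mul_nonneg hCd0 hK0, mul_nonneg (mul_nonneg hCφ hCM0) (Real.exp_pos Cy).le]
    gcongr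
  · intro s hs z hz
    have h1 := bh s (hI s hs) (y s + z) (by linarith)
    have h2 := (bφ s (hs0 s hs) (y s + z)).1
    have h3 : M s ≤ CM := (le_abs_self _).trans (hCM s hs)
    rw [abs_mul]
    calc _ ≤ (Cφ * Real.exp (-(AU + Ah + 1) * |y s + z|)) * (CM * Real.exp (Ah * |y s + z|)) := by
          refine mul_le_mul h2 (h1.trans ?_) (abs_nonneg _) (by positivity)
          gcongr
      _ = Cφ * CM * (Real.exp (-(AU + Ah + 1) * |y s + z|) * Real.exp (Ah * |y s + z|)) := by ring
      _ ≤ Cφ * CM * (Real.exp Cy * Real.exp (-z)) :=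
          mul_le_mul_of_nonneg_left (hexp s hs z hz (by linarith)) (by positivity)
      _ = Cφ * CM * Real.exp Cy * Real.exp (-z) := by ring
      _ ≤ _ := by
          have : Cφ * CM * Real.exp Cy ≤ K' := by rw [hK']; nlinarith [mul_nonneg hCd0 hK0]
          gcongr
  · intro s hs z hz
    have h1 := bUφ s hs z hz (bφ s (hs0 s hs) _).1
    have h2 := bUφ s hs z hz (bφ s (hs0 s hs) _).2
    calc _ ≤ |-2 * (φ1 s (y s + z) * U s (y s + z))|
          + |deriv y s * (φ s (y s + z) * U s (y s + z))| := abs_add_le _ _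
      _ ≤ 2 * (K * Real.exp (-z)) + Cd * (K * Real.exp (-z)) := by
          rw [abs_mul (-2), abs_mul (deriv y s)]
          have := hCd s hs
          rw [Real.norm_eq_abs] at this
          rw [show |(-2 : ℝ)| = 2 by norm_num]
          exact add_le_add (mul_le_mul_of_nonneg_left h2 two_pos.le)
            (mul_le_mul this h1 (abs_nonneg _) hCd0)
      _ = (2 * K + Cd * K) * Real.exp (-z) := by ring
      _ ≤ _ := by
          have : 2 * K + Cd * K ≤ K' := by rw [hK']; nlinarith [mul_nonneg (mul_nonneg hCφ hCM0) (Real.exp_pos Cy).le]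
          gcongr

end IsMovingBoundarySolution


/-! ### Green's identity down to the initial time. -/

theorem tendsto_intervalIntegral_left {F : ℝ → ℝ} {a b : ℝ} (hab : a < b)
    (hF : IntervalIntegrable F volume a b) :
    Tendsto (fun c => ∫ s in c..b, F s) (𝓝[>] a) (𝓝 (∫ s in a..b, F s)) := by
  have h := intervalIntegral.continuousOn_primitive_interval' hF right_mem_uIcc
  have h1 := (h a left_mem_uIcc).neg
  rw [uIcc_of_le hab.le] at h1
  have h2 := h1.mono_left (nhdsWithin_le_of_mem (Icc_mem_nhdsGT hab))
  simp only [Pi.neg_apply] at h2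
  rw [← intervalIntegral.integral_symm] at h2
  refine h2.congr fun c => ?_
  rw [Pi.neg_apply, ← intervalIntegral.integral_symm]

theorem tendsto_intervalIntegral_right {F : ℝ → ℝ} {a b : ℝ} (hab : a < b)
    (hF : IntervalIntegrable F volume a b) :
    Tendsto (fun c => ∫ s in a..c, F s) (𝓝[<] b) (𝓝 (∫ s in a..b, F s)) := by
  have h := intervalIntegral.continuousOn_primitive_interval' hF left_mem_uIcc
  have h1 := h b right_mem_uIcc
  rw [uIcc_of_le hab.le] at h1
  exact h1.mono_left (nhdsWithin_le_of_mem (Icc_mem_nhdsLT hab))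

theorem integrable_exp_neg_abs : Integrable (fun x : ℝ => Real.exp (-|x|)) := by
  rw [← integrableOn_univ, ← Iic_union_Ioi (a := (0 : ℝ))]
  refine IntegrableOn.union ?_ ?_
  · refine (integrableOn_exp_Iic 0).congr_fun (fun x hx => ?_) measurableSet_Iic
    simp only [abs_of_nonpos (show x ≤ 0 from hx), neg_neg]
  · refine (integrableOn_exp_neg_Ioi 0).congr_fun (fun x hx => ?_) measurableSet_Ioi
    simp only [abs_of_pos (show 0 < x from hx)]

namespace IsMovingBoundarySolution

variable {H : ℝ} {α β : ℝ → ℝ} {lam : ℝ → ℝ → ℝ} {f g y : ℝ → ℝ} {U : ℝ → ℝ → ℝ}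

theorem continuousOn_kernel_boundary (hU : IsMovingBoundarySolution H α β lam f g y U) {τ b : ℝ}
    {φ : ℝ → ℝ → ℝ} (hφ : ContinuousOn (fun p : ℝ × ℝ => φ p.1 p.2) {p | p.1 < τ})
    (hb : b < τ) (hbH : b ≤ H) : ContinuousOn (fun s => φ s (y s)) (Icc 0 b) :=
  hφ.comp (f := fun s => (s, y s))
    (continuousOn_id.prodMk (hU.y_cont.mono (Icc_subset_Icc_right hbH)))
    fun _ hs => hs.2.trans_lt hb

theorem intervalIntegrable_flux (hU : IsMovingBoundarySolution H α β lam f g y U) {b : ℝ}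
    (hb0 : 0 ≤ b) (hbH : b ≤ H) :
    IntervalIntegrable (fun s => boundaryGradient U y s + deriv y s * g s) volume 0 b := by
  have h : IntervalIntegrable (fun s => boundaryGradient U y s + deriv y s * g s) volume 0 H :=
    hU.grad_int.add (hU.y_speed.mul_continuousOn (by rw [uIcc_of_le hU.horizon_pos.le]; exact hU.g_cont))
  exact h.mono_set (by rw [uIcc_of_le hb0, uIcc_of_le hU.horizon_pos.le]; exact Icc_subset_Icc_right hbH)

/-- With `ξ = y(a) + z` the domain no longer depends on `a`; `U` is continuous up to time `0`, and
dominated convergence applies. Times are kept below `τ/2` only to stay away from the pole of the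
test function. -/
theorem tendsto_moment_zero (hU : IsMovingBoundarySolution H α β lam f g y U) {τ : ℝ}
    {φ φ1 φ2 : ℝ → ℝ → ℝ} (hφ : IsBackwardHeatTest τ φ φ1 φ2) (hτ : 0 < τ) (hτH : τ ≤ H) :
    Tendsto (fun a => ∫ ξ in Ioi (y a), φ a ξ * U a ξ) (𝓝[>] 0)
      (𝓝 (∫ ξ in Ioi (y 0), φ 0 ξ * f ξ)) := by
  set b := τ / 2 with hbdef
  have hb : 0 < b := by positivity
  have hbτ : b < τ := by rw [hbdef]; linarith
  have hbH : b ≤ H := by linarith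
  obtain ⟨CU, A, hCU, hA, bU⟩ := hU.exists_growth
  obtain ⟨Cφ, bφ⟩ := hφ.decay b hbτ (A + 1)
  obtain ⟨Cy, hCy⟩ := (isCompact_Icc (a := 0) (b := H)).exists_bound_of_continuousOn hU.y_cont
  have hCφ : 0 ≤ Cφ := by
    have := (abs_nonneg _).trans (bφ b ⟨hb.le, le_rfl⟩ 0).1
    simpa using this
  have e0 : ∫ ξ in Ioi (y 0), φ 0 ξ * f ξ = ∫ ξ in Ioi (y 0), φ 0 ξ * U 0 ξ :=
    setIntegral_congr_fun measurableSet_Ioi fun ξ hξ => by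
      simp only [hU.initial ξ (le_of_lt hξ)]
  rw [e0]
  simp only [← fun s => integral_Ioi_add_left (fun ξ => φ s ξ * U s ξ) (y s)]
  have hmem : ∀ᶠ a in 𝓝[>] (0 : ℝ), a ∈ Icc 0 b := by
    filter_upwards [Ioc_mem_nhdsGT hb] with a ha using ⟨ha.1.le, ha.2⟩
  -- joint continuity in straightened coordinates
  have hc : ContinuousOn (fun r : ℝ × ℝ => φ r.1 (y r.1 + r.2) * U r.1 (y r.1 + r.2))
      (Icc 0 b ×ˢ Ici 0) := by
    have cmap : ContinuousOn (fun r : ℝ × ℝ => (r.1, y r.1 + r.2)) (Icc 0 b ×ˢ Ici 0) :=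
      continuousOn_fst.prodMk (((hU.y_cont.mono (Icc_subset_Icc_right hbH)).comp continuousOn_fst
        fun r hr => hr.1).add continuousOn_snd)
    exact (hφ.cont.comp cmap fun r hr => hr.1.2.trans_lt hbτ).mul
      (hU.cont.comp cmap fun r hr => ⟨⟨hr.1.1, hr.1.2.trans hbH⟩, by simpa using hr.2⟩)
  refine tendsto_integral_filter_of_dominated_convergence
    (fun z => Cφ * CU * Real.exp Cy * Real.exp (-z)) ?_ ?_
    ((integrableOn_exp_neg_Ioi 0).const_mul _) ?_
  · filter_upwards [hmem] with a ha
    exact (hc.comp (f := fun z : ℝ => (a, z)) (by fun_prop)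
      (fun z (hz : 0 < z) => ⟨ha, hz.le⟩)).aestronglyMeasurable measurableSet_Ioi
  · filter_upwards [hmem] with s hs
    refine (ae_restrict_iff' measurableSet_Ioi).2 (ae_of_all _ fun z (hz : 0 < z) => ?_)
    have hs' : s ∈ Icc 0 H := ⟨hs.1, hs.2.trans hbH⟩
    have h1 := bU s hs' (y s + z) (by linarith)
    have h2 := (bφ s hs (y s + z)).1
    have h3 := hCy s hs'
    rw [Real.norm_eq_abs] at h3 ⊢
    have h4 : z ≤ |y s + z| + |y s| := by
      calc z ≤ |z| := le_abs_self z
        _ = |(y s + z) - y s| := by ring_nf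
        _ ≤ _ := abs_sub _ _
    rw [abs_mul]
    calc _ ≤ (Cφ * Real.exp (-(A + 1) * |y s + z|)) * (CU * Real.exp (A * |y s + z|)) :=
          mul_le_mul h2 h1 (abs_nonneg _) (by positivity)
      _ = Cφ * CU * Real.exp (-|y s + z|) := by
          rw [show -|y s + z| = -(A + 1) * |y s + z| + A * |y s + z| by ring, Real.exp_add]; ring
      _ ≤ Cφ * CU * Real.exp (Cy + -z) := by
          gcongr; linarith
      _ = _ := by rw [Real.exp_add]; ring
  · refine (ae_restrict_iff' measurableSet_Ioi).2 (ae_of_all _ fun z (hz : 0 < z) => ?_)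
    have h1 := hc (0, z) ⟨⟨le_rfl, hb.le⟩, hz.le⟩
    refine Tendsto.comp (g := fun r : ℝ × ℝ => φ r.1 (y r.1 + r.2) * U r.1 (y r.1 + r.2))
      (f := fun a : ℝ => (a, z)) h1 ?_
    refine tendsto_nhdsWithin_iff.2 ⟨?_, ?_⟩
    · exact ((continuous_id.prodMk continuous_const).tendsto 0).mono_left nhdsWithin_le_nhds
    · filter_upwards [hmem] with a ha using ⟨ha, hz.le⟩

/-- Green's identity from the initial time. -/
theorem green_identity_initial (hU : IsMovingBoundarySolution H α β lam f g y U) {τ b : ℝ}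
    {φ φ1 φ2 : ℝ → ℝ → ℝ} (hφ : IsBackwardHeatTest τ φ φ1 φ2) (hb0 : 0 < b) (hb : b < τ)
    (hτH : τ ≤ H) :
    IntervalIntegrable (fun s => (boundaryGradient U y s + deriv y s * g s) * φ s (y s))
      volume 0 b ∧
    IntervalIntegrable (fun s => g s * φ1 s (y s)) volume 0 b ∧
    (∫ ξ in Ioi (y b), φ b ξ * U b ξ) - ∫ ξ in Ioi (y 0), φ 0 ξ * f ξ
      = -(∫ s in (0 : ℝ)..b, (boundaryGradient U y s + deriv y s * g s) * φ s (y s))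
        + (∫ s in (0 : ℝ)..b, g s * φ1 s (y s))
        + ∫ s in (0 : ℝ)..b, ∫ ξ in Ioi (y s), φ s ξ * totalSource α β lam U s ξ := by
  have hbH : b < H := hb.trans_le hτH
  have huIcc : uIcc 0 b = Icc 0 b := uIcc_of_le hb0.le
  have i1 : IntervalIntegrable (fun s => (boundaryGradient U y s + deriv y s * g s) * φ s (y s))
      volume 0 b :=
    (hU.intervalIntegrable_flux hb0.le hbH.le).mul_continuousOn (by
      rw [huIcc]; exact hU.continuousOn_kernel_boundary hφ.cont hb hbH.le)
  have i2 : IntervalIntegrable (fun s => g s * φ1 s (y s)) volume 0 b :=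
    ContinuousOn.intervalIntegrable (by
      rw [huIcc]
      exact (hU.g_cont.mono (Icc_subset_Icc_right hbH.le)).mul
        (hU.continuousOn_kernel_boundary hφ.cont_one hb hbH.le))
  have i3 : IntervalIntegrable
      (fun s => ∫ ξ in Ioi (y s), φ s ξ * totalSource α β lam U s ξ) volume 0 b := by
    obtain ⟨A, M, hA, hM0, -, hMi, bh⟩ := hU.exists_totalSource_bound
    obtain ⟨C, bφ⟩ := hφ.decay b hb (A + 1)
    have hC : 0 ≤ C := by
      have := (abs_nonneg _).trans (bφ b ⟨hb0.le, le_rfl⟩ 0).1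
      simpa using this
    have hsub : ∀ s ∈ Ioo 0 b, s ∈ Ioo 0 H := fun s hs => ⟨hs.1, hs.2.trans hbH⟩
    refine (integrableOn_region hb0.le (y := y)
      (hU.y_cont.mono fun s hs => Ioo_subset_Icc_self (hsub s hs))
      (F := fun s ξ => φ s ξ * totalSource α β lam U s ξ)
      (k := fun s ξ => M s * C * Real.exp (-|ξ|))
      (N := fun s => M s * (C * ∫ ξ, Real.exp (-|ξ|))) ?_ ?_ ?_ ?_ ?_ ?_).2
    · exact (hφ.cont.mono fun p hp => hp.1.2.trans hb).mul
        (hU.continuousOn_totalSource.mono fun p hp => ⟨hsub _ hp.1, hp.2⟩)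
    · intro s hs ξ hξ
      rw [abs_mul]
      calc _ ≤ (C * Real.exp (-(A + 1) * |ξ|)) * (M s * Real.exp (A * |ξ|)) :=
            mul_le_mul (bφ s (Ioo_subset_Icc_self hs) ξ).1 (bh s (hsub s hs) ξ hξ) (abs_nonneg _)
              (by positivity)
        _ = _ := by
            rw [show -|ξ| = -(A + 1) * |ξ| + A * |ξ| by ring, Real.exp_add]; ring
    · intro s hs ξ
      have := hM0 s
      positivity
    · intro s hs
      exact integrable_exp_neg_abs.const_mul _
    · intro s hs
      rw [integral_const_mul]
      exact (mul_assoc _ _ _).le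
    · refine IntervalIntegrable.mul_const (hMi.mono_set ?_) _
      rw [huIcc, uIcc_of_le hU.horizon_pos.le]
      exact Icc_subset_Icc_right hbH.le
  refine ⟨i1, i2, ?_⟩
  -- Both sides of the identity on `[a, b]` converge as `a ↓ 0`. Integrability of the boundary
  -- gradient, of `y'` and of the source bound is enough here; they may blow up at `0`.
  have hl : Tendsto (fun a => (∫ ξ in Ioi (y b), φ b ξ * U b ξ) - ∫ ξ in Ioi (y a), φ a ξ * U a ξ)
      (𝓝[>] 0) (𝓝 ((∫ ξ in Ioi (y b), φ b ξ * U b ξ) - ∫ ξ in Ioi (y 0), φ 0 ξ * f ξ)) :=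
    tendsto_const_nhds.sub (hU.tendsto_moment_zero hφ (hb0.trans hb) hτH)
  have hr := ((tendsto_intervalIntegral_left hb0 (i1.sub i2)).neg.add
    (tendsto_intervalIntegral_left hb0 i3))
  have hev : ∀ᶠ a in 𝓝[>] (0 : ℝ), a ∈ Ioo 0 b := Ioo_mem_nhdsGT hb0
  have := tendsto_nhds_unique (hl.congr' (by
    filter_upwards [hev] with a ha using hU.green_identity hφ ha.1 ha.2.le hb hbH)) hr
  rw [this, intervalIntegral.integral_sub i1 i2]
  ring

end IsMovingBoundarySolution


/-! ### The heat kernel, its derivatives and its decay. -/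

/-- The backward heat kernel with pole at `(τ, x)`. -/
noncomputable def heatKernel (x τ s ξ : ℝ) : ℝ :=
  1 / (2 * √(Real.pi * (τ - s))) * Real.exp (-(ξ - x) ^ 2 / (4 * (τ - s)))

/-- The space derivative of `heatKernel`. -/
noncomputable def heatKernel₁ (x τ s ξ : ℝ) : ℝ :=
  -(ξ - x) / (2 * (τ - s)) * heatKernel x τ s ξ

/-- The second space derivative of `heatKernel`. -/
noncomputable def heatKernel₂ (x τ s ξ : ℝ) : ℝ :=
  ((ξ - x) ^ 2 / (4 * (τ - s) ^ 2) - 1 / (2 * (τ - s))) * heatKernel x τ s ξ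

/-- The third space derivative of `heatKernel`. -/
noncomputable def heatKernel₃ (x τ s ξ : ℝ) : ℝ :=
  (3 * (ξ - x) / (4 * (τ - s) ^ 2) - (ξ - x) ^ 3 / (8 * (τ - s) ^ 3)) * heatKernel x τ s ξ

section HeatKernel

variable {x τ s : ℝ}

theorem hasDerivAt_heatKernel (ξ : ℝ) :
    HasDerivAt (heatKernel x τ s) (heatKernel₁ x τ s ξ) ξ := by
  have h1 : HasDerivAt (fun ξ => -(ξ - x) ^ 2 / (4 * (τ - s))) (-(2 * (ξ - x)) / (4 * (τ - s))) ξ := by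
    have := (((hasDerivAt_id ξ).sub_const x).pow 2).neg.div_const (4 * (τ - s))
    simpa using this
  have h2 := h1.exp.const_mul (1 / (2 * √(Real.pi * (τ - s))))
  convert! h2 using 1
  simp only [heatKernel₁, heatKernel]
  rw [show -(2 * (ξ - x)) / (4 * (τ - s)) = -(ξ - x) / (2 * (τ - s)) by
    rw [show (4 : ℝ) * (τ - s) = 2 * (2 * (τ - s)) by ring,
      show -(2 * (ξ - x)) = 2 * (-(ξ - x)) by ring, mul_div_mul_left _ _ two_ne_zero]]
  ring

theorem hasDerivAt_heatKernel₁ (hs : s < τ) (ξ : ℝ) :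
    HasDerivAt (heatKernel₁ x τ s) (heatKernel₂ x τ s ξ) ξ := by
  have hδ : τ - s ≠ 0 := (sub_pos.2 hs).ne'
  have h1 : HasDerivAt (fun ξ => -(ξ - x) / (2 * (τ - s))) (-1 / (2 * (τ - s))) ξ :=
    ((hasDerivAt_id ξ).sub_const x).neg.div_const _
  convert! h1.mul (hasDerivAt_heatKernel ξ) using 1
  simp only [heatKernel₁, heatKernel₂]
  field_simp
  ring

theorem hasDerivAt_heatKernel₂ (hs : s < τ) (ξ : ℝ) :
    HasDerivAt (heatKernel₂ x τ s) (heatKernel₃ x τ s ξ) ξ := by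
  have hδ : τ - s ≠ 0 := (sub_pos.2 hs).ne'
  have h1 : HasDerivAt (fun ξ => (ξ - x) ^ 2 / (4 * (τ - s) ^ 2) - 1 / (2 * (τ - s)))
      (2 * (ξ - x) / (4 * (τ - s) ^ 2)) ξ := by
    have := ((((hasDerivAt_id ξ).sub_const x).pow 2).div_const (4 * (τ - s) ^ 2)).sub_const
      (1 / (2 * (τ - s)))
    simpa using this
  convert! h1.mul (hasDerivAt_heatKernel ξ) using 1
  simp only [heatKernel₁, heatKernel₃]
  field_simp
  ring

theorem hasDerivAt_heatKernel_time (hs : s < τ) (ξ : ℝ) :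
    HasDerivAt (fun s => heatKernel x τ s ξ) (-heatKernel₂ x τ s ξ) s := by
  have hδ : 0 < τ - s := sub_pos.2 hs
  have hδ' := hδ.ne'
  have hpi := Real.pi_pos
  have d0 : HasDerivAt (fun s : ℝ => τ - s) (-1) s := by simpa using (hasDerivAt_id s).const_sub τ
  have d1 : HasDerivAt (fun s : ℝ => √(Real.pi * (τ - s)))
      (Real.pi * (-1) / (2 * √(Real.pi * (τ - s)))) s :=
    (d0.const_mul Real.pi).sqrt (by positivity)
  have hsq : 0 < √(Real.pi * (τ - s)) := Real.sqrt_pos.2 (by positivity)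
  have d2 := (d1.const_mul 2).inv (by positivity)
  have d3 : HasDerivAt (fun s : ℝ => -(ξ - x) ^ 2 / (4 * (τ - s)))
      (-(-(ξ - x) ^ 2 * (4 * (-1))) / (4 * (τ - s)) ^ 2) s := by
    convert! (hasDerivAt_const s (-(ξ - x) ^ 2)).div (d0.const_mul 4) (by positivity) using 1
    simp
  have d4 := d2.mul d3.exp
  have hs2 : √(Real.pi * (τ - s)) ^ 2 = Real.pi * (τ - s) := Real.sq_sqrt (by positivity)
  convert! d4 using 1
  · ext s'
    simp [heatKernel]
  · simp only [heatKernel₂, heatKernel, Pi.inv_apply]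
    generalize Real.exp (-(ξ - x) ^ 2 / (4 * (τ - s))) = E
    generalize √(Real.pi * (τ - s)) = r at *
    -- Eliminating `π` in favour of `r²` turns the claim into an identity of rational functions in
    -- `r` and `τ - s`.
    have hpi' : Real.pi = r ^ 2 / (τ - s) := by field_simp; linarith
    rw [hpi']
    field_simp
    ring

theorem hasDerivAt_heatKernel₁_time (hs : s < τ) (ξ : ℝ) :
    HasDerivAt (fun s => heatKernel₁ x τ s ξ) (-heatKernel₃ x τ s ξ) s := by
  have hδ' : τ - s ≠ 0 := (sub_pos.2 hs).ne'
  have d0 : HasDerivAt (fun s : ℝ => τ - s) (-1) s := by simpa using (hasDerivAt_id s).const_sub τ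
  have d1 : HasDerivAt (fun s : ℝ => -(ξ - x) / (2 * (τ - s)))
      (-(-(ξ - x) * (2 * (-1))) / (2 * (τ - s)) ^ 2) s := by
    convert! (hasDerivAt_const s (-(ξ - x))).div (d0.const_mul 2) (by simpa using hδ') using 1
    simp
  convert! d1.mul (hasDerivAt_heatKernel_time hs ξ) using 1
  simp only [heatKernel₂, heatKernel₃]
  field_simp
  ring

theorem continuousOn_heatKernel :
    ContinuousOn (fun p : ℝ × ℝ => heatKernel x τ p.1 p.2) {p | p.1 < τ} := by
  unfold heatKernel
  have h1 : ∀ p ∈ {p : ℝ × ℝ | p.1 < τ}, 0 < τ - p.1 := fun p hp => sub_pos.2 hp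
  refine (ContinuousOn.div₀ continuousOn_const (by fun_prop) fun p hp => ?_).mul
    (ContinuousOn.rexp (ContinuousOn.div₀ (by fun_prop) (by fun_prop) fun p hp => ?_))
  · have := h1 p hp
    have := Real.pi_pos
    positivity
  · have := h1 p hp
    positivity

theorem continuousOn_heatKernel₁ :
    ContinuousOn (fun p : ℝ × ℝ => heatKernel₁ x τ p.1 p.2) {p | p.1 < τ} := by
  have h1 : ∀ p ∈ {p : ℝ × ℝ | p.1 < τ}, 0 < τ - p.1 := fun p hp => sub_pos.2 hp
  refine (ContinuousOn.div₀ (by fun_prop) (by fun_prop) fun p hp => ?_).mul continuousOn_heatKernel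
  have := h1 p hp
  positivity

theorem continuousOn_heatKernel₂ :
    ContinuousOn (fun p : ℝ × ℝ => heatKernel₂ x τ p.1 p.2) {p | p.1 < τ} := by
  have h1 : ∀ p ∈ {p : ℝ × ℝ | p.1 < τ}, 0 < τ - p.1 := fun p hp => sub_pos.2 hp
  refine ((ContinuousOn.div₀ (by fun_prop) (by fun_prop) fun p hp => ?_).sub
    (ContinuousOn.div₀ (by fun_prop) (by fun_prop) fun p hp => ?_)).mul continuousOn_heatKernel <;>
  · have := h1 p hp
    positivity

theorem continuousOn_heatKernel₃ :
    ContinuousOn (fun p : ℝ × ℝ => heatKernel₃ x τ p.1 p.2) {p | p.1 < τ} := by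
  have h1 : ∀ p ∈ {p : ℝ × ℝ | p.1 < τ}, 0 < τ - p.1 := fun p hp => sub_pos.2 hp
  refine ((ContinuousOn.div₀ (by fun_prop) (by fun_prop) fun p hp => ?_).sub
    (ContinuousOn.div₀ (by fun_prop) (by fun_prop) fun p hp => ?_)).mul continuousOn_heatKernel <;>
  · have := h1 p hp
    positivity

theorem heatKernel_nonneg (ξ : ℝ) : 0 ≤ heatKernel x τ s ξ := by
  unfold heatKernel; positivity

/-- A Gaussian, with a quadratic factor, decays faster than every exponential. -/
theorem exists_gaussian_le_exp {T : ℝ} (hT : 0 < T) (A x : ℝ) : ∃ C, 0 ≤ C ∧ ∀ ξ : ℝ,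
    (1 + |ξ - x| + |ξ - x| ^ 2) * Real.exp (-(ξ - x) ^ 2 / (4 * T)) ≤ C * Real.exp (-A * |ξ|) := by
  -- The factor `2` comes from `1 + d + d² ≤ 2e^d` with `d = |ξ - x|`. Together with `|ξ| ≤ |x| + d`
  -- this leaves the linear exponent `(|A| + 1)d`, and completing the square against `d²/(4T)` costs
  -- `(|A| + 1)²T`.
  refine ⟨2 * Real.exp ((|A| + 1) ^ 2 * T + |A| * |x|), by positivity, fun ξ => ?_⟩
  set d := |ξ - x| with hd
  have hd0 : 0 ≤ d := abs_nonneg _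
  have h1 : 1 + d + d ^ 2 ≤ 2 * Real.exp d := by
    have := Real.quadratic_le_exp_of_nonneg hd0
    nlinarith
  have h2 : |ξ| ≤ |x| + d := by
    calc |ξ| = |x + (ξ - x)| := by ring_nf
      _ ≤ _ := abs_add_le _ _
  have h3 : A * |ξ| ≤ |A| * (|x| + d) :=
    (mul_le_mul_of_nonneg_right (le_abs_self A) (abs_nonneg _)).trans
      (mul_le_mul_of_nonneg_left h2 (abs_nonneg _))
  have h4 : d * (|A| + 1) ≤ d ^ 2 / (4 * T) + (|A| + 1) ^ 2 * T := by
    have h := sq_nonneg (d / (2 * T) - (|A| + 1))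
    have e : d ^ 2 / (4 * T) + (|A| + 1) ^ 2 * T - d * (|A| + 1)
        = T * (d / (2 * T) - (|A| + 1)) ^ 2 := by
      field_simp; ring
    nlinarith [mul_nonneg hT.le h]
  rw [show (ξ - x) ^ 2 = d ^ 2 by rw [hd, sq_abs]]
  calc _ ≤ (2 * Real.exp d) * Real.exp (-d ^ 2 / (4 * T)) := by gcongr
    _ = 2 * Real.exp (d + -d ^ 2 / (4 * T)) := by rw [Real.exp_add]; ring
    _ ≤ 2 * Real.exp ((|A| + 1) ^ 2 * T + |A| * |x| + -A * |ξ|) := by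
        refine mul_le_mul_of_nonneg_left (Real.exp_le_exp.2 ?_) two_pos.le
        rw [neg_div]
        nlinarith
    _ = _ := by rw [Real.exp_add]; ring

/-- Uniformity on `[0, b]`: the Gaussian is largest in width at `s = 0`, where the exponent has
denominator `4τ`, while the powers of `1/(τ - s)` are largest at `s = b`. -/
theorem exists_heatKernel_decay {b : ℝ} (hb : b < τ) (hτ : 0 < τ) (A x : ℝ) :
    ∃ C, ∀ s ∈ Icc 0 b, ∀ ξ,
      |heatKernel x τ s ξ| ≤ C * Real.exp (-A * |ξ|) ∧
      |heatKernel₁ x τ s ξ| ≤ C * Real.exp (-A * |ξ|) ∧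
      |heatKernel₂ x τ s ξ| ≤ C * Real.exp (-A * |ξ|) := by
  obtain ⟨C, hC, h⟩ := exists_gaussian_le_exp hτ A x
  set e := 1 / (τ - b) with he
  have hτb : 0 < τ - b := sub_pos.2 hb
  have he0 : 0 < e := by positivity
  set c := 1 / (2 * √(Real.pi * (τ - b))) with hc
  have hc0 : 0 ≤ c := by positivity
  refine ⟨c * (1 + e + e ^ 2) * C, fun s hs ξ => ?_⟩
  have hδ : 0 < τ - s := by linarith [hs.2]
  have hpi := Real.pi_pos
  set d := |ξ - x| with hd
  have hd0 : 0 ≤ d := abs_nonneg _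
  set E := Real.exp (-(ξ - x) ^ 2 / (4 * τ)) with hE
  have hE0 : 0 < E := Real.exp_pos _
  have hG : heatKernel x τ s ξ ≤ c * E := by
    unfold heatKernel
    have h1 : 1 / (2 * √(Real.pi * (τ - s))) ≤ c := by
      apply one_div_le_one_div_of_le
      · positivity
      · gcongr; exact hs.2
    have h2 : Real.exp (-(ξ - x) ^ 2 / (4 * (τ - s))) ≤ E := by
      apply Real.exp_le_exp.2
      rw [neg_div, neg_div, neg_le_neg_iff]
      gcongr
      linarith [hs.1]
    exact mul_le_mul h1 h2 (Real.exp_pos _).le hc0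
  have hδe : 1 / (τ - s) ≤ e := by
    apply one_div_le_one_div_of_le hτb
    linarith [hs.2]
  have hδ0 : 0 ≤ 1 / (τ - s) := by positivity
  have main : ∀ w : ℝ, |w| ≤ (1 + e + e ^ 2) * (1 + d + d ^ 2) →
      |w * heatKernel x τ s ξ| ≤ c * (1 + e + e ^ 2) * C * Real.exp (-A * |ξ|) := by
    intro w hw
    rw [abs_mul, abs_of_nonneg (heatKernel_nonneg ξ)]
    calc _ ≤ ((1 + e + e ^ 2) * (1 + d + d ^ 2)) * (c * E) :=
          mul_le_mul hw hG (heatKernel_nonneg ξ) (by positivity)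
      _ = c * (1 + e + e ^ 2) * ((1 + d + d ^ 2) * E) := by ring
      _ ≤ c * (1 + e + e ^ 2) * (C * Real.exp (-A * |ξ|)) :=
          mul_le_mul_of_nonneg_left (h ξ) (by positivity)
      _ = _ := by ring
  refine ⟨?_, ?_, ?_⟩
  · have h1 : (1 : ℝ) ≤ (1 + e + e ^ 2) * (1 + d + d ^ 2) :=
      one_le_mul_of_one_le_of_one_le (by nlinarith [sq_nonneg e]) (by nlinarith [sq_nonneg d])
    simpa using main 1 (by rwa [abs_one])
  · refine main _ ?_
    have : |-(ξ - x) / (2 * (τ - s))| = d * (1 / (τ - s)) / 2 := by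
      rw [abs_div, abs_neg, abs_of_pos (by positivity : 0 < 2 * (τ - s)), ← hd]
      field_simp
    rw [this]
    nlinarith [mul_le_mul_of_nonneg_left hδe hd0, mul_nonneg he0.le hd0, sq_nonneg e, sq_nonneg d,
      mul_nonneg (sq_nonneg e) hd0, mul_nonneg (sq_nonneg e) (sq_nonneg d),
      mul_nonneg he0.le (sq_nonneg d)]
  · refine main _ ?_
    have h1 : |(ξ - x) ^ 2 / (4 * (τ - s) ^ 2) - 1 / (2 * (τ - s))|
        ≤ d ^ 2 * (1 / (τ - s)) ^ 2 / 4 + (1 / (τ - s)) / 2 := by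
      refine (abs_sub _ _).trans (le_of_eq ?_)
      rw [abs_of_nonneg (by positivity), abs_of_nonneg (by positivity), hd, sq_abs]
      field_simp
    have h2 : (1 / (τ - s)) ^ 2 ≤ e ^ 2 := by gcongr
    refine h1.trans ?_
    nlinarith [mul_le_mul_of_nonneg_left h2 (sq_nonneg d), mul_nonneg he0.le hd0, sq_nonneg e,
      sq_nonneg d, mul_nonneg (sq_nonneg e) hd0, mul_nonneg (sq_nonneg e) (sq_nonneg d),
      mul_nonneg he0.le (sq_nonneg d)]

theorem isBackwardHeatTest_heatKernel (hτ : 0 < τ) (x : ℝ) :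
    IsBackwardHeatTest τ (heatKernel x τ) (heatKernel₁ x τ) (heatKernel₂ x τ) where
  space _ _ ξ := hasDerivAt_heatKernel ξ
  space_two _ hs ξ := hasDerivAt_heatKernel₁ hs ξ
  time _ hs ξ := hasDerivAt_heatKernel_time hs ξ
  cont := continuousOn_heatKernel
  cont_one := continuousOn_heatKernel₁
  cont_two := continuousOn_heatKernel₂
  decay b hb A := by
    obtain ⟨C, h⟩ := exists_heatKernel_decay hb hτ A x
    exact ⟨C, fun s hs ξ => ⟨(h s hs ξ).1, (h s hs ξ).2.1⟩⟩

/-- The space derivative of a caloric function is caloric. This is the test function behind the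
boundary equation, and the reason for computing third derivatives. -/
theorem isBackwardHeatTest_heatKernel₁ (hτ : 0 < τ) (x : ℝ) :
    IsBackwardHeatTest τ (heatKernel₁ x τ) (heatKernel₂ x τ) (heatKernel₃ x τ) where
  space _ hs ξ := hasDerivAt_heatKernel₁ hs ξ
  space_two _ hs ξ := hasDerivAt_heatKernel₂ hs ξ
  time _ hs ξ := hasDerivAt_heatKernel₁_time hs ξ
  cont := continuousOn_heatKernel₁
  cont_one := continuousOn_heatKernel₂
  cont_two := continuousOn_heatKernel₃
  decay b hb A := by
    obtain ⟨C, h⟩ := exists_heatKernel_decay hb hτ A x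
    exact ⟨C, fun s hs ξ => (h s hs ξ).2⟩

theorem imageKernel_eq (y : ℝ → ℝ) (τ x s ξ : ℝ) :
    imageKernel y τ x s ξ = heatKernel x τ s ξ - heatKernel (2 * y τ - x) τ s ξ := by
  unfold imageKernel heatKernel
  rw [show ξ + x - 2 * y τ = ξ - (2 * y τ - x) by ring]
  ring

theorem sqrt_pi_mul_cube (hs : s ≤ τ) :
    √(Real.pi * (τ - s) ^ 3) = (τ - s) * √(Real.pi * (τ - s)) := by
  rw [show Real.pi * (τ - s) ^ 3 = (τ - s) ^ 2 * (Real.pi * (τ - s)) by ring,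
    Real.sqrt_mul (by positivity), Real.sqrt_sq (by linarith)]

theorem rebateKernel_eq (y : ℝ → ℝ) (x : ℝ) (hs : s ≤ τ) :
    rebateKernel y τ x s = heatKernel₁ x τ s (y s) - heatKernel₁ (2 * y τ - x) τ s (y s) := by
  unfold rebateKernel heatKernel₁ heatKernel
  rw [sqrt_pi_mul_cube hs, show (x - y s) ^ 2 = (y s - x) ^ 2 by ring,
    show x + y s - 2 * y τ = y s - (2 * y τ - x) by ring]
  -- At `s = τ` both sides vanish because division by zero gives zero, so the identity holds on the
  -- closed interval and can be used under the integral sign without excluding the end point.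
  rcases eq_or_lt_of_le hs with rfl | hlt
  · simp
  · have : 0 < τ - s := sub_pos.2 hlt
    have hpi := Real.pi_pos
    field_simp
    ring

theorem boundaryKernel_eq (y : ℝ → ℝ) (τ s ξ : ℝ) :
    boundaryKernel y τ s ξ = 2 * heatKernel (y τ) τ s ξ := by
  unfold boundaryKernel heatKernel
  rw [one_div, mul_inv]
  ring

theorem boundaryGradientKernel_eq (y : ℝ → ℝ) (ξ : ℝ) (hs : s ≤ τ) :
    boundaryGradientKernel y τ s ξ = -2 * heatKernel₁ (y τ) τ s ξ := by
  unfold boundaryGradientKernel heatKernel₁ heatKernel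
  rw [sqrt_pi_mul_cube hs]
  rcases eq_or_lt_of_le hs with rfl | hlt
  · simp
  · have : 0 < τ - s := sub_pos.2 hlt
    have hpi := Real.pi_pos
    field_simp

end HeatKernel


/-! ### Gaussian bounds up to the pole and Gaussian averages. -/

section HeatKernelBounds

variable {x τ s : ℝ}

/-- In the variable `w` the kernel is a fixed normalized Gaussian divided by the Jacobian `2√(τ -
s)`. Limits `s → τ` of moments thereby become dominated convergence under one measure. -/
theorem heatKernel_scaled (hs : s < τ) (w : ℝ) :
    heatKernel x τ s (x + 2 * √(τ - s) * w)
      = (√Real.pi)⁻¹ * Real.exp (-w ^ 2) * (2 * √(τ - s))⁻¹ := by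
  have hδ : 0 < τ - s := sub_pos.2 hs
  have h : (x + 2 * √(τ - s) * w - x) ^ 2 = 4 * (τ - s) * w ^ 2 := by
    rw [show (x + 2 * √(τ - s) * w - x) ^ 2 = 4 * √(τ - s) ^ 2 * w ^ 2 by ring, Real.sq_sqrt hδ.le]
  unfold heatKernel
  rw [h, show -(4 * (τ - s) * w ^ 2) / (4 * (τ - s)) = -w ^ 2 by field_simp,
    Real.sqrt_mul Real.pi_pos.le]
  have := Real.sqrt_pos.2 hδ
  have := Real.sqrt_pos.2 Real.pi_pos
  field_simp

theorem heatKernel₁_scaled (hs : s < τ) (w : ℝ) :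
    heatKernel₁ x τ s (x + 2 * √(τ - s) * w)
      = -(w / √(τ - s)) * heatKernel x τ s (x + 2 * √(τ - s) * w) := by
  have hδ : 0 < τ - s := sub_pos.2 hs
  have h2 := Real.sqrt_pos.2 hδ
  rw [heatKernel₁]
  congr 1
  have h3 : τ - s = √(τ - s) * √(τ - s) := (Real.mul_self_sqrt hδ.le).symm
  rw [show x + 2 * √(τ - s) * w - x = 2 * √(τ - s) * w by ring]
  generalize √(τ - s) = r at *
  rw [h3]
  field_simp

theorem exists_scaled (hs : s < τ) (x ξ : ℝ) : ∃ w, ξ = x + 2 * √(τ - s) * w := by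
  have := Real.sqrt_pos.2 (sub_pos.2 hs)
  exact ⟨(ξ - x) / (2 * √(τ - s)), by field_simp; ring⟩

theorem inv_sqrt_pi_le_one : (√Real.pi)⁻¹ ≤ 1 :=
  inv_le_one_of_one_le₀ (Real.one_le_sqrt.2 (by linarith [Real.pi_gt_three]))

theorem one_add_abs_add_cube_mul_exp_le (w : ℝ) :
    (1 + |w| + |w| ^ 3) * Real.exp (-w ^ 2) ≤ 4 := by
  have h1 := Real.quadratic_le_exp_of_nonneg (sq_nonneg w)
  have h0 := abs_nonneg w
  rw [← sq_abs w] at h1 ⊢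
  have h2 : 1 + |w| + |w| ^ 3 ≤ 4 * Real.exp (|w| ^ 2) := by
    nlinarith [sq_nonneg (|w| - 1), sq_nonneg (|w| ^ 2 - |w|)]
  rw [Real.exp_neg, ← div_eq_mul_inv, div_le_iff₀ (Real.exp_pos _)]
  exact h2

/-- Bounds of the heat kernel and its gradient, in the distance to the pole and in time. -/
theorem heatKernel_bounds (hs : s < τ) (x ξ : ℝ) :
    |heatKernel x τ s ξ| * √(τ - s) ≤ 4 ∧ |heatKernel x τ s ξ| * |ξ - x| ≤ 4 ∧
    |heatKernel₁ x τ s ξ| * (τ - s) ≤ 4 ∧ |heatKernel₁ x τ s ξ| * (ξ - x) ^ 2 ≤ 8 := by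
  obtain ⟨w, rfl⟩ := exists_scaled hs x ξ
  have hδ : 0 < τ - s := sub_pos.2 hs
  have h2 := Real.sqrt_pos.2 hδ
  have hp := Real.sqrt_pos.2 Real.pi_pos
  rw [heatKernel₁_scaled hs, heatKernel_scaled hs]
  have h3 : τ - s = √(τ - s) * √(τ - s) := (Real.mul_self_sqrt hδ.le).symm
  rw [show x + 2 * √(τ - s) * w - x = 2 * √(τ - s) * w by ring]
  have hE := one_add_abs_add_cube_mul_exp_le w
  have h0 := abs_nonneg w
  have hi := inv_sqrt_pi_le_one
  have hi0 : 0 < (√Real.pi)⁻¹ := inv_pos.2 hp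
  set E := Real.exp (-w ^ 2) with hEdef
  have hE0 : 0 < E := Real.exp_pos _
  set c := (√Real.pi)⁻¹
  have e1 : |c * E * (2 * √(τ - s))⁻¹| = c * E * (2 * √(τ - s))⁻¹ := abs_of_pos (by positivity)
  have b1 : E ≤ 4 := by nlinarith [pow_nonneg h0 3, mul_nonneg h0 hE0.le, mul_nonneg (pow_nonneg h0 3) hE0.le]
  have b2 : |w| * E ≤ 4 := by nlinarith [pow_nonneg h0 3, mul_nonneg h0 hE0.le, mul_nonneg (pow_nonneg h0 3) hE0.le]
  have b3 : |w| ^ 3 * E ≤ 4 := by nlinarith [pow_nonneg h0 3, mul_nonneg h0 hE0.le, mul_nonneg (pow_nonneg h0 3) hE0.le]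
  rw [abs_mul (-(w / √(τ - s))), e1, abs_neg, abs_div, abs_of_pos h2, abs_mul (2 * √(τ - s)),
    abs_of_pos (by positivity : 0 < 2 * √(τ - s)), h3]
  generalize √(τ - s) = r at *
  rw [Real.sqrt_mul_self h2.le]
  refine ⟨?_, ?_, ?_, ?_⟩
  · rw [show c * E * (2 * r)⁻¹ * r = c * E / 2 by field_simp]
    nlinarith
  · rw [show c * E * (2 * r)⁻¹ * (2 * r * |w|) = c * (|w| * E) by field_simp]
    nlinarith [mul_nonneg h0 hE0.le]
  · rw [show |w| / r * (c * E * (2 * r)⁻¹) * (r * r) = c * (|w| * E) / 2 by field_simp]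
    nlinarith [mul_nonneg h0 hE0.le]
  · rw [show |w| / r * (c * E * (2 * r)⁻¹) * (2 * r * w) ^ 2 = 2 * (c * (|w| ^ 3 * E)) by
      rw [show (2 * r * w) ^ 2 = 4 * r ^ 2 * |w| ^ 2 by rw [sq_abs]; ring]
      field_simp; ring]
    nlinarith [mul_nonneg (pow_nonneg h0 3) hE0.le]

/-- The weight `e^{A|ξ|}` is paid for by weakening the Gaussian exponent from `(ξ-x)²/(4(τ-s))` to
`(ξ-x)²/(16(τ-s))`. The constant is uniform up to the pole, unlike in `exists_heatKernel_decay`;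
only the explicit power of `τ - s` is singular. -/
theorem exists_weighted_bound (A x τ : ℝ) (hA : 0 ≤ A) : ∃ C, 0 ≤ C ∧ ∀ s ∈ Ico 0 τ, ∀ ξ,
    |heatKernel x τ s ξ| * Real.exp (A * |ξ|)
      ≤ C / √(τ - s) * Real.exp (-(16 * (τ - s))⁻¹ * (ξ - x) ^ 2) ∧
    |heatKernel₁ x τ s ξ| * Real.exp (A * |ξ|)
      ≤ C / (τ - s) * Real.exp (-(16 * (τ - s))⁻¹ * (ξ - x) ^ 2) := by
  -- `B` is the coefficient of `|w|` in the exponent: `1` from `1 + |w| ≤ e^{|w|}` and `2A√τ` from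
  -- the weight. Three quarters of `w²` absorb it, since `B|w| ≤ (3/4)w² + B²`.
  set B := 1 + 2 * A * √τ with hB
  refine ⟨Real.exp (A * |x| + B ^ 2), by positivity, fun s hs ξ => ?_⟩
  obtain ⟨w, rfl⟩ := exists_scaled hs.2 x ξ
  have hδ : 0 < τ - s := sub_pos.2 hs.2
  have h2 := Real.sqrt_pos.2 hδ
  have hp := Real.sqrt_pos.2 Real.pi_pos
  have h3 : (τ - s) = √(τ - s) * √(τ - s) := (Real.mul_self_sqrt hδ.le).symm
  have hrτ : √(τ - s) ≤ √τ := Real.sqrt_le_sqrt (by linarith [hs.1])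
  rw [heatKernel₁_scaled hs.2, heatKernel_scaled hs.2]
  have hi := inv_sqrt_pi_le_one
  have hi0 : 0 < (√Real.pi)⁻¹ := inv_pos.2 hp
  set c := (√Real.pi)⁻¹
  have e0 : -(16 * (τ - s))⁻¹ * (x + 2 * √(τ - s) * w - x) ^ 2 = -(w ^ 2 / 4) := by
    rw [show (x + 2 * √(τ - s) * w - x) ^ 2 = 4 * √(τ - s) ^ 2 * w ^ 2 by ring, Real.sq_sqrt hδ.le]
    field_simp
    norm_num
  rw [e0]
  have h0 := abs_nonneg w
  have key : (1 + |w|) * (Real.exp (-w ^ 2) * Real.exp (A * |x + 2 * √(τ - s) * w|))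
      ≤ Real.exp (A * |x| + B ^ 2) * Real.exp (-(w ^ 2 / 4)) := by
    have t1 : 1 + |w| ≤ Real.exp |w| := by linarith [Real.add_one_le_exp |w|]
    have t2 : |x + 2 * √(τ - s) * w| ≤ |x| + 2 * √τ * |w| := by
      refine (abs_add_le _ _).trans ?_
      rw [abs_mul, abs_of_pos (by positivity : 0 < 2 * √(τ - s))]
      gcongr
    calc _ ≤ Real.exp |w| * (Real.exp (-w ^ 2) * Real.exp (A * (|x| + 2 * √τ * |w|))) := by gcongr
      _ = Real.exp (|w| + (-w ^ 2 + A * (|x| + 2 * √τ * |w|))) := by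
          rw [Real.exp_add, Real.exp_add]
      _ ≤ Real.exp (A * |x| + B ^ 2 + -(w ^ 2 / 4)) := by
          apply Real.exp_le_exp.2
          have t3 : B * |w| ≤ 3 / 4 * w ^ 2 + B ^ 2 := by
            rw [← sq_abs w]; nlinarith [sq_nonneg (|w| - B), sq_nonneg |w|, sq_nonneg B]
          rw [hB] at t3 ⊢
          nlinarith
      _ = _ := Real.exp_add _ _
  set X := Real.exp (-w ^ 2) * Real.exp (A * |x + 2 * √(τ - s) * w|) with hX
  have hX0 : 0 < X := by positivity
  set Y := Real.exp (A * |x| + B ^ 2) * Real.exp (-(w ^ 2 / 4)) with hY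
  constructor
  · rw [abs_of_pos (by positivity)]
    calc c * Real.exp (-w ^ 2) * (2 * √(τ - s))⁻¹ * Real.exp (A * |x + 2 * √(τ - s) * w|)
        = (c / 2 * X) / √(τ - s) := by rw [hX]; field_simp
      _ ≤ Y / √(τ - s) := by
          gcongr
          nlinarith [mul_nonneg h0 hX0.le]
      _ = _ := by rw [hY]; ring
  · rw [abs_mul, abs_of_pos (by positivity : 0 < c * Real.exp (-w ^ 2) * (2 * √(τ - s))⁻¹), abs_neg,
      abs_div, abs_of_pos h2]
    calc |w| / √(τ - s) * (c * Real.exp (-w ^ 2) * (2 * √(τ - s))⁻¹)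
            * Real.exp (A * |x + 2 * √(τ - s) * w|)
        = (c / 2 * (|w| * X)) / (√(τ - s) * √(τ - s)) := by rw [hX]; field_simp
      _ ≤ Y / (√(τ - s) * √(τ - s)) := by
          gcongr
          nlinarith [mul_nonneg h0 hX0.le]
      _ = Y / (τ - s) := by rw [← h3]
      _ = _ := by rw [hY]; ring

theorem integrable_gaussian_translate {b : ℝ} (hb : 0 < b) (x : ℝ) :
    Integrable (fun ξ : ℝ => Real.exp (-b * (ξ - x) ^ 2)) :=
  (integrable_exp_neg_mul_sq hb).comp_sub_right x

theorem integral_gaussian_translate (b x : ℝ) :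
    ∫ ξ : ℝ, Real.exp (-b * (ξ - x) ^ 2) = √(Real.pi / b) := by
  rw [integral_sub_right_eq_self (fun ξ => Real.exp (-b * ξ ^ 2)) x, integral_gaussian]

theorem intervalIntegrable_inv_sqrt_sub (τ : ℝ) :
    IntervalIntegrable (fun s => (√(τ - s))⁻¹) volume 0 τ := by
  have h := (intervalIntegral.intervalIntegrable_rpow' (a := τ) (b := 0)
    (show (-1 : ℝ) < -(1 / 2) by norm_num)).comp_sub_left τ
  simp only [sub_self, sub_zero] at h
  refine h.mono_fun' (by fun_prop) ?_
  refine ae_of_all _ fun s => ?_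
  change ‖(√(τ - s))⁻¹‖ ≤ (τ - s) ^ (-(1 / 2) : ℝ)
  rw [Real.norm_of_nonneg (by positivity)]
  rcases le_or_gt 0 (τ - s) with h' | h'
  · rw [Real.rpow_neg h', Real.sqrt_eq_rpow]
  -- For `s > τ` the left side is zero by convention, and the real power of a negative base with
  -- exponent `-1/2` carries the factor `cos(π/2) = 0`, so the comparison holds for every `s`.
  · rw [Real.sqrt_eq_zero_of_nonpos h'.le, inv_zero, Real.rpow_def_of_neg h']
    refine mul_nonneg (Real.exp_pos _).le ?_
    rw [show -(1 / 2) * Real.pi = -(Real.pi / 2) by ring, Real.cos_neg, Real.cos_pi_div_two]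

/-- An integrable factor that is bounded near `τ`, times a kernel with an inverse square root
singularity at `τ`. -/
theorem intervalIntegrable_mul_singular (hτ : 0 < τ) {ψ k : ℝ → ℝ} {B C : ℝ}
    (hψ : IntervalIntegrable ψ volume 0 τ) (hB : ∀ s ∈ Ioo (τ / 2) τ, |ψ s| ≤ B)
    (hk : ContinuousOn k (Ioo 0 τ)) (hkC : ∀ s ∈ Ioo 0 τ, |k s| ≤ C * (√(τ - s))⁻¹) :
    IntervalIntegrable (fun s => ψ s * k s) volume 0 τ := by
  have hd : IntervalIntegrable
      (fun s => |C| * (√(τ / 2))⁻¹ * |ψ s| + |B| * |C| * (√(τ - s))⁻¹) volume 0 τ :=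
    (hψ.abs.const_mul _).add ((intervalIntegrable_inv_sqrt_sub τ).const_mul _)
  rw [intervalIntegrable_iff_integrableOn_Ioo_of_le hτ.le] at hψ hd ⊢
  refine Integrable.mono' hd
    (hψ.aestronglyMeasurable.mul (hk.aestronglyMeasurable measurableSet_Ioo)) ?_
  refine (ae_restrict_iff' measurableSet_Ioo).2 (ae_of_all _ fun s hs => ?_)
  have h1 : |k s| ≤ |C| * (√(τ - s))⁻¹ :=
    (hkC s hs).trans (mul_le_mul_of_nonneg_right (le_abs_self C) (by positivity))
  rw [norm_mul, Real.norm_eq_abs, Real.norm_eq_abs]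
  -- On the first half `ψ` is merely integrable but `k` is bounded; on the second half `ψ` is
  -- bounded and the inverse square root is integrable.
  rcases le_or_gt s (τ / 2) with h | h
  · have h2 : (√(τ - s))⁻¹ ≤ (√(τ / 2))⁻¹ := by
      apply inv_anti₀ (by positivity)
      apply Real.sqrt_le_sqrt
      linarith
    calc |ψ s| * |k s| ≤ |ψ s| * (|C| * (√(τ / 2))⁻¹) := by
          gcongr; exact h1.trans (mul_le_mul_of_nonneg_left h2 (abs_nonneg _))
      _ = |C| * (√(τ / 2))⁻¹ * |ψ s| := by ring
      _ ≤ _ := le_add_of_nonneg_right (by positivity)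
  · calc |ψ s| * |k s| ≤ |B| * (|C| * (√(τ - s))⁻¹) :=
          mul_le_mul ((hB s ⟨h, hs.2⟩).trans (le_abs_self B)) h1 (abs_nonneg _) (abs_nonneg _)
      _ = |B| * |C| * (√(τ - s))⁻¹ := by ring
      _ ≤ _ := le_add_of_nonneg_left (by positivity)

theorem integral_eq_scaled (hs : s < τ) (x : ℝ) (F : ℝ → ℝ) :
    ∫ ξ, F ξ = ∫ w, (2 * √(τ - s)) * F (x + 2 * √(τ - s) * w) := by
  have h2 : 0 < 2 * √(τ - s) := by have := Real.sqrt_pos.2 (sub_pos.2 hs); positivity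
  rw [integral_const_mul, Measure.integral_comp_mul_left (fun z => F (x + z)),
    integral_add_left_eq_self F x, abs_of_pos (inv_pos.2 h2), smul_eq_mul, mul_inv_cancel_left₀ h2.ne']

theorem integral_heatKernel_mul (hs : s < τ) (x : ℝ) (F : ℝ → ℝ) :
    ∫ ξ, heatKernel x τ s ξ * F ξ
      = ∫ w, (√Real.pi)⁻¹ * Real.exp (-w ^ 2) * F (x + 2 * √(τ - s) * w) := by
  rw [integral_eq_scaled hs x]
  congr 1
  ext w
  rw [heatKernel_scaled hs]
  have h2 : 0 < √(τ - s) := Real.sqrt_pos.2 (sub_pos.2 hs)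
  field_simp

theorem integral_heatKernel₁_mul (hs : s < τ) (x : ℝ) (F : ℝ → ℝ) :
    ∫ ξ, heatKernel₁ x τ s ξ * F ξ
      = ∫ w, (√Real.pi)⁻¹ * Real.exp (-w ^ 2)
          * (-(w / √(τ - s)) * F (x + 2 * √(τ - s) * w)) := by
  rw [integral_eq_scaled hs x]
  congr 1
  ext w
  rw [heatKernel₁_scaled hs, heatKernel_scaled hs]
  have h2 : 0 < √(τ - s) := Real.sqrt_pos.2 (sub_pos.2 hs)
  field_simp

theorem integrable_exp_neg_sq_mul_exp (A : ℝ) :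
    Integrable (fun w : ℝ => Real.exp (-w ^ 2) * Real.exp (A * |w|)) := by
  have h := (integrable_exp_neg_mul_sq (show (0 : ℝ) < 1 / 2 by norm_num)).const_mul (Real.exp (A ^ 2))
  refine h.mono' (by fun_prop) (ae_of_all _ fun w => ?_)
  rw [Real.norm_of_nonneg (by positivity), ← Real.exp_add, ← Real.exp_add]
  apply Real.exp_le_exp.2
  rw [← sq_abs w]
  nlinarith [sq_nonneg (|w| - A)]

/-- Dominated convergence for Gaussian averages with exponential growth. -/
theorem tendsto_gaussian_average {Φ : ℝ → ℝ → ℝ} {L : ℝ → ℝ} {C A : ℝ}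
    (hm : ∀ᶠ s in 𝓝[<] τ, Measurable (Φ s))
    (hb : ∀ᶠ s in 𝓝[<] τ, ∀ w, |Φ s w| ≤ C * Real.exp (A * |w|))
    (hl : ∀ᵐ w, Tendsto (fun s => Φ s w) (𝓝[<] τ) (𝓝 (L w))) :
    Tendsto (fun s => ∫ w, (√Real.pi)⁻¹ * Real.exp (-w ^ 2) * Φ s w) (𝓝[<] τ)
      (𝓝 (∫ w, (√Real.pi)⁻¹ * Real.exp (-w ^ 2) * L w)) := by
  refine tendsto_integral_filter_of_dominated_convergence
    (fun w => (√Real.pi)⁻¹ * C * (Real.exp (-w ^ 2) * Real.exp (A * |w|))) ?_ ?_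
    ((integrable_exp_neg_sq_mul_exp A).const_mul _) ?_
  · filter_upwards [hm] with s hs
    exact (Measurable.mul (by fun_prop) hs).aestronglyMeasurable
  · filter_upwards [hb] with s hs
    refine ae_of_all _ fun w => ?_
    rw [norm_mul, Real.norm_of_nonneg (by positivity), Real.norm_eq_abs]
    calc _ ≤ (√Real.pi)⁻¹ * Real.exp (-w ^ 2) * (C * Real.exp (A * |w|)) := by
          gcongr; exact hs w
      _ = _ := by ring
  · filter_upwards [hl] with w hw using hw.const_mul _

theorem integral_normalized_gaussian (c : ℝ) :
    ∫ w : ℝ, (√Real.pi)⁻¹ * Real.exp (-w ^ 2) * c = c := by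
  have h := integral_gaussian 1
  simp only [neg_mul, one_mul, div_one] at h
  rw [integral_mul_const, integral_const_mul, h,
    inv_mul_cancel₀ (Real.sqrt_pos.2 Real.pi_pos).ne', one_mul]

/-- The normalized Gaussian `e^{-w²}/√π` has second moment `1/2`, and half of it sits on `w > 0`.
This produces the factor `1/2` of the jump relation. -/
theorem integral_sq_mul_gaussian_Ioi (c : ℝ) :
    ∫ w : ℝ, (√Real.pi)⁻¹ * Real.exp (-w ^ 2) * (Ioi 0).indicator (fun w => c * w ^ 2) w = c / 4 := by
  have h := integral_rpow_mul_exp_neg_mul_rpow (p := 2) (q := 2) (b := 1) two_pos (by norm_num)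
    one_pos
  have e : ∀ w : ℝ, (√Real.pi)⁻¹ * Real.exp (-w ^ 2) * (Ioi 0).indicator (fun w => c * w ^ 2) w
      = (Ioi 0).indicator (fun w => (√Real.pi)⁻¹ * c * (w ^ (2 : ℝ) * Real.exp (-1 * w ^ (2 : ℝ)))) w := by
    intro w
    by_cases hw : w ∈ Ioi (0 : ℝ)
    · rw [indicator_of_mem hw, indicator_of_mem hw, Real.rpow_two]
      ring_nf
    · rw [indicator_of_notMem hw, indicator_of_notMem hw, mul_zero]
  simp only [e]
  rw [integral_indicator measurableSet_Ioi, integral_const_mul, h]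
  have hG : Real.Gamma ((2 + 1) / 2) = √Real.pi / 2 := by
    rw [show ((2 : ℝ) + 1) / 2 = 1 / 2 + 1 by norm_num, Real.Gamma_add_one (by norm_num),
      Real.Gamma_one_half_eq]
    ring
  rw [hG, Real.one_rpow]
  have := Real.sqrt_pos.2 Real.pi_pos
  field_simp
  norm_num

end HeatKernelBounds


/-! ### Heat potentials with pole off the boundary; the price equation. -/

theorem measurable_indicator_Ioi {u : ℝ → ℝ} {c : ℝ} (h : ContinuousOn u (Ici c)) :
    Measurable ((Ioi c).indicator u) := by
  have h1 : Continuous fun z => u (max c z) :=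
    h.comp_continuous (by fun_prop) fun z => mem_Ici.2 (le_max_left c z)
  have : (Ioi c).indicator u = (Ioi c).indicator fun z => u (max c z) := by
    ext z
    by_cases hz : z ∈ Ioi c
    · rw [indicator_of_mem hz, indicator_of_mem hz, max_eq_right (le_of_lt hz)]
    · rw [indicator_of_notMem hz, indicator_of_notMem hz]
  rw [this]
  exact h1.measurable.indicator measurableSet_Ioi

theorem tendsto_sqrt_sub_left (τ : ℝ) : Tendsto (fun s => √(τ - s)) (𝓝[<] τ) (𝓝 0) := by
  have h : Continuous fun s : ℝ => √(τ - s) := by fun_prop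
  have := (h.tendsto τ).mono_left (nhdsWithin_le_nhds (s := Iio τ))
  simpa using this

theorem tendsto_scaled_point (τ x w : ℝ) :
    Tendsto (fun s => x + 2 * √(τ - s) * w) (𝓝[<] τ) (𝓝 x) := by
  have := (((tendsto_sqrt_sub_left τ).const_mul 2).mul_const w).const_add x
  simpa using this

theorem setIntegral_mul_indicator (G u : ℝ → ℝ) (c : ℝ) :
    ∫ ξ in Ioi c, G ξ * u ξ = ∫ ξ, G ξ * (Ioi c).indicator u ξ := by
  rw [← integral_indicator measurableSet_Ioi]
  congr 1
  ext ξ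
  by_cases h : ξ ∈ Ioi c
  · rw [indicator_of_mem h, indicator_of_mem h]
  · rw [indicator_of_notMem h, indicator_of_notMem h, mul_zero]

namespace IsMovingBoundarySolution

variable {H : ℝ} {α β : ℝ → ℝ} {lam : ℝ → ℝ → ℝ} {f g y : ℝ → ℝ} {U : ℝ → ℝ → ℝ} {τ : ℝ}

/-- The slice integral of the dominating Gaussian is a multiple of `√(τ - s)`, which cancels the
prefactor of the kernel. What remains is a constant times the integrable bound `M`. -/
theorem integrable_heatKernel_source (hU : IsMovingBoundarySolution H α β lam f g y U)
    (hτ : τ ∈ Ioc 0 H) (x : ℝ) :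
    IntegrableOn (fun p : ℝ × ℝ => heatKernel x τ p.1 p.2 * totalSource α β lam U p.1 p.2)
      {p | p.1 ∈ Ioo 0 τ ∧ y p.1 < p.2} ∧
    IntervalIntegrable (fun s => ∫ ξ in Ioi (y s), heatKernel x τ s ξ * totalSource α β lam U s ξ)
      volume 0 τ := by
  obtain ⟨A, M, hA, hM0, -, hMi, bh⟩ := hU.exists_totalSource_bound
  obtain ⟨C, hC, hw⟩ := exists_weighted_bound A x τ hA
  have hsub : ∀ s ∈ Ioo 0 τ, s ∈ Ioo 0 H := fun s hs => ⟨hs.1, hs.2.trans_le hτ.2⟩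
  refine integrableOn_region hτ.1.le (y := y)
    (hU.y_cont.mono fun s hs => Ioo_subset_Icc_self (hsub s hs))
    (F := fun s ξ => heatKernel x τ s ξ * totalSource α β lam U s ξ)
    (k := fun s ξ => M s * (C / √(τ - s)) * Real.exp (-(16 * (τ - s))⁻¹ * (ξ - x) ^ 2))
    (N := fun s => M s * (C * √(Real.pi * 16))) ?_ ?_ ?_ ?_ ?_ ?_
  · exact (continuousOn_heatKernel.mono fun p hp => hp.1.2).mul
      (hU.continuousOn_totalSource.mono fun p hp => ⟨hsub _ hp.1, hp.2⟩)
  · intro s hs ξ hξ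
    rw [abs_mul]
    calc _ ≤ |heatKernel x τ s ξ| * (M s * Real.exp (A * |ξ|)) := by
          gcongr; exact bh s (hsub s hs) ξ hξ
      _ = M s * (|heatKernel x τ s ξ| * Real.exp (A * |ξ|)) := by ring
      _ ≤ M s * (C / √(τ - s) * Real.exp (-(16 * (τ - s))⁻¹ * (ξ - x) ^ 2)) :=
          mul_le_mul_of_nonneg_left (hw s ⟨hs.1.le, hs.2⟩ ξ).1 (hM0 s)
      _ = _ := by ring
  · intro s hs ξ
    have := hM0 s
    positivity
  · intro s hs
    have : 0 < τ - s := sub_pos.2 hs.2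
    exact (integrable_gaussian_translate (by positivity) x).const_mul _
  · intro s hs
    have h : 0 < τ - s := sub_pos.2 hs.2
    have h2 := Real.sqrt_pos.2 h
    rw [integral_const_mul, integral_gaussian_translate,
      show Real.pi / (16 * (τ - s))⁻¹ = (Real.pi * 16) * (τ - s) by field_simp,
      Real.sqrt_mul (by positivity)]
    apply le_of_eq
    field_simp
  · refine IntervalIntegrable.mul_const (hMi.mono_set ?_) _
    rw [uIcc_of_le hτ.1.le, uIcc_of_le hU.horizon_pos.le]
    exact Icc_subset_Icc_right hτ.2

/-- The prefactor `1/(τ - s)` now leaves `(τ - s)^{-1/2}` after slicing. It is integrable against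
`M`, which is integrable at `0` and, being continuous on `(0, H]`, bounded near `τ`. -/
theorem integrable_heatKernel₁_source (hU : IsMovingBoundarySolution H α β lam f g y U)
    (hτ : τ ∈ Ioc 0 H) (x : ℝ) :
    IntegrableOn (fun p : ℝ × ℝ => heatKernel₁ x τ p.1 p.2 * totalSource α β lam U p.1 p.2)
      {p | p.1 ∈ Ioo 0 τ ∧ y p.1 < p.2} ∧
    IntervalIntegrable (fun s => ∫ ξ in Ioi (y s), heatKernel₁ x τ s ξ * totalSource α β lam U s ξ)
      volume 0 τ := by
  obtain ⟨A, M, hA, hM0, hMc, hMi, bh⟩ := hU.exists_totalSource_bound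
  obtain ⟨C, hC, hw⟩ := exists_weighted_bound A x τ hA
  have hsub : ∀ s ∈ Ioo 0 τ, s ∈ Ioo 0 H := fun s hs => ⟨hs.1, hs.2.trans_le hτ.2⟩
  obtain ⟨B, hB⟩ := isCompact_Icc.exists_bound_of_continuousOn
    (hMc.mono (fun s (hs : s ∈ Icc (τ / 2) τ) => ⟨(half_pos hτ.1).trans_le hs.1, hs.2.trans hτ.2⟩))
  refine integrableOn_region hτ.1.le (y := y)
    (hU.y_cont.mono fun s hs => Ioo_subset_Icc_self (hsub s hs))
    (F := fun s ξ => heatKernel₁ x τ s ξ * totalSource α β lam U s ξ)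
    (k := fun s ξ => M s * (C / (τ - s)) * Real.exp (-(16 * (τ - s))⁻¹ * (ξ - x) ^ 2))
    (N := fun s => M s * (C * √(Real.pi * 16) * (√(τ - s))⁻¹)) ?_ ?_ ?_ ?_ ?_ ?_
  · exact (continuousOn_heatKernel₁.mono fun p hp => hp.1.2).mul
      (hU.continuousOn_totalSource.mono fun p hp => ⟨hsub _ hp.1, hp.2⟩)
  · intro s hs ξ hξ
    rw [abs_mul]
    calc _ ≤ |heatKernel₁ x τ s ξ| * (M s * Real.exp (A * |ξ|)) := by
          gcongr; exact bh s (hsub s hs) ξ hξ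
      _ = M s * (|heatKernel₁ x τ s ξ| * Real.exp (A * |ξ|)) := by ring
      _ ≤ M s * (C / (τ - s) * Real.exp (-(16 * (τ - s))⁻¹ * (ξ - x) ^ 2)) :=
          mul_le_mul_of_nonneg_left (hw s ⟨hs.1.le, hs.2⟩ ξ).2 (hM0 s)
      _ = _ := by ring
  · intro s hs ξ
    have := hM0 s
    have : 0 < τ - s := sub_pos.2 hs.2
    positivity
  · intro s hs
    have : 0 < τ - s := sub_pos.2 hs.2
    exact (integrable_gaussian_translate (by positivity) x).const_mul _
  · intro s hs
    have h : 0 < τ - s := sub_pos.2 hs.2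
    have h2 := Real.sqrt_pos.2 h
    rw [integral_const_mul, integral_gaussian_translate,
      show Real.pi / (16 * (τ - s))⁻¹ = (Real.pi * 16) * (τ - s) by field_simp,
      Real.sqrt_mul (by positivity)]
    apply le_of_eq
    have h3 : τ - s = √(τ - s) * √(τ - s) := (Real.mul_self_sqrt h.le).symm
    generalize √(τ - s) = r at *
    rw [h3]
    field_simp
  · refine intervalIntegrable_mul_singular hτ.1 (B := B) (C := C * √(Real.pi * 16))
      (hMi.mono_set ?_) (fun s hs => hB s (Ioo_subset_Icc_self hs)) ?_ fun s hs => ?_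
    · rw [uIcc_of_le hτ.1.le, uIcc_of_le hU.horizon_pos.le]
      exact Icc_subset_Icc_right hτ.2
    · refine ContinuousOn.mul continuousOn_const (ContinuousOn.inv₀ (by fun_prop) fun s hs => ?_)
      exact (Real.sqrt_pos.2 (sub_pos.2 hs.2)).ne'
    · rw [abs_of_nonneg (by positivity)]

theorem tendsto_y (hU : IsMovingBoundarySolution H α β lam f g y U) (hτ : τ ∈ Ioc 0 H) :
    Tendsto y (𝓝[<] τ) (𝓝 (y τ)) := by
  refine (hU.y_cont τ (Ioc_subset_Icc_self hτ)).mono_left ?_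
  rw [← nhdsWithin_Ioo_eq_nhdsLT hτ.1]
  exact nhdsWithin_mono _ fun s hs => ⟨hs.1.le, hs.2.le.trans hτ.2⟩

theorem continuousOn_slice (hU : IsMovingBoundarySolution H α β lam f g y U) {s : ℝ}
    (hs : s ∈ Icc 0 H) : ContinuousOn (U s) (Ici (y s)) :=
  hU.cont.comp_horiz fun _ hz => ⟨hs, hz⟩

theorem measurable_scaled (hU : IsMovingBoundarySolution H α β lam f g y U) {s : ℝ}
    (hs : s ∈ Icc 0 H) (x r : ℝ) :
    Measurable fun w => (Ioi (y s)).indicator (U s) (x + 2 * r * w) :=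
  (measurable_indicator_Ioi (hU.continuousOn_slice hs)).comp (by fun_prop)

theorem exists_scaled_growth (hU : IsMovingBoundarySolution H α β lam f g y U) (x τ : ℝ) :
    ∃ C A, ∀ s ∈ Icc 0 H, ∀ w,
      |(Ioi (y s)).indicator (U s) (x + 2 * √(τ - s) * w)| ≤ C * Real.exp (A * |w|) := by
  obtain ⟨C, A, hC, hA, h⟩ := hU.exists_growth
  refine ⟨C * Real.exp (A * |x|), A * (2 * √τ), fun s hs w => ?_⟩
  have hs0 := hs.1
  have h1 : |x + 2 * √(τ - s) * w| ≤ |x| + 2 * √τ * |w| := by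
    refine (abs_add_le _ _).trans ?_
    rw [abs_mul, abs_of_nonneg (by positivity : 0 ≤ 2 * √(τ - s))]
    have : √(τ - s) ≤ √τ := Real.sqrt_le_sqrt (by linarith)
    gcongr
  have h2 : C * Real.exp (A * |x + 2 * √(τ - s) * w|)
      ≤ C * Real.exp (A * |x|) * Real.exp (A * (2 * √τ) * |w|) := by
    rw [mul_assoc C, ← Real.exp_add]
    gcongr
    nlinarith
  by_cases hm : x + 2 * √(τ - s) * w ∈ Ioi (y s)
  · rw [indicator_of_mem hm]
    exact (h s hs _ (le_of_lt hm)).trans h2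
  · rw [indicator_of_notMem hm, abs_zero]
    positivity

theorem eventually_mem (hτ : τ ∈ Ioc 0 H) : ∀ᶠ s in 𝓝[<] τ, s ∈ Ioo 0 τ ∧ s ∈ Ioo 0 H := by
  filter_upwards [Ioo_mem_nhdsLT hτ.1] with s hs using ⟨hs, hs.1, hs.2.trans_le hτ.2⟩

/-- Beyond the boundary the heat kernel recovers the value of the solution. -/
theorem tendsto_moment_above (hU : IsMovingBoundarySolution H α β lam f g y U) (hτ : τ ∈ Ioc 0 H)
    {x : ℝ} (hx : y τ < x) :
    Tendsto (fun s => ∫ ξ in Ioi (y s), heatKernel x τ s ξ * U s ξ) (𝓝[<] τ) (𝓝 (U τ x)) := by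
  obtain ⟨C, A, hCA⟩ := hU.exists_scaled_growth x τ
  have hev := eventually_mem hτ
  have h := tendsto_gaussian_average (τ := τ) (C := C) (A := A) (L := fun _ => U τ x)
    (Φ := fun s w => (Ioi (y s)).indicator (U s) (x + 2 * √(τ - s) * w)) ?_ ?_ ?_
  · rw [integral_normalized_gaussian] at h
    refine h.congr' ?_
    filter_upwards [hev] with s hs
    rw [setIntegral_mul_indicator, integral_heatKernel_mul hs.1.2]
  · filter_upwards [hev] with s hs using hU.measurable_scaled (Ioo_subset_Icc_self hs.2) x _
  · filter_upwards [hev] with s hs w using hCA s (Ioo_subset_Icc_self hs.2) w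
  · refine ae_of_all _ fun w => ?_
    have h1 := tendsto_scaled_point τ x w
    have h2 : ∀ᶠ s in 𝓝[<] τ, y s < x + 2 * √(τ - s) * w := (hU.tendsto_y hτ).eventually_lt h1 hx
    have h3 := hU.cont (τ, x) ⟨Ioc_subset_Icc_self hτ, hx.le⟩
    have h4 : Tendsto (fun s => (s, x + 2 * √(τ - s) * w)) (𝓝[<] τ)
        (𝓝[{p : ℝ × ℝ | p.1 ∈ Icc 0 H ∧ y p.1 ≤ p.2}] (τ, x)) := by
      refine tendsto_nhdsWithin_iff.2 ⟨(tendsto_id.mono_left nhdsWithin_le_nhds).prodMk_nhds h1, ?_⟩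
      filter_upwards [h2, hev] with s hs hs' using ⟨Ioo_subset_Icc_self hs'.2, hs.le⟩
    refine (h3.tendsto.comp h4).congr' ?_
    filter_upwards [h2] with s hs
    simp only [Function.comp]
    rw [indicator_of_mem (show _ ∈ Ioi (y s) from hs)]

/-- Below the boundary the heat kernel does not see the solution in the limit. -/
theorem tendsto_moment_below (hU : IsMovingBoundarySolution H α β lam f g y U) (hτ : τ ∈ Ioc 0 H)
    {x : ℝ} (hx : x < y τ) :
    Tendsto (fun s => ∫ ξ in Ioi (y s), heatKernel x τ s ξ * U s ξ) (𝓝[<] τ) (𝓝 0) := by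
  obtain ⟨C, A, hCA⟩ := hU.exists_scaled_growth x τ
  have hev := eventually_mem hτ
  have h := tendsto_gaussian_average (τ := τ) (C := C) (A := A) (L := fun _ => 0)
    (Φ := fun s w => (Ioi (y s)).indicator (U s) (x + 2 * √(τ - s) * w)) ?_ ?_ ?_
  · rw [integral_normalized_gaussian] at h
    refine h.congr' ?_
    filter_upwards [hev] with s hs
    rw [setIntegral_mul_indicator, integral_heatKernel_mul hs.1.2]
  · filter_upwards [hev] with s hs using hU.measurable_scaled (Ioo_subset_Icc_self hs.2) x _
  · filter_upwards [hev] with s hs w using hCA s (Ioo_subset_Icc_self hs.2) w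
  · refine ae_of_all _ fun w => ?_
    have h2 : ∀ᶠ s in 𝓝[<] τ, x + 2 * √(τ - s) * w < y s :=
      (tendsto_scaled_point τ x w).eventually_lt (hU.tendsto_y hτ) hx
    refine tendsto_const_nhds.congr' ?_
    filter_upwards [h2] with s hs
    rw [indicator_of_notMem (fun h : _ ∈ Ioi (y s) => lt_asymm hs h)]

/-- For `s` near `τ` the curve stays at a positive distance `ρ` from the pole and the bounds in `|ξ
- x|` apply; for earlier `s` the bounds in `τ - s` do. -/
theorem exists_kernel_bound_off_boundary (hU : IsMovingBoundarySolution H α β lam f g y U)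
    (hτ : τ ∈ Ioc 0 H) {x : ℝ} (hx : x ≠ y τ) :
    ∃ B, ∀ s ∈ Ioo 0 τ, |heatKernel x τ s (y s)| ≤ B ∧ |heatKernel₁ x τ s (y s)| ≤ B := by
  set ρ := |y τ - x| / 2 with hρ
  have hρ0 : 0 < ρ := half_pos (abs_pos.2 (sub_ne_zero.2 hx.symm))
  have h1 : ∀ᶠ s in 𝓝[<] τ, ρ < |y s - x| :=
    ((hU.tendsto_y hτ).sub_const x).abs.eventually (eventually_gt_nhds (by linarith))
  obtain ⟨l, hl, hlτ⟩ := (mem_nhdsLT_iff_exists_Ioo_subset).1 h1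
  have hη : 0 < τ - l := sub_pos.2 hl
  have hη2 := Real.sqrt_pos.2 hη
  refine ⟨4 / √(τ - l) + 4 / ρ + 4 / (τ - l) + 8 / ρ ^ 2, fun s hs => ?_⟩
  obtain ⟨b1, b2, b3, b4⟩ := heatKernel_bounds hs.2 x (y s)
  have hδ : 0 < τ - s := sub_pos.2 hs.2
  have p1 : 0 < 4 / √(τ - l) := by positivity
  have p2 : 0 < 4 / ρ := by positivity
  have p3 : 0 < 4 / (τ - l) := by positivity
  have p4 : 0 < 8 / ρ ^ 2 := by positivity
  rcases lt_or_ge l s with h | h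
  · have hd : ρ < |y s - x| := hlτ ⟨h, hs.2⟩
    have c1 : |heatKernel x τ s (y s)| ≤ 4 / ρ := by
      rw [le_div_iff₀ hρ0]
      exact (mul_le_mul_of_nonneg_left hd.le (abs_nonneg _)).trans b2
    have c2 : |heatKernel₁ x τ s (y s)| ≤ 8 / ρ ^ 2 := by
      rw [le_div_iff₀ (by positivity)]
      refine (mul_le_mul_of_nonneg_left ?_ (abs_nonneg _)).trans b4
      rw [← sq_abs (y s - x)]
      gcongr
    constructor <;> linarith
  · have hd : τ - l ≤ τ - s := by linarith
    have c1 : |heatKernel x τ s (y s)| ≤ 4 / √(τ - l) := by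
      rw [le_div_iff₀ hη2]
      exact (mul_le_mul_of_nonneg_left (Real.sqrt_le_sqrt hd) (abs_nonneg _)).trans b1
    have c2 : |heatKernel₁ x τ s (y s)| ≤ 4 / (τ - l) := by
      rw [le_div_iff₀ hη]
      exact (mul_le_mul_of_nonneg_left hd (abs_nonneg _)).trans b3
    constructor <;> linarith

theorem continuousOn_kernel_boundary_Ioo (hU : IsMovingBoundarySolution H α β lam f g y U)
    (hτ : τ ≤ H) {φ : ℝ → ℝ → ℝ} (hφ : ContinuousOn (fun p : ℝ × ℝ => φ p.1 p.2) {p | p.1 < τ}) :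
    ContinuousOn (fun s => φ s (y s)) (Ioo 0 τ) :=
  hφ.comp (f := fun s => (s, y s))
    (continuousOn_id.prodMk (hU.y_cont.mono fun _ hs => ⟨hs.1.le, hs.2.le.trans hτ⟩))
    fun _ hs => hs.2

/-- The heat potential representation with pole off the boundary; `ℓ` is the value of the
solution there, and zero below the boundary. -/
theorem heat_representation (hU : IsMovingBoundarySolution H α β lam f g y U) (hτ : τ ∈ Ioc 0 H)
    {x ℓ : ℝ} (hx : x ≠ y τ)
    (hℓ : Tendsto (fun s => ∫ ξ in Ioi (y s), heatKernel x τ s ξ * U s ξ) (𝓝[<] τ) (𝓝 ℓ)) :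
    IntervalIntegrable (fun s => (boundaryGradient U y s + deriv y s * g s)
      * heatKernel x τ s (y s)) volume 0 τ ∧
    IntervalIntegrable (fun s => g s * heatKernel₁ x τ s (y s)) volume 0 τ ∧
    ℓ - ∫ ξ in Ioi (y 0), heatKernel x τ 0 ξ * f ξ
      = -(∫ s in (0 : ℝ)..τ, (boundaryGradient U y s + deriv y s * g s) * heatKernel x τ s (y s))
        + (∫ s in (0 : ℝ)..τ, g s * heatKernel₁ x τ s (y s))
        + ∫ s in (0 : ℝ)..τ, ∫ ξ in Ioi (y s), heatKernel x τ s ξ * totalSource α β lam U s ξ := by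
  obtain ⟨B, hB⟩ := hU.exists_kernel_bound_off_boundary hτ hx
  have i1 : IntervalIntegrable (fun s => (boundaryGradient U y s + deriv y s * g s)
      * heatKernel x τ s (y s)) volume 0 τ := by
    have h := hU.intervalIntegrable_flux hτ.1.le hτ.2
    rw [intervalIntegrable_iff_integrableOn_Ioo_of_le hτ.1.le] at h ⊢
    refine Integrable.mul_bdd (c := B) h
      ((hU.continuousOn_kernel_boundary_Ioo hτ.2 continuousOn_heatKernel).aestronglyMeasurable
        measurableSet_Ioo) ?_
    exact (ae_restrict_iff' measurableSet_Ioo).2 (ae_of_all _ fun s hs => (hB s hs).1)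
  have i2 : IntervalIntegrable (fun s => g s * heatKernel₁ x τ s (y s)) volume 0 τ := by
    have h : IntervalIntegrable g volume 0 τ := ContinuousOn.intervalIntegrable (by
      rw [uIcc_of_le hτ.1.le]; exact hU.g_cont.mono (Icc_subset_Icc_right hτ.2))
    rw [intervalIntegrable_iff_integrableOn_Ioo_of_le hτ.1.le] at h ⊢
    refine Integrable.mul_bdd (c := B) h
      ((hU.continuousOn_kernel_boundary_Ioo hτ.2 continuousOn_heatKernel₁).aestronglyMeasurable
        measurableSet_Ioo) ?_
    exact (ae_restrict_iff' measurableSet_Ioo).2 (ae_of_all _ fun s hs => (hB s hs).2)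
  refine ⟨i1, i2, ?_⟩
  have i3 := (hU.integrable_heatKernel_source hτ x).2
  have hl := hℓ.sub_const (∫ ξ in Ioi (y 0), heatKernel x τ 0 ξ * f ξ)
  have hr := ((tendsto_intervalIntegral_right hτ.1 i1).neg.add
    (tendsto_intervalIntegral_right hτ.1 i2)).add (tendsto_intervalIntegral_right hτ.1 i3)
  refine tendsto_nhds_unique (hl.congr' ?_) hr
  filter_upwards [Ioo_mem_nhdsLT hτ.1] with b hb
  exact (hU.green_identity_initial (isBackwardHeatTest_heatKernel hτ.1 x) hb.1 hb.2 hτ.2).2.2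

theorem integrableOn_mul_initial (hU : IsMovingBoundarySolution H α β lam f g y U) {k : ℝ → ℝ}
    (hk : Continuous k) (hd : ∀ A, ∃ C, ∀ ξ, |k ξ| ≤ C * Real.exp (-A * |ξ|)) :
    IntegrableOn (fun ξ => f ξ * k ξ) (Ioi (y 0)) := by
  obtain ⟨CU, A, hCU, hA, bU⟩ := hU.exists_growth
  obtain ⟨C, hC⟩ := hd (A + 1)
  have h0 : (0 : ℝ) ∈ Icc 0 H := ⟨le_rfl, hU.horizon_pos.le⟩
  have hf : ContinuousOn f (Ioi (y 0)) :=
    ((hU.continuousOn_slice h0).mono Ioi_subset_Ici_self).congr fun ξ hξ =>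
      (hU.initial ξ (le_of_lt hξ)).symm
  refine (integrable_exp_neg_abs.const_mul (CU * C)).integrableOn.mono'
    ((hf.mul hk.continuousOn).aestronglyMeasurable measurableSet_Ioi) ?_
  refine (ae_restrict_iff' measurableSet_Ioi).2 (ae_of_all _ fun ξ hξ => ?_)
  have h1 := bU 0 h0 ξ (le_of_lt hξ)
  rw [hU.initial ξ (le_of_lt hξ)] at h1
  rw [norm_mul, Real.norm_eq_abs, Real.norm_eq_abs]
  calc _ ≤ (CU * Real.exp (A * |ξ|)) * (C * Real.exp (-(A + 1) * |ξ|)) :=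
        mul_le_mul h1 (hC ξ) (abs_nonneg _) (by positivity)
    _ = _ := by
        rw [show -|ξ| = A * |ξ| + -(A + 1) * |ξ| by ring, Real.exp_add]; ring

theorem integrableOn_slice_source (hU : IsMovingBoundarySolution H α β lam f g y U)
    {φ φ1 φ2 : ℝ → ℝ → ℝ} (hφ : IsBackwardHeatTest τ φ φ1 φ2) (hτ : τ ≤ H) {s : ℝ}
    (hs : s ∈ Ioo 0 τ) :
    IntegrableOn (fun ξ => φ s ξ * totalSource α β lam U s ξ) (Ioi (y s)) := by
  obtain ⟨A, M, hA, hM0, -, -, bh⟩ := hU.exists_totalSource_bound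
  obtain ⟨C, hC⟩ := hφ.decay s hs.2 (A + 1)
  have hs' : s ∈ Ioo 0 H := ⟨hs.1, hs.2.trans_le hτ⟩
  have c1 : ContinuousOn (φ s) (Ioi (y s)) := hφ.cont.comp_horiz fun _ _ => hs.2
  have c2 : ContinuousOn (totalSource α β lam U s) (Ioi (y s)) :=
    hU.continuousOn_totalSource.comp_horiz fun _ hz => ⟨hs', hz⟩
  refine (integrable_exp_neg_abs.const_mul (C * M s)).integrableOn.mono'
    ((c1.mul c2).aestronglyMeasurable measurableSet_Ioi) ?_
  refine (ae_restrict_iff' measurableSet_Ioi).2 (ae_of_all _ fun ξ hξ => ?_)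
  rw [norm_mul, Real.norm_eq_abs, Real.norm_eq_abs]
  have h1 := (hC s ⟨hs.1.le, le_rfl⟩ ξ).1
  calc _ ≤ (C * Real.exp (-(A + 1) * |ξ|)) * (M s * Real.exp (A * |ξ|)) :=
        mul_le_mul h1 (bh s hs' ξ hξ) (abs_nonneg _) ((abs_nonneg _).trans h1)
    _ = _ := by
        rw [show -|ξ| = -(A + 1) * |ξ| + A * |ξ| by ring, Real.exp_add]; ring

theorem continuous_heatKernel_initial (x : ℝ) : Continuous (heatKernel x τ 0) := by
  unfold heatKernel; fun_prop

theorem heatKernel_initial_decay (hτ : 0 < τ) (x A : ℝ) :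
    ∃ C, ∀ ξ, |heatKernel x τ 0 ξ| ≤ C * Real.exp (-A * |ξ|) := by
  obtain ⟨C, hC⟩ := exists_heatKernel_decay hτ hτ A x
  exact ⟨C, fun ξ => (hC 0 ⟨le_rfl, le_rfl⟩ ξ).1⟩

/-- The reflected pole `2y(τ) - x` lies below the boundary, so its representation has left-hand
value `0`. Subtracting it from the representation at `x` keeps `U(τ, x)` and turns each kernel into
its image version. -/
theorem satisfiesPriceEquation (hU : IsMovingBoundarySolution H α β lam f g y U) :
    SatisfiesPriceEquation H α β lam f g y U := by
  intro τ hτ x hx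
  have hx' : 2 * y τ - x < y τ := by linarith
  obtain ⟨a1, a2, a3⟩ := hU.heat_representation hτ hx.ne' (hU.tendsto_moment_above hτ hx)
  obtain ⟨b1, b2, b3⟩ := hU.heat_representation hτ hx'.ne (hU.tendsto_moment_below hτ hx')
  have f1 := hU.integrableOn_mul_initial (continuous_heatKernel_initial x)
    (heatKernel_initial_decay hτ.1 x)
  have f2 := hU.integrableOn_mul_initial (continuous_heatKernel_initial (2 * y τ - x))
    (heatKernel_initial_decay hτ.1 (2 * y τ - x))
  obtain ⟨s1, t1⟩ := hU.integrable_heatKernel_source hτ x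
  obtain ⟨s2, t2⟩ := hU.integrable_heatKernel_source hτ (2 * y τ - x)
  have e1 : ∀ ξ, f ξ * imageKernel y τ x 0 ξ
      = f ξ * heatKernel x τ 0 ξ - f ξ * heatKernel (2 * y τ - x) τ 0 ξ := fun ξ => by
    rw [imageKernel_eq, mul_sub]
  have e2 : ∀ s, (boundaryGradient U y s + deriv y s * g s) * imageKernel y τ x s (y s)
      = (boundaryGradient U y s + deriv y s * g s) * heatKernel x τ s (y s)
        - (boundaryGradient U y s + deriv y s * g s) * heatKernel (2 * y τ - x) τ s (y s) :=
    fun s => by rw [imageKernel_eq, mul_sub]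
  have e3 : ∀ s ∈ uIcc 0 τ, g s * heatKernel₁ x τ s (y s)
      - g s * heatKernel₁ (2 * y τ - x) τ s (y s) = g s * rebateKernel y τ x s := fun s hs => by
    rw [uIcc_of_le hτ.1.le] at hs
    rw [rebateKernel_eq y x hs.2, mul_sub]
  have e4 : ∀ s ξ, imageKernel y τ x s ξ * totalSource α β lam U s ξ
      = heatKernel x τ s ξ * totalSource α β lam U s ξ
        - heatKernel (2 * y τ - x) τ s ξ * totalSource α β lam U s ξ := fun s ξ => by
    rw [imageKernel_eq, sub_mul]
  -- Splitting the inner integral needs integrable slices, which are available only strictly between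
  -- `0` and `τ`; the outer integral does not see the end points.
  have e5 : ∀ s ∈ Ioo 0 τ, ∫ ξ in Ioi (y s), imageKernel y τ x s ξ * totalSource α β lam U s ξ
      = (∫ ξ in Ioi (y s), heatKernel x τ s ξ * totalSource α β lam U s ξ)
        - ∫ ξ in Ioi (y s), heatKernel (2 * y τ - x) τ s ξ * totalSource α β lam U s ξ := by
    intro s hs
    simp only [e4]
    exact integral_sub
      (hU.integrableOn_slice_source (isBackwardHeatTest_heatKernel hτ.1 x) hτ.2 hs)
      (hU.integrableOn_slice_source (isBackwardHeatTest_heatKernel hτ.1 (2 * y τ - x)) hτ.2 hs)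
  refine ⟨?_, ?_, ?_, ?_, ?_⟩
  · simp only [e1]; exact f1.sub f2
  · simp only [e2]; exact a1.sub b1
  · exact (a2.sub b2).congr fun s hs => e3 s (uIoc_subset_uIcc hs)
  · simp only [e4]; exact s1.sub s2
  · have g1 : ∫ ξ in Ioi (y 0), f ξ * imageKernel y τ x 0 ξ
        = (∫ ξ in Ioi (y 0), heatKernel x τ 0 ξ * f ξ)
          - ∫ ξ in Ioi (y 0), heatKernel (2 * y τ - x) τ 0 ξ * f ξ := by
      simp only [e1]
      rw [integral_sub f1 f2]
      simp only [mul_comm (f _)]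
    have g2 : ∫ s in (0 : ℝ)..τ, (boundaryGradient U y s + deriv y s * g s)
          * imageKernel y τ x s (y s)
        = (∫ s in (0 : ℝ)..τ, (boundaryGradient U y s + deriv y s * g s) * heatKernel x τ s (y s))
          - ∫ s in (0 : ℝ)..τ, (boundaryGradient U y s + deriv y s * g s)
            * heatKernel (2 * y τ - x) τ s (y s) := by
      simp only [e2]
      exact intervalIntegral.integral_sub a1 b1
    have g3 : ∫ s in (0 : ℝ)..τ, g s * rebateKernel y τ x s
        = (∫ s in (0 : ℝ)..τ, g s * heatKernel₁ x τ s (y s))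
          - ∫ s in (0 : ℝ)..τ, g s * heatKernel₁ (2 * y τ - x) τ s (y s) := by
      rw [← intervalIntegral.integral_sub a2 b2]
      exact intervalIntegral.integral_congr fun s hs => (e3 s hs).symm
    have g4 : ∫ s in (0 : ℝ)..τ, ∫ ξ in Ioi (y s),
          imageKernel y τ x s ξ * totalSource α β lam U s ξ
        = (∫ s in (0 : ℝ)..τ, ∫ ξ in Ioi (y s), heatKernel x τ s ξ * totalSource α β lam U s ξ)
          - ∫ s in (0 : ℝ)..τ, ∫ ξ in Ioi (y s),
            heatKernel (2 * y τ - x) τ s ξ * totalSource α β lam U s ξ := by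
      rw [← intervalIntegral.integral_sub t1 t2, intervalIntegral.integral_of_le hτ.1.le,
        intervalIntegral.integral_of_le hτ.1.le, integral_Ioc_eq_integral_Ioo,
        integral_Ioc_eq_integral_Ioo]
      exact setIntegral_congr_fun measurableSet_Ioo e5
    rw [g1, g2, g3, g4]
    linarith

end IsMovingBoundarySolution


/-! ### Integration by parts for the initial value. -/

theorem tendsto_zero_of_exp_decay {k : ℝ → ℝ} {C : ℝ} (h : ∀ ξ, |k ξ| ≤ C * Real.exp (-1 * |ξ|)) :
    Tendsto k atTop (𝓝 0) := by
  have h0 : Tendsto (fun ξ : ℝ => C * Real.exp (-1 * |ξ|)) atTop (𝓝 0) := by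
    have := ((Real.tendsto_exp_neg_atTop_nhds_zero.comp tendsto_abs_atTop_atTop).const_mul C)
    simpa [Function.comp_def] using this
  exact squeeze_zero_norm h h0

theorem IsBackwardHeatTest.integrable_grad {τ s : ℝ} {φ φ1 φ2 : ℝ → ℝ → ℝ}
    (hφ : IsBackwardHeatTest τ φ φ1 φ2) (hs0 : 0 ≤ s) (hs : s < τ) : Integrable (φ1 s) := by
  obtain ⟨C, hC⟩ := hφ.decay s hs 1
  have c : Continuous (φ1 s) := by
    rw [← continuousOn_univ]
    exact hφ.cont_one.comp_horiz fun _ _ => hs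
  refine (integrable_exp_neg_abs.const_mul C).mono' c.aestronglyMeasurable (ae_of_all _ fun ξ => ?_)
  have := (hC s ⟨hs0, le_rfl⟩ ξ).2
  rwa [neg_one_mul] at this

theorem IsBackwardHeatTest.integral_grad_Ioi {τ s : ℝ} {φ φ1 φ2 : ℝ → ℝ → ℝ}
    (hφ : IsBackwardHeatTest τ φ φ1 φ2) (hs0 : 0 ≤ s) (hs : s < τ) (c : ℝ) :
    ∫ ξ in Ioi c, φ1 s ξ = -φ s c := by
  obtain ⟨C, hC⟩ := hφ.decay s hs 1
  rw [integral_Ioi_of_hasDerivAt_of_tendsto' (fun x _ => hφ.space s hs x)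
    (hφ.integrable_grad hs0 hs).integrableOn
    (tendsto_zero_of_exp_decay fun ξ => (hC s ⟨hs0, le_rfl⟩ ξ).1), zero_sub]

/-- Integration by parts on a half line for a locally Lipschitz function of exponential growth. -/
theorem integral_deriv_mul_of_lipschitz {f k k' : ℝ → ℝ} {c CL A CF B : ℝ}
    (hL : ∀ x ∈ Ici c, ∀ z ∈ Ici c, |f x - f z| ≤ CL * Real.exp (A * max |x| |z|) * |x - z|)
    (hF : ∀ x ∈ Ici c, |f x| ≤ CF * Real.exp (B * |x|))
    (hk : ∀ x, HasDerivAt k (k' x) x) (hk'c : Continuous k')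
    (hd : ∀ A, ∃ C, ∀ ξ, |k ξ| ≤ C * Real.exp (-A * |ξ|) ∧ |k' ξ| ≤ C * Real.exp (-A * |ξ|)) :
    IntegrableOn (fun ξ => deriv f ξ * k ξ) (Ioi c) ∧
    ∫ ξ in Ioi c, deriv f ξ * k ξ = -(f c * k c) - ∫ ξ in Ioi c, k' ξ * f ξ := by
  have hkc : Continuous k := continuous_iff_continuousAt.2 fun x => (hk x).continuousAt
  have hlip : ∀ N, ∃ K : NNReal, LipschitzOnWith K f (Icc c N) := by
    intro N
    refine ⟨(|CL| * Real.exp (|A| * max |c| |N|)).toNNReal,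
      LipschitzOnWith.of_dist_le_mul fun x hx z hz => ?_⟩
    rw [Real.coe_toNNReal _ (by positivity), Real.dist_eq, Real.dist_eq]
    have hb : ∀ x ∈ Icc c N, |x| ≤ max |c| |N| := fun x hx => by
      rw [abs_le]
      constructor
      · have := neg_abs_le c; have := le_max_left |c| |N|; linarith [hx.1]
      · have := le_abs_self N; have := le_max_right |c| |N|; linarith [hx.2]
    refine (hL x hx.1 z hz.1).trans ?_
    have h1 : A * max |x| |z| ≤ |A| * max |c| |N| :=
      (mul_le_mul_of_nonneg_right (le_abs_self A) (le_max_of_le_left (abs_nonneg _))).trans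
        (mul_le_mul_of_nonneg_left (max_le (hb x hx) (hb z hz)) (abs_nonneg _))
    have := le_abs_self CL
    gcongr
  have hfc : ContinuousOn f (Ici c) := by
    intro x hx
    obtain ⟨K, hK⟩ := hlip (x + 1)
    have hx' : x ∈ Icc c (x + 1) := ⟨hx, by linarith⟩
    refine (hK.continuousOn x hx').mono_of_mem_nhdsWithin ?_
    have := inter_mem (self_mem_nhdsWithin (s := Ici c) (a := x))
      (mem_nhdsWithin_of_mem_nhds (Iic_mem_nhds (show x < x + 1 by linarith)))
    exact mem_of_superset this fun z hz => ⟨hz.1, hz.2⟩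
  -- The bound holds at every interior point, since `deriv` is zero where `f` is not differentiable.
  -- The local Lipschitz constant on the unit ball around `ξ` costs the extra factor `e^{|A|}`.
  have hderiv : ∀ ξ ∈ Ioi c, |deriv f ξ| ≤ |CL| * Real.exp |A| * Real.exp (|A| * |ξ|) := by
    intro ξ hξ
    have := norm_deriv_le_of_lip' (f := f) (x₀ := ξ)
      (C := |CL| * Real.exp |A| * Real.exp (|A| * |ξ|)) (by positivity) ?_
    · exact this
    · filter_upwards [Ioi_mem_nhds hξ, Metric.ball_mem_nhds ξ one_pos] with z hz hz1
      rw [Real.norm_eq_abs, Real.norm_eq_abs]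
      refine (hL z (Ioi_subset_Ici_self hz) ξ (Ioi_subset_Ici_self hξ)).trans ?_
      rw [Metric.mem_ball, Real.dist_eq] at hz1
      have h1 : max |z| |ξ| ≤ 1 + |ξ| := by
        refine max_le ?_ (by linarith)
        calc |z| = |(z - ξ) + ξ| := by ring_nf
          _ ≤ |z - ξ| + |ξ| := abs_add_le _ _
          _ ≤ _ := by linarith
      have h2 : A * max |z| |ξ| ≤ |A| + |A| * |ξ| := by
        calc _ ≤ |A| * max |z| |ξ| :=
              mul_le_mul_of_nonneg_right (le_abs_self A) (le_max_of_le_left (abs_nonneg _))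
          _ ≤ |A| * (1 + |ξ|) := mul_le_mul_of_nonneg_left h1 (abs_nonneg _)
          _ = _ := by ring
      have h3 := le_abs_self CL
      rw [mul_assoc |CL|, ← Real.exp_add]
      gcongr
  have int1 : IntegrableOn (fun ξ => deriv f ξ * k ξ) (Ioi c) := by
    obtain ⟨C, hC⟩ := hd (|A| + 1)
    refine (integrable_exp_neg_abs.const_mul (|CL| * Real.exp |A| * C)).integrableOn.mono'
      ((measurable_deriv f).mul hkc.measurable).aestronglyMeasurable ?_
    refine (ae_restrict_iff' measurableSet_Ioi).2 (ae_of_all _ fun ξ hξ => ?_)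
    rw [norm_mul, Real.norm_eq_abs, Real.norm_eq_abs]
    calc _ ≤ (|CL| * Real.exp |A| * Real.exp (|A| * |ξ|)) * (C * Real.exp (-(|A| + 1) * |ξ|)) :=
          mul_le_mul (hderiv ξ hξ) (hC ξ).1 (abs_nonneg _) (by positivity)
      _ = _ := by
          rw [show -|ξ| = |A| * |ξ| + -(|A| + 1) * |ξ| by ring, Real.exp_add]; ring
  have hprod : ∀ {w : ℝ → ℝ}, (∀ A, ∃ C, ∀ ξ, |w ξ| ≤ C * Real.exp (-A * |ξ|)) →
      ∃ C, ∀ ξ ∈ Ici c, |f ξ * w ξ| ≤ C * Real.exp (-1 * |ξ|) := by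
    intro w hw
    obtain ⟨C, hC⟩ := hw (B + 1)
    refine ⟨CF * C, fun ξ hξ => ?_⟩
    rw [abs_mul]
    calc _ ≤ (CF * Real.exp (B * |ξ|)) * (C * Real.exp (-(B + 1) * |ξ|)) :=
          mul_le_mul (hF ξ hξ) (hC ξ) (abs_nonneg _) ((abs_nonneg _).trans (hF ξ hξ))
      _ = _ := by
          rw [show -1 * |ξ| = B * |ξ| + -(B + 1) * |ξ| by ring, Real.exp_add]; ring
  have int2 : IntegrableOn (fun ξ => f ξ * k' ξ) (Ioi c) := by
    obtain ⟨C, hC⟩ := hprod (w := k') fun A => by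
      obtain ⟨C, hC⟩ := hd A
      exact ⟨C, fun ξ => (hC ξ).2⟩
    refine (integrable_exp_neg_abs.const_mul C).integrableOn.mono'
      (((hfc.mono Ioi_subset_Ici_self).mul hk'c.continuousOn).aestronglyMeasurable
        measurableSet_Ioi) ?_
    refine (ae_restrict_iff' measurableSet_Ioi).2 (ae_of_all _ fun ξ hξ => ?_)
    have := hC ξ (Ioi_subset_Ici_self hξ)
    rwa [neg_one_mul] at this
  refine ⟨int1, ?_⟩
  have hk1 : ContDiff ℝ 1 k := by
    rw [contDiff_one_iff_deriv]
    refine ⟨fun x => (hk x).differentiableAt, ?_⟩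
    rwa [show deriv k = k' from funext fun x => (hk x).deriv]
  have hN : ∀ N, c ≤ N → ∫ ξ in c..N, deriv f ξ * k ξ
      = f N * k N - f c * k c - ∫ ξ in c..N, f ξ * k' ξ := by
    intro N hN
    obtain ⟨K, hK⟩ := hlip N
    -- A Lipschitz function is absolutely continuous, so the integral of its almost everywhere
    -- derivative obeys integration by parts on `[c, N]`; the decay of `k` and `k'` allows `N → ∞`.
    have ac1 : AbsolutelyContinuousOnInterval f c N :=
      LipschitzOnWith.absolutelyContinuousOnInterval (K := K) (by rwa [uIcc_of_le hN])
    obtain ⟨K', hK'⟩ := hk1.contDiffOn.exists_lipschitzOnWith (s := uIcc c N) one_ne_zero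
      (convex_uIcc c N) isCompact_uIcc
    have := AbsolutelyContinuousOnInterval.integral_mul_deriv_eq_deriv_mul ac1
      hK'.absolutelyContinuousOnInterval
    rw [show deriv k = k' from funext fun x => (hk x).deriv] at this
    linarith
  have l1 := intervalIntegral_tendsto_integral_Ioi c int1 tendsto_id
  have l2 := intervalIntegral_tendsto_integral_Ioi c int2 tendsto_id
  have l3 : Tendsto (fun N => f N * k N) atTop (𝓝 0) := by
    obtain ⟨C, hC⟩ := hprod (w := k) fun A => by
      obtain ⟨C, hC⟩ := hd A
      exact ⟨C, fun ξ => (hC ξ).1⟩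
    have h0 : Tendsto (fun ξ : ℝ => C * Real.exp (-1 * |ξ|)) atTop (𝓝 0) := by
      have := ((Real.tendsto_exp_neg_atTop_nhds_zero.comp tendsto_abs_atTop_atTop).const_mul C)
      simpa [Function.comp_def] using this
    refine squeeze_zero_norm' ?_ h0
    filter_upwards [eventually_ge_atTop c] with N hN using hC N hN
  have l4 := (l3.sub_const (f c * k c)).sub l2
  have := tendsto_nhds_unique (l1.congr' (by
    filter_upwards [eventually_ge_atTop c] with N h using hN N h)) l4
  rw [this, zero_sub]
  simp only [mul_comm (f _)]

/-! ### The jump relation at the boundary. -/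

namespace IsMovingBoundarySolution

variable {H : ℝ} {α β : ℝ → ℝ} {lam : ℝ → ℝ → ℝ} {f g y : ℝ → ℝ} {U : ℝ → ℝ → ℝ} {τ : ℝ}

/-- The speed may be unbounded at time `0`, but only increments ending at `τ` matter. On `[τ/2, τ]`
the curve is `C^1`; for earlier `s` one has `τ - s > τ/2` and boundedness of `y` suffices, whence
the summand `2Y · (2/τ)`. -/
theorem exists_lipschitz_y (hU : IsMovingBoundarySolution H α β lam f g y U) (hτ : τ ∈ Ioc 0 H) :
    ∃ L, 0 ≤ L ∧ ∀ s ∈ Ioo 0 τ, |y s - y τ| ≤ L * (τ - s) := by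
  have hpos := half_pos hτ.1
  obtain ⟨K, hK⟩ := (hU.y_smooth.mono (fun s (hs : s ∈ Icc (τ / 2) τ) =>
    ⟨hpos.trans_le hs.1, hs.2.trans hτ.2⟩)).exists_lipschitzOnWith one_ne_zero (convex_Icc _ _)
    isCompact_Icc
  obtain ⟨Y, hY⟩ := isCompact_Icc.exists_bound_of_continuousOn hU.y_cont
  have hY0 : 0 ≤ Y := (norm_nonneg _).trans (hY τ (Ioc_subset_Icc_self hτ))
  refine ⟨K + 2 * Y * (2 / τ), by have := hτ.1; positivity, fun s hs => ?_⟩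
  have hδ : 0 < τ - s := sub_pos.2 hs.2
  have hτ0 := hτ.1
  rcases le_or_gt (τ / 2) s with h | h
  · have := hK.dist_le_mul s ⟨h, hs.2.le⟩ τ ⟨by linarith, le_rfl⟩
    rw [Real.dist_eq, Real.dist_eq, abs_sub_comm s, abs_of_pos hδ] at this
    refine this.trans ?_
    have : 0 ≤ 2 * Y * (2 / τ) := by positivity
    nlinarith
  · have h1 := hY s ⟨hs.1.le, hs.2.le.trans hτ.2⟩
    have h2 := hY τ (Ioc_subset_Icc_self hτ)
    rw [Real.norm_eq_abs] at h1 h2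
    have h3 : (1 : ℝ) ≤ 2 / τ * (τ - s) := by
      rw [div_mul_eq_mul_div, le_div_iff₀ hτ0]; linarith
    have h4 := K.coe_nonneg
    calc |y s - y τ| ≤ |y s| + |y τ| := abs_sub _ _
      _ ≤ 2 * Y := by linarith
      _ ≤ 2 * Y * (2 / τ * (τ - s)) := le_mul_of_one_le_right (by positivity) h3
      _ ≤ _ := by nlinarith [mul_nonneg h4 hδ.le]

/-- Mean value theorem for the solution between the boundary and an interior point. -/
theorem exists_mean_value (hU : IsMovingBoundarySolution H α β lam f g y U) {s ξ : ℝ}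
    (hs : s ∈ Ioc 0 H) (hξ : y s < ξ) : ∃ η ∈ Ioo (y s) ξ,
      U s ξ - g s = derivWithin (U s) (Ici (y s)) η * (ξ - y s) := by
  obtain ⟨η, hη, h⟩ := exists_hasDerivAt_eq_slope (U s) (derivWithin (U s) (Ici (y s))) hξ
    ((hU.continuousOn_slice (Ioc_subset_Icc_self hs)).mono Icc_subset_Ici_self)
    (fun x hx => hU.hasDerivAt_space hs hx.1)
  refine ⟨η, hη, ?_⟩
  rw [h, hU.boundary s (Ioc_subset_Icc_self hs), div_mul_cancel₀ _ (sub_pos.2 hξ).ne']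

/-- The factor `ξ - y s` compensates the singularity of the kernel gradient in the jump relation.
Within distance `1` of the boundary it comes from the mean value theorem and the gradient bound on a
compact strip; farther away the growth bound is enough, as the factor exceeds `1`. -/
theorem exists_linear_bound (hU : IsMovingBoundarySolution H α β lam f g y U) (hτ : τ ∈ Ioc 0 H) :
    ∃ C A, 0 ≤ C ∧ 0 ≤ A ∧ ∀ s ∈ Icc (τ / 2) τ, ∀ ξ, y s < ξ →
      |U s ξ - g s| ≤ C * Real.exp (A * |ξ|) * (ξ - y s) := by
  have hpos := half_pos hτ.1
  have hsub : ∀ s ∈ Icc (τ / 2) τ, s ∈ Ioc 0 H := fun s hs => ⟨hpos.trans_le hs.1, hs.2.trans hτ.2⟩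
  obtain ⟨C, A, hC, hA, hg⟩ := hU.exists_growth
  obtain ⟨G, hG⟩ := isCompact_Icc.exists_bound_of_continuousOn hU.g_cont
  have hG0 : 0 ≤ G := (norm_nonneg _).trans (hG τ (Ioc_subset_Icc_self hτ))
  have cmap : ContinuousOn (fun r : ℝ × ℝ => (r.1, y r.1 + r.2)) (Icc (τ / 2) τ ×ˢ Icc 0 1) :=
    continuousOn_fst.prodMk ((hU.y_cont.comp continuousOn_fst fun r hr =>
      Ioc_subset_Icc_self (hsub _ hr.1)).add continuousOn_snd)
  obtain ⟨X, hX⟩ := (isCompact_Icc.prod isCompact_Icc).exists_bound_of_continuousOn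
    (hU.grad_cont.comp cmap fun r hr => ⟨hsub _ hr.1, by simpa using hr.2.1⟩)
  have hX0 : 0 ≤ X := (norm_nonneg _).trans
    (hX (τ, 0) ⟨⟨by linarith [hτ.1], le_rfl⟩, ⟨le_rfl, zero_le_one⟩⟩)
  refine ⟨X + G + C, A, by positivity, hA, fun s hs ξ hξ => ?_⟩
  have hd : 0 < ξ - y s := sub_pos.2 hξ
  have he : 1 ≤ Real.exp (A * |ξ|) := Real.one_le_exp (by positivity)
  rcases le_or_gt (ξ - y s) 1 with h | h
  · obtain ⟨η, hη, e⟩ := hU.exists_mean_value (hsub s hs) hξ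
    have := hX (s, η - y s) ⟨hs, ⟨by linarith [hη.1], by linarith [hη.2]⟩⟩
    simp only [Function.comp, add_sub_cancel, Real.norm_eq_abs] at this
    rw [e, abs_mul, abs_of_pos hd]
    gcongr
    nlinarith
  · have h1 := hg s (Ioc_subset_Icc_self (hsub s hs)) ξ hξ.le
    have h2 := hG s (Ioc_subset_Icc_self (hsub s hs))
    rw [Real.norm_eq_abs] at h2
    have h3 : |U s ξ - g s| ≤ (X + G + C) * Real.exp (A * |ξ|) := by
      refine (abs_sub _ _).trans ?_
      nlinarith
    exact h3.trans (le_mul_of_one_le_right (by positivity) h.le)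

/-- The jump relation: the gradient of the heat kernel with pole on the boundary recovers half of
the boundary gradient. -/
theorem tendsto_moment_gradient (hU : IsMovingBoundarySolution H α β lam f g y U)
    (hτ : τ ∈ Ioc 0 H) :
    Tendsto (fun s => ∫ ξ in Ioi (y s), heatKernel₁ (y τ) τ s ξ * (U s ξ - g s)) (𝓝[<] τ)
      (𝓝 (-boundaryGradient U y τ / 2)) := by
  obtain ⟨L, hL, hLy⟩ := hU.exists_lipschitz_y hτ
  obtain ⟨C, A, hC, hA, hCA⟩ := hU.exists_linear_bound hτ
  have hev := eventually_mem hτ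
  have hev2 : ∀ᶠ s in 𝓝[<] τ, s ∈ Icc (τ / 2) τ := by
    filter_upwards [Ioo_mem_nhdsLT (half_lt_self hτ.1)] with s hs using ⟨hs.1.le, hs.2.le⟩
  have hsq : ∀ s, s < τ → τ - s = √(τ - s) * √(τ - s) := fun s hs =>
    (Real.mul_self_sqrt (sub_pos.2 hs).le).symm
  have hlim0 := tendsto_sqrt_sub_left τ
  -- For `w > 0`, `U - g` behaves like `Ψ · 2√(τ - s) w`, so the factor `-w/√(τ - s)` of the kernel
  -- gradient leaves `-2Ψw²`; for `w < 0` the point is eventually below the boundary.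
  have h := tendsto_gaussian_average (τ := τ)
    (C := C * Real.exp (A * |y τ|) * (L * √τ + 2)) (A := A * (2 * √τ) + 2)
    (L := (Ioi 0).indicator fun w => (-2 * boundaryGradient U y τ) * w ^ 2)
    (Φ := fun s w => -(w / √(τ - s)) *
      (Ioi (y s)).indicator (fun ξ => U s ξ - g s) (y τ + 2 * √(τ - s) * w)) ?_ ?_ ?_
  · rw [integral_sq_mul_gaussian_Ioi,
      show -2 * boundaryGradient U y τ / 4 = -boundaryGradient U y τ / 2 by ring] at h
    refine h.congr' ?_
    filter_upwards [hev] with s hs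
    rw [setIntegral_mul_indicator, integral_heatKernel₁_mul hs.1.2]
  · filter_upwards [hev] with s hs
    have := (measurable_indicator_Ioi (u := fun ξ => U s ξ - g s)
      ((hU.continuousOn_slice (Ioo_subset_Icc_self hs.2)).sub continuousOn_const)).comp
      (show Measurable fun w => y τ + 2 * √(τ - s) * w by fun_prop)
    exact Measurable.mul (by fun_prop) this
  · filter_upwards [hev, hev2] with s hs hs2 w
    have hr : 0 < √(τ - s) := Real.sqrt_pos.2 (sub_pos.2 hs.1.2)
    by_cases hm : y τ + 2 * √(τ - s) * w ∈ Ioi (y s)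
    · rw [indicator_of_mem hm, abs_mul, abs_neg, abs_div, abs_of_pos hr]
      have h1 := hCA s hs2 _ hm
      have h0 := abs_nonneg w
      have hrτ : √(τ - s) ≤ √τ := Real.sqrt_le_sqrt (by linarith [hs.1.1])
      have h2 : y τ + 2 * √(τ - s) * w - y s ≤ √(τ - s) * (L * √τ + 2 * |w|) := by
        have e1 := hLy s hs.1
        rw [hsq s hs.1.2, abs_le] at e1
        nlinarith [le_abs_self w, mul_nonneg hL hr.le, mul_le_mul_of_nonneg_left hrτ
          (mul_nonneg hL hr.le), mul_le_mul_of_nonneg_left (le_abs_self w) hr.le]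
      have h3 : |y τ + 2 * √(τ - s) * w| ≤ |y τ| + 2 * √τ * |w| := by
        refine (abs_add_le _ _).trans ?_
        rw [abs_mul, abs_of_pos (by positivity : 0 < 2 * √(τ - s))]
        gcongr
      have h4 : |w| ≤ Real.exp |w| := by linarith [Real.add_one_le_exp |w|]
      have h5 : 1 ≤ Real.exp |w| := Real.one_le_exp h0
      have h6 : L * √τ + 2 * |w| ≤ (L * √τ + 2) * Real.exp |w| := by
        have : 0 ≤ L * √τ := by positivity
        nlinarith
      calc |w| / √(τ - s) * |U s (y τ + 2 * √(τ - s) * w) - g s|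
          ≤ |w| / √(τ - s) * (C * Real.exp (A * (|y τ| + 2 * √τ * |w|))
              * (√(τ - s) * (L * √τ + 2 * |w|))) := by
            refine mul_le_mul_of_nonneg_left (h1.trans ?_) (by positivity)
            refine mul_le_mul ?_ h2 (sub_pos.2 hm).le (by positivity)
            gcongr
        _ = |w| * (C * Real.exp (A * (|y τ| + 2 * √τ * |w|)) * (L * √τ + 2 * |w|)) := by
            field_simp
        _ ≤ Real.exp |w| * (C * Real.exp (A * (|y τ| + 2 * √τ * |w|))
              * ((L * √τ + 2) * Real.exp |w|)) := by gcongr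
        _ = _ := by
            rw [show A * (|y τ| + 2 * √τ * |w|) = A * |y τ| + A * (2 * √τ) * |w| by ring,
              show (A * (2 * √τ) + 2) * |w| = A * (2 * √τ) * |w| + |w| + |w| by ring,
              Real.exp_add, Real.exp_add, Real.exp_add]
            ring
    · rw [indicator_of_notMem hm, mul_zero, abs_zero]
      positivity
  · refine ae_of_all _ fun w => ?_
    -- The boundary moves by `O(τ - s)`, which is negligible on the scale `√(τ - s)`: in the
    -- variable `w` the boundary sits at `0` in the limit.
    have hsmall : Tendsto (fun s => (y τ - y s) / √(τ - s)) (𝓝[<] τ) (𝓝 0) := by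
      have h0 : Tendsto (fun s => L * √(τ - s)) (𝓝[<] τ) (𝓝 0) := by
        simpa using hlim0.const_mul L
      refine squeeze_zero_norm' ?_ h0
      filter_upwards [hev] with s hs
      have hr : 0 < √(τ - s) := Real.sqrt_pos.2 (sub_pos.2 hs.1.2)
      have e1 := hLy s hs.1
      rw [hsq s hs.1.2, abs_sub_comm] at e1
      rw [norm_div, Real.norm_eq_abs, Real.norm_eq_abs, abs_of_pos hr, div_le_iff₀ hr]
      linarith
    rcases lt_trichotomy w 0 with hw | rfl | hw
    · rw [indicator_of_notMem (fun h : w ∈ Ioi 0 => lt_asymm hw h)]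
      have : ∀ᶠ s in 𝓝[<] τ, (y τ - y s) / √(τ - s) < -2 * w :=
        hsmall.eventually (eventually_lt_nhds (by linarith))
      refine tendsto_const_nhds.congr' ?_
      filter_upwards [this, hev] with s hs hs'
      have hr : 0 < √(τ - s) := Real.sqrt_pos.2 (sub_pos.2 hs'.1.2)
      rw [div_lt_iff₀ hr] at hs
      have : ¬ (y τ + 2 * √(τ - s) * w ∈ Ioi (y s)) := fun h => by
        rw [mem_Ioi] at h; linarith
      rw [indicator_of_notMem this, mul_zero]
    · simp
    · rw [indicator_of_mem (show w ∈ Ioi 0 from hw)]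
      have h1 : ∀ᶠ s in 𝓝[<] τ, -2 * w < (y τ - y s) / √(τ - s) :=
        hsmall.eventually (eventually_gt_nhds (by linarith))
      have h2 : ∀ᶠ s in 𝓝[<] τ, y s < y τ + 2 * √(τ - s) * w := by
        filter_upwards [h1, hev] with s hs hs'
        have hr : 0 < √(τ - s) := Real.sqrt_pos.2 (sub_pos.2 hs'.1.2)
        rw [lt_div_iff₀ hr] at hs
        linarith
      -- The mean value point is chosen for all `s`, under a condition, to make `η` a function. It
      -- is squeezed between `y s` and the scaled point, so joint continuity of the gradient up to
      -- the boundary applies.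
      have hmv : ∀ s, ∃ η, (s ∈ Ioc 0 H ∧ y s < y τ + 2 * √(τ - s) * w) →
          η ∈ Ioo (y s) (y τ + 2 * √(τ - s) * w) ∧
          U s (y τ + 2 * √(τ - s) * w) - g s
            = derivWithin (U s) (Ici (y s)) η * (y τ + 2 * √(τ - s) * w - y s) := fun s => by
        by_cases h : s ∈ Ioc 0 H ∧ y s < y τ + 2 * √(τ - s) * w
        · obtain ⟨η, h1, h2⟩ := hU.exists_mean_value h.1 h.2
          exact ⟨η, fun _ => ⟨h1, h2⟩⟩
        · exact ⟨0, fun h' => absurd h' h⟩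
      choose η hη using hmv
      have hηev : ∀ᶠ s in 𝓝[<] τ, η s ∈ Ioo (y s) (y τ + 2 * √(τ - s) * w) := by
        filter_upwards [h2, hev] with s hs hs'
        exact (hη s ⟨Ioo_subset_Ioc_self hs'.2, hs⟩).1
      have hηl : Tendsto η (𝓝[<] τ) (𝓝 (y τ)) :=
        tendsto_of_tendsto_of_tendsto_of_le_of_le' (hU.tendsto_y hτ) (tendsto_scaled_point τ (y τ) w)
          (hηev.mono fun s hs => hs.1.le) (hηev.mono fun s hs => hs.2.le)
      have hgr : Tendsto (fun s => derivWithin (U s) (Ici (y s)) (η s)) (𝓝[<] τ)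
          (𝓝 (boundaryGradient U y τ)) := by
        have h3 := hU.grad_cont (τ, y τ) ⟨hτ, le_rfl⟩
        refine h3.tendsto.comp (f := fun s => (s, η s)) (tendsto_nhdsWithin_iff.2 ⟨?_, ?_⟩)
        · exact (tendsto_id.mono_left nhdsWithin_le_nhds).prodMk_nhds hηl
        · filter_upwards [hηev, hev] with s hs hs'
          exact ⟨Ioo_subset_Ioc_self hs'.2, hs.1.le⟩
      have hfin := (hgr.mul (hsmall.add_const (2 * w))).const_mul (-w)
      rw [show -w * (boundaryGradient U y τ * (0 + 2 * w))
        = -2 * boundaryGradient U y τ * w ^ 2 by ring] at hfin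
      refine hfin.congr' ?_
      filter_upwards [h2, hev] with s hs hs'
      have hr : 0 < √(τ - s) := Real.sqrt_pos.2 (sub_pos.2 hs'.1.2)
      rw [indicator_of_mem (show _ ∈ Ioi (y s) from hs),
        (hη s ⟨Ioo_subset_Ioc_self hs'.2, hs⟩).2]
      field_simp
      ring

end IsMovingBoundarySolution


/-! ### The Volterra equation for the boundary. -/

namespace IsMovingBoundarySolution

variable {H : ℝ} {α β : ℝ → ℝ} {lam : ℝ → ℝ → ℝ} {f g y : ℝ → ℝ} {U : ℝ → ℝ → ℝ} {τ : ℝ}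

theorem initial_eq_boundary (hU : IsMovingBoundarySolution H α β lam f g y U) :
    f (y 0) = g 0 := by
  rw [← hU.initial (y 0) le_rfl, hU.boundary 0 ⟨le_rfl, hU.horizon_pos.le⟩]

/-- The balance of the boundary values along the boundary. -/
theorem boundary_balance (hU : IsMovingBoundarySolution H α β lam f g y U) {b : ℝ}
    {φ φ1 φ2 : ℝ → ℝ → ℝ} (hφ : IsBackwardHeatTest τ φ φ1 φ2)
    (hb0 : 0 < b) (hb : b < τ) (hτH : τ ≤ H) :
    φ b (y b) * g b - φ 0 (y 0) * g 0
      = -(∫ s in (0 : ℝ)..b, g s * φ2 s (y s))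
        + (∫ s in (0 : ℝ)..b, deriv y s * g s * φ1 s (y s))
        + ∫ s in (0 : ℝ)..b, deriv g s * φ s (y s) := by
  have hbH : b < H := hb.trans_le hτH
  have huIcc : uIcc 0 b = Icc 0 b := uIcc_of_le hb0.le
  have hH : uIcc 0 b ⊆ uIcc 0 H := by
    rw [huIcc, uIcc_of_le hU.horizon_pos.le]; exact Icc_subset_Icc_right hbH.le
  have c0 := hU.continuousOn_kernel_boundary hφ.cont hb hbH.le
  have c1 := hU.continuousOn_kernel_boundary hφ.cont_one hb hbH.le
  have c2 := hU.continuousOn_kernel_boundary hφ.cont_two hb hbH.le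
  have cg := hU.g_cont.mono (Icc_subset_Icc_right hbH.le)
  have j1 : IntervalIntegrable (fun s => g s * φ2 s (y s)) volume 0 b :=
    ContinuousOn.intervalIntegrable (by rw [huIcc]; exact cg.mul c2)
  have j2 : IntervalIntegrable (fun s => deriv y s * g s * φ1 s (y s)) volume 0 b :=
    ((hU.y_speed.mono_set hH).mul_continuousOn (by rwa [huIcc])).mul_continuousOn (by rwa [huIcc])
  have j3 : IntervalIntegrable (fun s => deriv g s * φ s (y s)) volume 0 b :=
    (hU.g_speed.mono_set hH).mul_continuousOn (by rwa [huIcc])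
  have j1' : IntervalIntegrable (fun s => -(g s * φ2 s (y s))) volume 0 b := j1.neg
  rw [← intervalIntegral.integral_eq_sub_of_hasDerivAt_of_le
    (f := fun s => φ s (y s) * g s)
    (f' := fun s => -(g s * φ2 s (y s)) + deriv y s * g s * φ1 s (y s) + deriv g s * φ s (y s))
    hb0.le (c0.mul cg) (fun s hs => ?_) ((j1'.add j2).add j3),
    intervalIntegral.integral_add (j1'.add j2) j3, intervalIntegral.integral_add j1' j2,
    intervalIntegral.integral_neg]
  have hs' : s ∈ Ioo 0 H := ⟨hs.1, hs.2.trans hbH⟩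
  have d1 := hφ.hasDerivAt_curve (hs.2.trans hb) (hU.hasDerivAt_y hs')
  convert! d1.mul (hU.hasDerivAt_g hs') using 1
  ring

/-- Green's identity for the space derivative of a test function, with the boundary value
subtracted. -/
theorem gradient_identity (hU : IsMovingBoundarySolution H α β lam f g y U) {b : ℝ}
    {φ φ1 φ2 φ3 : ℝ → ℝ → ℝ} (hφ : IsBackwardHeatTest τ φ φ1 φ2)
    (hφ1 : IsBackwardHeatTest τ φ1 φ2 φ3)
    (hb0 : 0 < b) (hb : b < τ) (hτH : τ ≤ H)
    (hi : IntervalIntegrable (fun s => boundaryGradient U y s * φ1 s (y s)) volume 0 b) :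
    (∫ ξ in Ioi (y b), φ1 b ξ * (U b ξ - g b)) + ∫ ξ in Ioi (y 0), deriv f ξ * φ 0 ξ
      = -(∫ s in (0 : ℝ)..b, boundaryGradient U y s * φ1 s (y s))
        + (∫ s in (0 : ℝ)..b, deriv g s * φ s (y s))
        + ∫ s in (0 : ℝ)..b, ∫ ξ in Ioi (y s), φ1 s ξ * totalSource α β lam U s ξ := by
  have hbH : b < H := hb.trans_le hτH
  have hbI : b ∈ Icc 0 H := ⟨hb0.le, hbH.le⟩
  obtain ⟨i1, i2, e1⟩ := hU.green_identity_initial hφ1 hb0 hb hτH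
  have e2 := hU.boundary_balance hφ hb0 hb hτH
  have hU1 : IntegrableOn (fun ξ => φ1 b ξ * U b ξ) (Ioi (y b)) := by
    obtain ⟨CU, A, hCU, hA, bU⟩ := hU.exists_growth
    obtain ⟨C, hC⟩ := hφ1.decay b hb (A + 1)
    refine (integrable_exp_neg_abs.const_mul (C * CU)).integrableOn.mono'
      (((hφ1.cont.comp_horiz fun _ _ => hb).mul
        ((hU.continuousOn_slice hbI).mono Ioi_subset_Ici_self)).aestronglyMeasurable
          measurableSet_Ioi) ?_
    refine (ae_restrict_iff' measurableSet_Ioi).2 (ae_of_all _ fun ξ hξ => ?_)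
    rw [norm_mul, Real.norm_eq_abs, Real.norm_eq_abs]
    have h1 := (hC b ⟨hb0.le, le_rfl⟩ ξ).1
    calc _ ≤ (C * Real.exp (-(A + 1) * |ξ|)) * (CU * Real.exp (A * |ξ|)) :=
          mul_le_mul h1 (bU b hbI ξ (Ioi_subset_Ici_self hξ)) (abs_nonneg _)
            ((abs_nonneg _).trans h1)
      _ = _ := by
          rw [show -|ξ| = -(A + 1) * |ξ| + A * |ξ| by ring, Real.exp_add]; ring
  have e3 : ∫ ξ in Ioi (y b), φ1 b ξ * (U b ξ - g b)
      = (∫ ξ in Ioi (y b), φ1 b ξ * U b ξ) + φ b (y b) * g b := by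
    simp only [mul_sub]
    rw [integral_sub hU1 ((hφ.integrable_grad hb0.le hb).integrableOn.mul_const _),
      integral_mul_const, hφ.integral_grad_Ioi hb0.le hb]
    ring
  obtain ⟨CL, A, hL⟩ := hU.f_lipschitz
  obtain ⟨CF, B, hCF, hB, hF⟩ := hU.exists_growth
  have h0 : (0 : ℝ) ∈ Icc 0 H := ⟨le_rfl, hU.horizon_pos.le⟩
  have hτ0 : 0 < τ := hb0.trans hb
  have e4 := (integral_deriv_mul_of_lipschitz hL
    (fun x hx => by rw [← hU.initial x hx]; exact hF 0 h0 x hx) (hφ.space 0 hτ0)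
    (by rw [← continuousOn_univ]; exact hφ.cont_one.comp_horiz fun _ _ => hτ0)
    (fun A => by
      obtain ⟨C, hC⟩ := hφ.decay 0 hτ0 A
      exact ⟨C, fun ξ => hC 0 ⟨le_rfl, le_rfl⟩ ξ⟩)).2
  rw [hU.initial_eq_boundary] at e4
  have hH : uIcc 0 b ⊆ uIcc 0 H := by
    rw [uIcc_of_le hb0.le, uIcc_of_le hU.horizon_pos.le]; exact Icc_subset_Icc_right hbH.le
  have j2 : IntervalIntegrable (fun s => deriv y s * g s * φ1 s (y s)) volume 0 b := by
    have := i1.sub hi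
    exact this.congr fun s _ => by ring
  have e5 : ∫ s in (0 : ℝ)..b, (boundaryGradient U y s + deriv y s * g s) * φ1 s (y s)
      = (∫ s in (0 : ℝ)..b, boundaryGradient U y s * φ1 s (y s))
        + ∫ s in (0 : ℝ)..b, deriv y s * g s * φ1 s (y s) := by
    rw [← intervalIntegral.integral_add hi j2]
    exact intervalIntegral.integral_congr fun s _ => by ring
  -- In the sum the terms with `g φ_ξξ` and `y' g φ_ξ` cancel against those of the boundary balance
  -- and only `g' φ` survives. The corner contributions at time `0` cancel because `f (y 0) = g 0`.
  rw [e3, e4]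
  rw [e5] at e1
  linarith

/-- Along the boundary the kernel gradient carries the factor `(y s - y τ)/(τ - s)`, which is
bounded by `exists_lipschitz_y`. Its singularity is therefore no worse than that of the kernel
itself, an integrable inverse square root. -/
theorem exists_boundary_kernel_bound (hU : IsMovingBoundarySolution H α β lam f g y U)
    (hτ : τ ∈ Ioc 0 H) : ∃ C, ∀ s ∈ Ioo 0 τ,
      |heatKernel (y τ) τ s (y s)| ≤ C * (√(τ - s))⁻¹ ∧
      |heatKernel₁ (y τ) τ s (y s)| ≤ C * (√(τ - s))⁻¹ := by
  obtain ⟨L, hL, hLy⟩ := hU.exists_lipschitz_y hτ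
  refine ⟨4 + 2 * L, fun s hs => ?_⟩
  obtain ⟨b1, -, -, -⟩ := heatKernel_bounds hs.2 (y τ) (y s)
  have hδ : 0 < τ - s := sub_pos.2 hs.2
  have hr := Real.sqrt_pos.2 hδ
  have h1 : |heatKernel (y τ) τ s (y s)| ≤ 4 * (√(τ - s))⁻¹ := by
    rwa [← div_eq_mul_inv, le_div_iff₀ hr]
  have hr' : 0 < (√(τ - s))⁻¹ := inv_pos.2 hr
  refine ⟨h1.trans (by gcongr; linarith), ?_⟩
  rw [heatKernel₁, abs_mul, abs_div, abs_neg, abs_of_pos (by positivity : 0 < 2 * (τ - s))]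
  have h2 : |y s - y τ| / (2 * (τ - s)) ≤ L / 2 := by
    rw [div_le_iff₀ (by positivity)]
    have := hLy s hs
    linarith
  calc _ ≤ L / 2 * (4 * (√(τ - s))⁻¹) := mul_le_mul h2 h1 (abs_nonneg _) (by positivity)
    _ = 2 * L * (√(τ - s))⁻¹ := by ring
    _ ≤ _ := by gcongr; linarith

theorem exists_bound_near_end {ψ ψ' : ℝ → ℝ} (hτ : τ ∈ Ioc 0 H) (h : ContinuousOn ψ' (Ioc 0 H))
    (he : ∀ s ∈ Ioo 0 H, ψ s = ψ' s) : ∃ B, ∀ s ∈ Ioo (τ / 2) τ, |ψ s| ≤ B := by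
  have hpos := half_pos hτ.1
  obtain ⟨B, hB⟩ := isCompact_Icc.exists_bound_of_continuousOn
    (h.mono (fun s (hs : s ∈ Icc (τ / 2) τ) => ⟨hpos.trans_le hs.1, hs.2.trans hτ.2⟩))
  refine ⟨B, fun s hs => ?_⟩
  rw [he s ⟨hpos.trans hs.1, hs.2.trans_le hτ.2⟩]
  exact hB s (Ioo_subset_Icc_self hs)

/-- `gradient_identity` is applied to the kernel with pole `(τ, y τ)`, and `b → τ`: the left side
tends to `-Ψ/2` plus the initial term by the jump relation, the right side by integrability up to
the pole. The result is then multiplied by `-2`. -/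
theorem satisfiesBoundaryEquation (hU : IsMovingBoundarySolution H α β lam f g y U) :
    SatisfiesBoundaryEquation H α β lam f g y U := by
  intro τ hτ
  have hsubτ : uIcc 0 τ ⊆ uIcc 0 H := by
    rw [uIcc_of_le hτ.1.le, uIcc_of_le hU.horizon_pos.le]; exact Icc_subset_Icc_right hτ.2
  obtain ⟨C, hC⟩ := hU.exists_boundary_kernel_bound hτ
  have hφ := isBackwardHeatTest_heatKernel hτ.1 (y τ)
  have hφ1 := isBackwardHeatTest_heatKernel₁ hτ.1 (y τ)
  -- integrability of the singular boundary terms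
  have k1 : IntervalIntegrable (fun s => boundaryGradient U y s * heatKernel₁ (y τ) τ s (y s))
      volume 0 τ := by
    have hcont : ContinuousOn (boundaryGradient U y) (Ioc 0 H) :=
      hU.grad_cont.comp (f := fun s => (s, y s))
        (continuousOn_id.prodMk (hU.y_cont.mono Ioc_subset_Icc_self)) fun s hs => ⟨hs, le_rfl⟩
    obtain ⟨B, hB⟩ := exists_bound_near_end hτ hcont fun _ _ => rfl
    exact intervalIntegrable_mul_singular hτ.1 (hU.grad_int.mono_set hsubτ) hB
      (hU.continuousOn_kernel_boundary_Ioo hτ.2 continuousOn_heatKernel₁) fun s hs => (hC s hs).2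
  have k2 : IntervalIntegrable (fun s => deriv g s * heatKernel (y τ) τ s (y s)) volume 0 τ := by
    have hcont : ContinuousOn (derivWithin g (Ioc 0 H)) (Ioc 0 H) :=
      hU.g_smooth.continuousOn_derivWithin (uniqueDiffOn_Ioc 0 H) le_rfl
    obtain ⟨B, hB⟩ := exists_bound_near_end hτ hcont fun s hs =>
      (derivWithin_of_mem_nhds (Ioc_mem_nhds hs.1 hs.2)).symm
    exact intervalIntegrable_mul_singular hτ.1 (hU.g_speed.mono_set hsubτ) hB
      (hU.continuousOn_kernel_boundary_Ioo hτ.2 continuousOn_heatKernel) fun s hs => (hC s hs).1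
  obtain ⟨s1, t1⟩ := hU.integrable_heatKernel₁_source hτ (y τ)
  have k0 : IntegrableOn (fun ξ => deriv f ξ * heatKernel (y τ) τ 0 ξ) (Ioi (y 0)) := by
    obtain ⟨CL, A, hL⟩ := hU.f_lipschitz
    obtain ⟨CF, B, hCF, hB, hF⟩ := hU.exists_growth
    have h0 : (0 : ℝ) ∈ Icc 0 H := ⟨le_rfl, hU.horizon_pos.le⟩
    exact (integral_deriv_mul_of_lipschitz hL
      (fun x hx => by rw [← hU.initial x hx]; exact hF 0 h0 x hx) (hφ.space 0 hτ.1)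
      (by rw [← continuousOn_univ]; exact hφ.cont_one.comp_horiz fun _ _ => hτ.1)
      (fun A => by
        obtain ⟨C, hC⟩ := hφ.decay 0 hτ.1 A
        exact ⟨C, fun ξ => hC 0 ⟨le_rfl, le_rfl⟩ ξ⟩)).1
  -- the limit of the gradient identity
  have main : -boundaryGradient U y τ / 2 + ∫ ξ in Ioi (y 0), deriv f ξ * heatKernel (y τ) τ 0 ξ
      = -(∫ s in (0 : ℝ)..τ, boundaryGradient U y s * heatKernel₁ (y τ) τ s (y s))
        + (∫ s in (0 : ℝ)..τ, deriv g s * heatKernel (y τ) τ s (y s))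
        + ∫ s in (0 : ℝ)..τ, ∫ ξ in Ioi (y s),
            heatKernel₁ (y τ) τ s ξ * totalSource α β lam U s ξ := by
    have hl := (hU.tendsto_moment_gradient hτ).add_const
      (∫ ξ in Ioi (y 0), deriv f ξ * heatKernel (y τ) τ 0 ξ)
    have hr := ((tendsto_intervalIntegral_right hτ.1 k1).neg.add
      (tendsto_intervalIntegral_right hτ.1 k2)).add (tendsto_intervalIntegral_right hτ.1 t1)
    refine tendsto_nhds_unique (hl.congr' ?_) hr
    filter_upwards [Ioo_mem_nhdsLT hτ.1] with b hb
    refine hU.gradient_identity hφ hφ1 hb.1 hb.2 hτ.2 (k1.mono_set ?_)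
    rw [uIcc_of_le hb.1.le, uIcc_of_le hτ.1.le]
    exact Icc_subset_Icc_right hb.2.le
  -- translation to the kernels of the equation
  have e0 : ∀ ξ, deriv f ξ * boundaryKernel y τ 0 ξ
      = 2 * (deriv f ξ * heatKernel (y τ) τ 0 ξ) := fun ξ => by rw [boundaryKernel_eq]; ring
  have e1 : ∀ s ∈ uIcc 0 τ, 2 * (boundaryGradient U y s * heatKernel₁ (y τ) τ s (y s))
      = boundaryGradient U y s * ((y τ - y s) * Real.exp (-(y τ - y s) ^ 2 / (4 * (τ - s)))
          / (2 * √(Real.pi * (τ - s) ^ 3))) := fun s hs => by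
    rw [uIcc_of_le hτ.1.le] at hs
    have h := boundaryGradientKernel_eq y (y s) hs.2
    rw [boundaryGradientKernel] at h
    rw [show (y τ - y s) ^ 2 = (y s - y τ) ^ 2 by ring]
    linear_combination (boundaryGradient U y s) * h
  have e2 : ∀ s, deriv g s * boundaryKernel y τ s (y s)
      = 2 * (deriv g s * heatKernel (y τ) τ s (y s)) := fun s => by rw [boundaryKernel_eq]; ring
  have e3 : ∀ s ∈ Ioo 0 τ, ∀ ξ, totalSource α β lam U s ξ * boundaryGradientKernel y τ s ξ
      = -2 * (heatKernel₁ (y τ) τ s ξ * totalSource α β lam U s ξ) := fun s hs ξ => by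
    rw [boundaryGradientKernel_eq y ξ hs.2.le]; ring
  refine ⟨?_, ?_, ?_, ?_, ?_⟩
  · simp only [e0]; exact k0.const_mul 2
  · exact (k1.const_mul 2).congr fun s hs => e1 s (uIoc_subset_uIcc hs)
  · simp only [e2]; exact k2.const_mul 2
  · have hm : MeasurableSet {p : ℝ × ℝ | p.1 ∈ Ioo 0 τ ∧ y p.1 < p.2} := by
      have h : {p : ℝ × ℝ | p.1 ∈ Ioo 0 τ ∧ y p.1 < p.2}
          = {p : ℝ × ℝ | p.1 ∈ Ioo 0 H ∧ y p.1 < p.2} ∩ (Ioo 0 τ ×ˢ univ) := by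
        ext p
        simp only [mem_inter_iff, mem_ofPred_eq, mem_prod, mem_univ, and_true]
        constructor
        · rintro ⟨h1, h2⟩
          exact ⟨⟨⟨h1.1, h1.2.trans_le hτ.2⟩, h2⟩, h1⟩
        · rintro ⟨⟨-, h2⟩, h1⟩
          exact ⟨h1, h2⟩
      rw [h]
      exact hU.isOpen_region.measurableSet.inter (measurableSet_Ioo.prod MeasurableSet.univ)
    have h2 : IntegrableOn (fun p : ℝ × ℝ => -2 * (heatKernel₁ (y τ) τ p.1 p.2
        * totalSource α β lam U p.1 p.2)) {p | p.1 ∈ Ioo 0 τ ∧ y p.1 < p.2} := s1.const_mul (-2)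
    exact h2.congr_fun (fun p hp => (e3 p.1 hp.1 p.2).symm) hm
  · have g0 : ∫ ξ in Ioi (y 0), deriv f ξ * boundaryKernel y τ 0 ξ
        = 2 * ∫ ξ in Ioi (y 0), deriv f ξ * heatKernel (y τ) τ 0 ξ := by
      simp only [e0]
      rw [integral_const_mul]
    have g1 : ∫ s in (0 : ℝ)..τ, boundaryGradient U y s
          * ((y τ - y s) * Real.exp (-(y τ - y s) ^ 2 / (4 * (τ - s)))
            / (2 * √(Real.pi * (τ - s) ^ 3)))
        = 2 * ∫ s in (0 : ℝ)..τ, boundaryGradient U y s * heatKernel₁ (y τ) τ s (y s) := by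
      rw [← intervalIntegral.integral_const_mul]
      exact intervalIntegral.integral_congr fun s hs => (e1 s hs).symm
    have g2 : ∫ s in (0 : ℝ)..τ, deriv g s * boundaryKernel y τ s (y s)
        = 2 * ∫ s in (0 : ℝ)..τ, deriv g s * heatKernel (y τ) τ s (y s) := by
      simp only [e2]
      rw [intervalIntegral.integral_const_mul]
    have g3 : ∫ s in (0 : ℝ)..τ, ∫ ξ in Ioi (y s),
          totalSource α β lam U s ξ * boundaryGradientKernel y τ s ξ
        = -2 * ∫ s in (0 : ℝ)..τ, ∫ ξ in Ioi (y s),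
          heatKernel₁ (y τ) τ s ξ * totalSource α β lam U s ξ := by
      rw [← intervalIntegral.integral_const_mul, intervalIntegral.integral_of_le hτ.1.le,
        intervalIntegral.integral_of_le hτ.1.le, integral_Ioc_eq_integral_Ioo,
        integral_Ioc_eq_integral_Ioo]
      refine setIntegral_congr_fun measurableSet_Ioo fun s hs => ?_
      simp only [e3 s hs]
      rw [integral_const_mul]
    rw [g0, g1, g2, g3]
    linarith

end IsMovingBoundarySolution


/-! ### The time change: the clock and its inverse. -/

/-- A function with a derivative bounded above by a negative constant has a `C^1` inverse. -/
theorem exists_inverse_of_hasDerivAt_neg {c a : ℝ → ℝ} {ε : ℝ} (hε : 0 < ε)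
    (ha : ∀ t, ε ≤ a t) (hc : ∀ t, HasDerivAt c (-a t) t) :
    ∃ θ : ℝ → ℝ, Continuous θ ∧ (∀ τ, c (θ τ) = τ) ∧ (∀ t, θ (c t) = t) ∧
      ∀ τ, HasDerivAt θ (-(a (θ τ))⁻¹) τ := by
  have hpos : ∀ t, 0 < a t := fun t => hε.trans_le (ha t)
  have hd : ∀ t, HasDerivAt (fun t => -c t) (a t) t := fun t => by
    convert! (hc t).neg using 1; ring
  have hmono : StrictMono fun t => -c t :=
    strictMono_of_deriv_pos fun t => by rw [(hd t).deriv]; exact hpos t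
  have hcont : Continuous fun t => -c t :=
    continuous_iff_continuousAt.2 fun t => (hd t).continuousAt
  have hd' : ∀ t, HasDerivAt (fun t => -c t - ε * t) (a t - ε) t := fun t => by
    convert! (hd t).sub ((hasDerivAt_id t).const_mul ε) using 1; ring
  -- Monotonicity of `-c t - ε t` says that `-c` grows at least linearly, hence is onto the line.
  have hmono' : Monotone fun t => -c t - ε * t :=
    monotone_of_deriv_nonneg (fun t => (hd' t).differentiableAt) fun t => by
      rw [(hd' t).deriv]; linarith [ha t]
  have htop : Tendsto (fun t => -c t) atTop atTop := by
    refine tendsto_atTop_mono' (f₁ := fun t => ε * t + -c 0) _ ?_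
      (tendsto_atTop_add_const_right _ _ (tendsto_id.const_mul_atTop hε))
    filter_upwards [eventually_ge_atTop 0] with t ht
    have := hmono' ht
    simp only [mul_zero, sub_zero] at this
    linarith
  have hbot : Tendsto (fun t => -c t) atBot atBot := by
    refine tendsto_atBot_mono' (f₁ := fun t => ε * t + -c 0) _ ?_
      (tendsto_atBot_add_const_right _ _ (tendsto_id.const_mul_atBot hε))
    filter_upwards [eventually_le_atBot 0] with t ht
    have := hmono' ht
    simp only [mul_zero, sub_zero] at this
    linarith
  let e := hmono.orderIsoOfSurjective _ (hcont.surjective htop hbot)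
  have he : ∀ t, e t = -c t := fun t => rfl
  have hθc : Continuous fun τ => e.symm (-τ) := e.symm.continuous.comp continuous_neg
  have h1 : ∀ τ, c (e.symm (-τ)) = τ := fun τ => by
    have := he (e.symm (-τ))
    rw [e.apply_symm_apply] at this
    linarith
  refine ⟨fun τ => e.symm (-τ), hθc, h1, fun t => by
    show e.symm (-c t) = t
    rw [← he, e.symm_apply_apply], fun τ => ?_⟩
  have := HasDerivAt.of_local_left_inverse hθc.continuousAt (hc (e.symm (-τ)))
    (neg_ne_zero.2 (hpos _).ne') (Eventually.of_forall h1)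
  rwa [inv_neg] at this

section Primitive

variable {φ : ℝ → ℝ} {Q a b t : ℝ}

/-- Coefficients are controlled only on `[0, Q]`. Extending an integrand constantly beyond the end
points leaves the integrals unchanged and, when it is continuous on `[0, Q]`, yields a function
continuous on the whole line, to which the fundamental theorem applies. -/
theorem intervalIntegral_eq_IccExtend (hQ : 0 ≤ Q) (ha : a ∈ Icc 0 Q) (hb : b ∈ Icc 0 Q) :
    ∫ k in a..b, φ k = ∫ k in a..b, IccExtend hQ ((Icc 0 Q).domRestrict φ) k :=
  intervalIntegral.integral_congr fun k hk => by
    have hk' : k ∈ Icc 0 Q := uIcc_subset_Icc ha hb hk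
    rw [IccExtend_of_mem hQ _ hk', domRestrict_apply]

theorem hasDerivWithinAt_primitive (hφ : ContinuousOn φ (Icc 0 Q)) (ha : a ∈ Icc 0 Q)
    (ht : t ∈ Icc 0 Q) :
    HasDerivWithinAt (fun t => ∫ k in a..t, φ k) (φ t) (Icc 0 Q) t := by
  have hQ : 0 ≤ Q := ha.1.trans ha.2
  have hc : Continuous (IccExtend hQ ((Icc 0 Q).domRestrict φ)) := hφ.domRestrict.Icc_extend'
  have h := (hc.integral_hasStrictDerivAt a t).hasDerivAt.hasDerivWithinAt (s := Icc 0 Q)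
  rw [IccExtend_of_mem hQ _ ht, domRestrict_apply] at h
  exact h.congr (fun x hx => intervalIntegral_eq_IccExtend hQ ha hx)
    (intervalIntegral_eq_IccExtend hQ ha ht)

theorem contDiffOn_primitive (hQ : 0 < Q) (hφ : ContinuousOn φ (Icc 0 Q)) (ha : a ∈ Icc 0 Q) :
    ContDiffOn ℝ 1 (fun t => ∫ k in a..t, φ k) (Icc 0 Q) := by
  have hu := uniqueDiffOn_Icc hQ
  rw [show (1 : WithTop ℕ∞) = 0 + 1 by rfl, contDiffOn_succ_iff_derivWithin hu]
  refine ⟨fun t ht => (hasDerivWithinAt_primitive hφ ha ht).differentiableWithinAt, by simp, ?_⟩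
  rw [contDiffOn_zero]
  exact hφ.congr fun t ht => (hasDerivWithinAt_primitive hφ ha ht).derivWithin (hu t ht)

end Primitive

namespace VerhulstModel

variable {M : VerhulstModel} {T Q τ t : ℝ}

namespace Admissible

theorem sigma_sq_cont (hM : M.Admissible Q) : ContinuousOn (fun t => M.σ t ^ 2) (Icc 0 Q) :=
  hM.sigma_smooth.continuousOn.pow 2

theorem drift_cont (hM : M.Admissible Q) :
    ContinuousOn (fun t => M.σ t ^ 2 / 2 - M.κ t * M.θ t) (Icc 0 Q) :=
  (hM.sigma_sq_cont.div_const 2).sub (hM.kappa_smooth.continuousOn.mul hM.theta_cont)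

/-- The inverse of the clock extends to a `C^1` function on the line. -/
theorem exists_extended_timeOf (hM : M.Admissible Q) (hT : 0 < T) (hTQ : T ≤ Q) :
    ∃ θ a c : ℝ → ℝ, Continuous a ∧ (∀ t, 0 < a t) ∧ (∀ t ∈ Icc 0 Q, a t = M.σ t ^ 2 / 2) ∧
      StrictAnti c ∧ (∀ t ∈ Icc 0 T, c t = M.clock T t) ∧ Continuous θ ∧
      (∀ τ, c (θ τ) = τ) ∧ (∀ t, θ (c t) = t) ∧ ∀ τ, HasDerivAt θ (-(a (θ τ))⁻¹) τ := by
  have hQ : 0 < Q := hT.trans_le hTQ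
  have hTm : T ∈ Icc 0 Q := ⟨hT.le, hTQ⟩
  have hac : ContinuousOn (fun t => M.σ t ^ 2 / 2) (Icc 0 Q) := hM.sigma_sq_cont.div_const 2
  let a := IccExtend hQ.le ((Icc 0 Q).domRestrict fun t => M.σ t ^ 2 / 2)
  have ha : Continuous a := hac.domRestrict.Icc_extend'
  obtain ⟨t₀, ht₀, hmin⟩ := isCompact_Icc.exists_isMinOn (nonempty_Icc.2 hQ.le) hac
  have hε : 0 < M.σ t₀ ^ 2 / 2 := by have := hM.sigma_pos t₀ ht₀; positivity
  have hle : ∀ t, M.σ t₀ ^ 2 / 2 ≤ a t := fun t => hmin (projIcc 0 Q hQ.le t).2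
  have haI : ∀ t ∈ Icc 0 Q, a t = M.σ t ^ 2 / 2 := fun t ht => IccExtend_of_mem _ _ ht
  have hc : ∀ t, HasDerivAt (fun t => ∫ k in t..T, a k) (-a t) t := fun t => by
    simp only [intervalIntegral.integral_symm T]
    exact (ha.integral_hasStrictDerivAt T t).hasDerivAt.neg
  obtain ⟨θ, h1, h2, h3, h4⟩ := exists_inverse_of_hasDerivAt_neg hε hle hc
  refine ⟨θ, a, _, ha, fun t => hε.trans_le (hle t), haI, ?_, fun t ht => ?_, h1, h2, h3, h4⟩
  · exact strictAnti_of_deriv_neg fun t => by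
      rw [(hc t).deriv]; exact neg_neg_of_pos (hε.trans_le (hle t))
  · rw [clock, ← intervalIntegral.integral_const_mul]
    refine intervalIntegral.integral_congr fun k hk => ?_
    have hk' : k ∈ Icc 0 Q := uIcc_subset_Icc ⟨ht.1, ht.2.trans hTQ⟩ hTm hk
    rw [haI k hk']
    ring

theorem strictAntiOn_clock (hM : M.Admissible Q) (hT : 0 < T) (hTQ : T ≤ Q) :
    StrictAntiOn (M.clock T) (Icc 0 T) := by
  obtain ⟨θ, a, c, -, -, -, hc, hcI, -⟩ := hM.exists_extended_timeOf hT hTQ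
  intro s hs t ht hst
  rw [← hcI s hs, ← hcI t ht]
  exact hc hst

theorem timeOf_clock (hM : M.Admissible Q) (hT : 0 < T) (hTQ : T ≤ Q) (ht : t ∈ Icc 0 T) :
    M.timeOf T (M.clock T t) = t :=
  (hM.strictAntiOn_clock hT hTQ).injOn.leftInvOn_invFunOn ht

theorem _root_.VerhulstModel.clock_self : M.clock T T = 0 := by simp [clock]

theorem clock_mem (hM : M.Admissible Q) (hT : 0 < T) (hTQ : T ≤ Q) (ht : t ∈ Icc 0 T) :
    M.clock T t ∈ Icc 0 (M.clock T 0) := by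
  have h := (hM.strictAntiOn_clock hT hTQ).antitoneOn
  refine ⟨?_, h ⟨le_rfl, hT.le⟩ ht ht.1⟩
  rw [← M.clock_self (T := T)]
  exact h ht ⟨hT.le, le_rfl⟩ ht.2

theorem clock_zero_pos (hM : M.Admissible Q) (hT : 0 < T) (hTQ : T ≤ Q) : 0 < M.clock T 0 := by
  refine (M.clock_self (T := T)).symm.trans_lt ?_
  exact hM.strictAntiOn_clock hT hTQ ⟨le_rfl, hT.le⟩ ⟨hT.le, le_rfl⟩ hT

theorem extended_timeOf_eq {θ c : ℝ → ℝ} (hM : M.Admissible Q) (hT : 0 < T) (hTQ : T ≤ Q)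
    (hc : StrictAnti c) (hcI : ∀ t ∈ Icc 0 T, c t = M.clock T t) (hcθ : ∀ τ, c (θ τ) = τ)
    (hτ : τ ∈ Icc 0 (M.clock T 0)) : θ τ ∈ Icc 0 T ∧ M.timeOf T τ = θ τ := by
  have h0 : (0 : ℝ) ∈ Icc 0 T := ⟨le_rfl, hT.le⟩
  have hT' : T ∈ Icc 0 T := ⟨hT.le, le_rfl⟩
  have hmem : θ τ ∈ Icc 0 T := by
    constructor
    · rw [← hc.le_iff_ge, hcθ, hcI 0 h0]; exact hτ.2
    · rw [← hc.le_iff_ge, hcθ, hcI T hT', clock_self]; exact hτ.1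
  refine ⟨hmem, ?_⟩
  conv_lhs => rw [← hcθ τ, hcI _ hmem]
  exact hM.timeOf_clock hT hTQ hmem

theorem timeOf_mem (hM : M.Admissible Q) (hT : 0 < T) (hTQ : T ≤ Q)
    (hτ : τ ∈ Icc 0 (M.clock T 0)) : M.timeOf T τ ∈ Icc 0 T := by
  obtain ⟨θ, a, c, -, -, -, hc, hcI, -, hcθ, -⟩ := hM.exists_extended_timeOf hT hTQ
  obtain ⟨h1, h2⟩ := hM.extended_timeOf_eq hT hTQ hc hcI hcθ hτ
  rwa [h2]

theorem clock_timeOf (hM : M.Admissible Q) (hT : 0 < T) (hTQ : T ≤ Q)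
    (hτ : τ ∈ Icc 0 (M.clock T 0)) : M.clock T (M.timeOf T τ) = τ := by
  obtain ⟨θ, a, c, -, -, -, hc, hcI, -, hcθ, -⟩ := hM.exists_extended_timeOf hT hTQ
  obtain ⟨h1, h2⟩ := hM.extended_timeOf_eq hT hTQ hc hcI hcθ hτ
  rw [h2, ← hcI _ h1, hcθ]

theorem timeOf_zero (hM : M.Admissible Q) (hT : 0 < T) (hTQ : T ≤ Q) : M.timeOf T 0 = T := by
  conv_lhs => rw [← M.clock_self (T := T)]
  exact hM.timeOf_clock hT hTQ ⟨hT.le, le_rfl⟩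

theorem timeOf_mem_Ico (hM : M.Admissible Q) (hT : 0 < T) (hTQ : T ≤ Q)
    (hτ : τ ∈ Ioc 0 (M.clock T 0)) : M.timeOf T τ ∈ Ico 0 T := by
  have h := hM.timeOf_mem hT hTQ (Ioc_subset_Icc_self hτ)
  refine ⟨h.1, h.2.lt_of_ne fun he => ?_⟩
  have := hM.clock_timeOf hT hTQ (Ioc_subset_Icc_self hτ)
  rw [he, clock_self] at this
  exact hτ.1.ne this

theorem timeOf_mem_Ioo (hM : M.Admissible Q) (hT : 0 < T) (hTQ : T ≤ Q)
    (hτ : τ ∈ Ioo 0 (M.clock T 0)) : M.timeOf T τ ∈ Ioo 0 T := by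
  have h := hM.timeOf_mem_Ico hT hTQ (Ioo_subset_Ioc_self hτ)
  refine ⟨h.1.lt_of_ne fun he => ?_, h.2⟩
  have := hM.clock_timeOf hT hTQ (Ioo_subset_Icc_self hτ)
  rw [← he] at this
  exact hτ.2.ne this.symm

theorem injOn_timeOf (hM : M.Admissible Q) (hT : 0 < T) (hTQ : T ≤ Q) :
    InjOn (M.timeOf T) (Icc 0 (M.clock T 0)) := fun s hs t ht h => by
  rw [← hM.clock_timeOf hT hTQ hs, ← hM.clock_timeOf hT hTQ ht, h]

theorem image_timeOf_Icc (hM : M.Admissible Q) (hT : 0 < T) (hTQ : T ≤ Q) :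
    M.timeOf T '' Icc 0 (M.clock T 0) = Icc 0 T := by
  ext t
  constructor
  · rintro ⟨τ, hτ, rfl⟩
    exact hM.timeOf_mem hT hTQ hτ
  · exact fun ht => ⟨_, hM.clock_mem hT hTQ ht, hM.timeOf_clock hT hTQ ht⟩

/-- `timeOf` has no meaning outside the range of the clock, so at the end points the derivative can
only be one-sided. It is read off from the globally defined inverse of the extended clock. -/
theorem hasDerivWithinAt_timeOf (hM : M.Admissible Q) (hT : 0 < T) (hTQ : T ≤ Q)
    (hτ : τ ∈ Icc 0 (M.clock T 0)) :
    HasDerivWithinAt (M.timeOf T) (-(2 / M.σ (M.timeOf T τ) ^ 2)) (Icc 0 (M.clock T 0)) τ := by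
  obtain ⟨θ, a, c, -, -, haI, hc, hcI, -, hcθ, -, hd⟩ := hM.exists_extended_timeOf hT hTQ
  have he := fun {τ} => hM.extended_timeOf_eq (τ := τ) hT hTQ hc hcI hcθ
  have h := (hd τ).hasDerivWithinAt (s := Icc 0 (M.clock T 0))
  rw [haI _ ⟨(he hτ).1.1, (he hτ).1.2.trans hTQ⟩, ← (he hτ).2, inv_div] at h
  exact h.congr (fun x hx => (he hx).2) (he hτ).2

theorem hasDerivAt_timeOf (hM : M.Admissible Q) (hT : 0 < T) (hTQ : T ≤ Q)
    (hτ : τ ∈ Ioo 0 (M.clock T 0)) :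
    HasDerivAt (M.timeOf T) (-(2 / M.σ (M.timeOf T τ) ^ 2)) τ :=
  (hM.hasDerivWithinAt_timeOf hT hTQ (Ioo_subset_Icc_self hτ)).hasDerivAt
    (Icc_mem_nhds hτ.1 hτ.2)

theorem continuousOn_timeOf (hM : M.Admissible Q) (hT : 0 < T) (hTQ : T ≤ Q) :
    ContinuousOn (M.timeOf T) (Icc 0 (M.clock T 0)) :=
  fun _ hτ => (hM.hasDerivWithinAt_timeOf hT hTQ hτ).continuousWithinAt

/-- Continuous functions of time are continuous functions of the clock. -/
theorem continuousOn_comp_timeOf (hM : M.Admissible Q) (hT : 0 < T) (hTQ : T ≤ Q) {φ : ℝ → ℝ}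
    (hφ : ContinuousOn φ (Icc 0 T)) :
    ContinuousOn (fun τ => φ (M.timeOf T τ)) (Icc 0 (M.clock T 0)) :=
  hφ.comp (hM.continuousOn_timeOf hT hTQ) fun _ hτ => hM.timeOf_mem hT hTQ hτ

theorem contDiffOn_timeOf (hM : M.Admissible Q) (hT : 0 < T) (hTQ : T ≤ Q) :
    ContDiffOn ℝ 1 (M.timeOf T) (Icc 0 (M.clock T 0)) := by
  have hu := uniqueDiffOn_Icc (hM.clock_zero_pos hT hTQ)
  rw [show (1 : WithTop ℕ∞) = 0 + 1 by rfl, contDiffOn_succ_iff_derivWithin hu]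
  refine ⟨fun t ht => (hM.hasDerivWithinAt_timeOf hT hTQ ht).differentiableWithinAt, by simp, ?_⟩
  rw [contDiffOn_zero]
  have h : ContinuousOn (fun t => -(2 / M.σ t ^ 2)) (Icc 0 T) :=
    ((continuousOn_const.div hM.sigma_sq_cont fun t ht =>
      (pow_pos (hM.sigma_pos t ht) 2).ne').neg).mono (Icc_subset_Icc_right hTQ)
  exact (hM.continuousOn_comp_timeOf hT hTQ h).congr fun t ht =>
    (hM.hasDerivWithinAt_timeOf hT hTQ ht).derivWithin (hu t ht)

/-- Change of variables introduces the Jacobian `2/σ²`, which is removed by multiplying with the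
continuous function `σ²/2`. This transports the integrable speed of the exercise boundary at
maturity to an integrable speed at `τ = 0`. -/
theorem intervalIntegrable_comp_timeOf (hM : M.Admissible Q) (hT : 0 < T) (hTQ : T ≤ Q)
    {φ : ℝ → ℝ} (hφ : IntervalIntegrable φ volume 0 T) :
    IntervalIntegrable (fun τ => φ (M.timeOf T τ)) volume 0 (M.clock T 0) := by
  have hH := hM.clock_zero_pos hT hTQ
  rw [intervalIntegrable_iff_integrableOn_Icc_of_le hT.le, ← hM.image_timeOf_Icc hT hTQ,
    integrableOn_image_iff_integrableOn_abs_deriv_smul measurableSet_Icc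
      (fun τ hτ => hM.hasDerivWithinAt_timeOf hT hTQ hτ) (hM.injOn_timeOf hT hTQ),
    ← intervalIntegrable_iff_integrableOn_Icc_of_le hH.le] at hφ
  have hc : ContinuousOn (fun τ => M.σ (M.timeOf T τ) ^ 2 / 2) (uIcc 0 (M.clock T 0)) := by
    rw [uIcc_of_le hH.le]
    exact hM.continuousOn_comp_timeOf hT hTQ
      ((hM.sigma_sq_cont.div_const 2).mono (Icc_subset_Icc_right hTQ))
  refine (hφ.mul_continuousOn hc).congr fun τ hτ => ?_
  rw [uIoc_of_le hH.le] at hτ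
  have hm := hM.timeOf_mem hT hTQ (Ioc_subset_Icc_self hτ)
  have hp := hM.sigma_pos _ ⟨hm.1, hm.2.trans hTQ⟩
  rw [abs_neg, abs_of_pos (by positivity), smul_eq_mul]
  field_simp

theorem contDiffOn_shift (hM : M.Admissible Q) (hT : 0 < T) (hTQ : T ≤ Q) :
    ContDiffOn ℝ 1 M.shift (Icc 0 Q) := by
  have hQ := hT.trans_le hTQ
  exact contDiffOn_primitive hQ hM.drift_cont ⟨le_rfl, hQ.le⟩

theorem hasDerivAt_shift (hM : M.Admissible Q) (ht : t ∈ Ioo 0 Q) :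
    HasDerivAt M.shift (M.σ t ^ 2 / 2 - M.κ t * M.θ t) t :=
  (hasDerivWithinAt_primitive hM.drift_cont ⟨le_rfl, (ht.1.trans ht.2).le⟩
    (Ioo_subset_Icc_self ht)).hasDerivAt (Icc_mem_nhds ht.1 ht.2)

end Admissible

end VerhulstModel


/-! ### The price in the reduced variables: derivatives and the equation. -/

/-- This form of the quotient rule keeps the gauge as a single common denominator in every
derivative of the reduced price. -/
theorem HasDerivWithinAt.div_exp {a b : ℝ → ℝ} {a' b' x : ℝ} {S : Set ℝ}
    (ha : HasDerivWithinAt a a' S x) (hb : HasDerivWithinAt b b' S x) :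
    HasDerivWithinAt (fun x => a x / Real.exp (b x)) ((a' - a x * b') / Real.exp (b x)) S x := by
  have h := ha.div hb.exp (Real.exp_pos _).ne'
  refine h.congr_deriv ?_
  have := Real.exp_pos (b x)
  field_simp

theorem HasDerivAt.div_exp {a b : ℝ → ℝ} {a' b' x : ℝ}
    (ha : HasDerivAt a a' x) (hb : HasDerivAt b b' x) :
    HasDerivAt (fun x => a x / Real.exp (b x)) ((a' - a x * b') / Real.exp (b x)) x := by
  rw [← hasDerivWithinAt_univ] at *
  exact ha.div_exp hb

namespace VerhulstModel

variable {M : VerhulstModel} {T Q K τ t x r : ℝ} {F P : ℝ → ℝ → ℝ} {rB : ℝ → ℝ}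

theorem rateOf_pos : 0 < M.rateOf t x := Real.exp_pos _

theorem gauge_pos : 0 < M.gauge T t r := Real.exp_pos _

theorem rateOf_logVar (hr : 0 < r) : M.rateOf t (M.logVar t r) = r := by
  rw [rateOf, logVar, add_sub_cancel_right, Real.exp_log hr]

theorem logVar_le_iff (hr : 0 < r) : M.logVar t r ≤ x ↔ r ≤ M.rateOf t x := by
  rw [logVar, rateOf, ← le_sub_iff_add_le, Real.log_le_iff_le_exp hr]

theorem logVar_lt_iff (hr : 0 < r) : M.logVar t r < x ↔ r < M.rateOf t x := by
  rw [logVar, rateOf, ← lt_sub_iff_add_lt, Real.log_lt_iff_lt_exp hr]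

theorem hasDerivAt_rateOf : HasDerivAt (M.rateOf t) (M.rateOf t x) x := by
  exact ((hasDerivAt_id x).sub_const (M.shift t)).exp.congr_deriv (mul_one _)

theorem Admissible.hasDerivAt_rateOf_time (hM : M.Admissible Q) (ht : t ∈ Ioo 0 Q) :
    HasDerivAt (fun k => M.rateOf k x)
      (-(M.σ t ^ 2 / 2 - M.κ t * M.θ t) * M.rateOf t x) t := by
  refine ((hM.hasDerivAt_shift ht).const_sub x).exp.congr_deriv ?_
  rw [rateOf, mul_comm]

theorem Admissible.contDiffOn_ratio (hM : M.Admissible Q) :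
    ContDiffOn ℝ 1 (fun k => M.κ k / M.σ k ^ 2) (Icc 0 Q) :=
  hM.kappa_smooth.div (hM.sigma_smooth.pow 2) fun t ht => (pow_pos (hM.sigma_pos t ht) 2).ne'

theorem Admissible.hasDerivAt_ratio (hM : M.Admissible Q) (hTQ : T ≤ Q) (ht : t ∈ Ioo 0 T) :
    HasDerivAt (fun k => M.κ k / M.σ k ^ 2)
      (derivWithin (fun k => M.κ k / M.σ k ^ 2) (Icc 0 T) t) t :=
  (((hM.contDiffOn_ratio.mono (Icc_subset_Icc_right hTQ)).differentiableOn one_ne_zero t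
    (Ioo_subset_Icc_self ht)).hasDerivWithinAt).hasDerivAt (Icc_mem_nhds ht.1 ht.2)

theorem Admissible.hasDerivAt_discount (hM : M.Admissible Q) (hTQ : T ≤ Q) (ht : t ∈ Ioo 0 T) :
    HasDerivAt (fun t => ∫ k in T..t, M.s k) (M.s t) t := by
  have ht' : t ∈ Ioo 0 Q := ⟨ht.1, ht.2.trans_le hTQ⟩
  exact (hasDerivWithinAt_primitive hM.s_cont ⟨(ht.1.trans ht.2).le, hTQ⟩
    (Ioo_subset_Icc_self ht')).hasDerivAt (Icc_mem_nhds ht'.1 ht'.2)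

/-- The `x`-derivative of the reduced price in the original variables. -/
noncomputable def reducedDelta (M : VerhulstModel) (T K : ℝ) (F P : ℝ → ℝ → ℝ) (rB : ℝ → ℝ)
    (t r : ℝ) : ℝ :=
  r * (derivWithin (P t) (Ici (rB t)) r - M.κ t / M.σ t ^ 2 * (P t r - (K - F t (rB t))))
    / M.gauge T t r

/-- The second `x`-derivative of the reduced price in the original variables. -/
noncomputable def reducedGamma (M : VerhulstModel) (T K : ℝ) (F P : ℝ → ℝ → ℝ) (rB : ℝ → ℝ)
    (t r : ℝ) : ℝ :=
  (r * (deriv (P t) r - M.κ t / M.σ t ^ 2 * (P t r - (K - F t (rB t))))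
    + r ^ 2 * (deriv (deriv (P t)) r - 2 * (M.κ t / M.σ t ^ 2) * deriv (P t) r
      + (M.κ t / M.σ t ^ 2) ^ 2 * (P t r - (K - F t (rB t))))) / M.gauge T t r

/-- The time derivative of the reduced price, at fixed `x`, in the original variables. -/
noncomputable def reducedTheta (M : VerhulstModel) (T K : ℝ) (F P : ℝ → ℝ → ℝ) (rB : ℝ → ℝ)
    (t r : ℝ) : ℝ :=
  (deriv (fun k => P k r) t - (M.σ t ^ 2 / 2 - M.κ t * M.θ t) * r * deriv (P t) r
      + deriv (fun k => F k (rB k)) t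
    - (P t r - (K - F t (rB t))) *
      (derivWithin (fun k => M.κ k / M.σ k ^ 2) (Icc 0 T) t * r
        - M.κ t / M.σ t ^ 2 * ((M.σ t ^ 2 / 2 - M.κ t * M.θ t) * r) + M.s t)) / M.gauge T t r

namespace IsAmericanPut

theorem isOpen_region (hP : M.IsAmericanPut T K F P rB) :
    IsOpen {p : ℝ × ℝ | p.1 ∈ Ioo 0 T ∧ rB p.1 < p.2} := by
  have h1 : ContinuousOn (fun p : ℝ × ℝ => p.2 - rB p.1) (Ioo 0 T ×ˢ univ) :=
    continuousOn_snd.sub ((hP.rB_cont.mono Ioo_subset_Icc_self).comp continuousOn_fst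
      fun p hp => hp.1)
  have h2 := h1.isOpen_inter_preimage (isOpen_Ioo.prod isOpen_univ) (isOpen_Ioi (a := (0 : ℝ)))
  convert! h2 using 1
  ext p
  simp [and_assoc]

theorem derivWithin_price_eq (hr : rB t < r) :
    derivWithin (P t) (Ici (rB t)) r = deriv (P t) r :=
  derivWithin_of_mem_nhds (Ici_mem_nhds hr)

theorem hasDerivWithinAt_reduced_space (hP : M.IsAmericanPut T K F P rB) (ht : t ∈ Ico 0 T)
    (hx : rB t ≤ M.rateOf t x) :
    HasDerivWithinAt (fun x => (P t (M.rateOf t x) - (K - F t (rB t))) / M.gauge T t (M.rateOf t x))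
      (M.reducedDelta T K F P rB t (M.rateOf t x)) (Ici (M.logVar t (rB t))) x := by
  have hr0 := hP.rB_pos t (Ico_subset_Icc_self ht)
  have h1 := (hP.delta_diff t ht _ hx).hasDerivWithinAt
  have h2 : HasDerivWithinAt (M.rateOf t) (M.rateOf t x) (Ici (M.logVar t (rB t))) x :=
    hasDerivAt_rateOf.hasDerivWithinAt
  have h3 := h1.comp x h2 fun z hz => (logVar_le_iff hr0).1 hz
  have h4 := (h3.sub_const (K - F t (rB t))).div_exp
    ((h2.const_mul (M.κ t / M.σ t ^ 2)).add_const (∫ k in T..t, M.s k))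
  refine h4.congr_deriv ?_
  rw [reducedDelta, gauge]
  congr 1
  simp only [Function.comp_apply]
  ring

theorem hasDerivAt_reducedDelta (hP : M.IsAmericanPut T K F P rB) (ht : t ∈ Ioo 0 T)
    (hx : rB t < M.rateOf t x) :
    HasDerivAt (fun x => M.reducedDelta T K F P rB t (M.rateOf t x))
      (M.reducedGamma T K F P rB t (M.rateOf t x)) x := by
  have hr0 := hP.rB_pos t (Ioo_subset_Icc_self ht)
  have h0 : HasDerivAt (M.rateOf t) (M.rateOf t x) x := hasDerivAt_rateOf
  have h1 := (hP.c12.diff_space (t, M.rateOf t x) ⟨ht, hx⟩).hasDerivAt.comp x h0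
  have h2 := (hP.c12.diff_space_two (t, M.rateOf t x) ⟨ht, hx⟩).hasDerivAt.comp x h0
  have h3 := (h0.mul (h2.sub ((h1.sub_const (K - F t (rB t))).const_mul
    (M.κ t / M.σ t ^ 2)))).div_exp
      ((h0.const_mul (M.κ t / M.σ t ^ 2)).add_const (∫ k in T..t, M.s k))
  refine HasDerivAt.congr_of_eventuallyEq (h3.congr_deriv ?_) ?_
  · rw [reducedGamma, gauge]
    congr 1
    simp only [Function.comp_apply, Pi.mul_apply, Pi.sub_apply]
    ring
  · filter_upwards [Ioi_mem_nhds ((logVar_lt_iff hr0).2 hx)] with z hz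
    rw [reducedDelta, derivWithin_price_eq ((logVar_lt_iff hr0).1 hz)]
    rfl

theorem contDiffOn_bond_boundary (hF : M.IsBondPrice Q F) (hP : M.IsAmericanPut T K F P rB)
    (hTQ : T ≤ Q) : ContDiffOn ℝ 1 (fun k => F k (rB k)) (Ico 0 T) :=
  hF.c1.comp (f := fun k => (k, rB k)) (contDiffOn_id.prodMk hP.rB_smooth) fun k hk =>
    ⟨⟨hk.1, hk.2.le.trans hTQ⟩, hP.rB_pos k (Ico_subset_Icc_self hk)⟩

theorem hasDerivAt_bond_boundary (hF : M.IsBondPrice Q F) (hP : M.IsAmericanPut T K F P rB)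
    (hTQ : T ≤ Q) (ht : t ∈ Ioo 0 T) :
    HasDerivAt (fun k => F k (rB k)) (deriv (fun k => F k (rB k)) t) t :=
  (((hP.contDiffOn_bond_boundary hF hTQ).differentiableOn one_ne_zero t
    (Ioo_subset_Ico_self ht)).differentiableAt (Ico_mem_nhds ht.1 ht.2)).hasDerivAt

theorem hasDerivAt_reduced_time (hM : M.Admissible Q) (hF : M.IsBondPrice Q F)
    (hP : M.IsAmericanPut T K F P rB) (hTQ : T ≤ Q) (ht : t ∈ Ioo 0 T)
    (hx : rB t < M.rateOf t x) :
    HasDerivAt (fun t => (P t (M.rateOf t x) - (K - F t (rB t))) / M.gauge T t (M.rateOf t x))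
      (M.reducedTheta T K F P rB t (M.rateOf t x)) t := by
  have hr := hM.hasDerivAt_rateOf_time (x := x) ⟨ht.1, ht.2.trans_le hTQ⟩
  have h1 := hasDerivAt_comp_of_partials (v := P) (vt := fun t r => deriv (fun k => P k r) t)
    (vx := fun t r => deriv (P t) r) hP.isOpen_region
    (fun p hp => (hP.c12.diff_time p hp).hasDerivAt)
    (fun p hp => (hP.c12.diff_space p hp).hasDerivAt) hP.c12.cont_time hP.c12.cont_space
    (hasDerivAt_id t) hr ⟨ht, hx⟩
  have h2 := (h1.sub ((hP.hasDerivAt_bond_boundary hF hTQ ht).const_sub K)).div_exp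
    (((hM.hasDerivAt_ratio hTQ ht).mul hr).add (hM.hasDerivAt_discount hTQ ht))
  refine h2.congr_deriv ?_
  rw [reducedTheta, gauge]
  simp only [id, Pi.mul_apply, Pi.sub_apply, Pi.add_apply]
  congr 1
  ring

/-- The pricing equation in the reduced variables. -/
theorem reduced_pde (hM : M.Admissible Q) (hP : M.IsAmericanPut T K F P rB) (hTQ : T ≤ Q)
    (ht : t ∈ Ioo 0 T) (hr : rB t < r) :
    -(2 / M.σ t ^ 2) * M.reducedTheta T K F P rB t r
      = M.reducedGamma T K F P rB t r
        + (2 * M.gammaCoeff T t / M.σ t ^ 2 * r - M.κ t ^ 2 / M.σ t ^ 4 * r ^ 2)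
          * ((P t r - (K - F t (rB t))) / M.gauge T t r)
        + -(2 / M.σ t ^ 2) * M.sourceBar K F rB t r / M.gauge T t r := by
  have h := hP.pde t ht r hr
  have hσ := hM.sigma_pos t ⟨ht.1.le, ht.2.le.trans hTQ⟩
  have hg := gauge_pos (M := M) (T := T) (t := t) (r := r)
  rw [PricingPDE] at h
  rw [reducedTheta, reducedGamma, gammaCoeff, sourceBar]
  generalize M.gauge T t r = G at *
  generalize deriv (fun k => P k r) t = pt at *
  generalize deriv (deriv (P t)) r = prr at *
  generalize deriv (P t) r = pr at *
  generalize P t r = p at *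
  generalize derivWithin (fun k => M.κ k / M.σ k ^ 2) (Icc 0 T) t = c' at *
  generalize deriv (fun k => F k (rB k)) t = fb' at *
  generalize F t (rB t) = fb at *
  -- Once the pricing equation is solved for `P_t`, the derivatives are independent symbols and the
  -- claim is a rational identity. The two `P_r` contributions left by the logarithmic variable and
  -- by the gauge cancel in it.
  have h' : pt = (M.s t + M.R * r) * p - 1 / 2 * M.σ t ^ 2 * r ^ 2 * prr
    - M.κ t * r * (M.θ t - r) * pr := by linarith
  rw [h']
  generalize M.σ t = σ at *
  field_simp
  ring

end IsAmericanPut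

end VerhulstModel


/-! ### Bounds and regularity of the coefficients and of the reduced boundary. -/

theorem abs_exp_sub_exp_le (a b : ℝ) :
    |Real.exp a - Real.exp b| ≤ Real.exp (max a b) * |a - b| := by
  wlog h : b ≤ a generalizing a b
  · rw [abs_sub_comm, max_comm, abs_sub_comm a b]
    exact this b a (not_le.1 h).le
  rw [max_eq_left h, abs_of_nonneg (sub_nonneg.2 (Real.exp_le_exp.2 h)),
    abs_of_nonneg (sub_nonneg.2 h)]
  have h1 := Real.add_one_le_exp (b - a)
  have h2 : Real.exp b = Real.exp a * Real.exp (b - a) := by rw [← Real.exp_add]; ring_nf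
  rw [h2]
  nlinarith [Real.exp_pos a]

theorem ContinuousOn.exists_pos_bound {φ : ℝ → ℝ} {a b : ℝ} (h : ContinuousOn φ (Icc a b)) :
    ∃ B, 0 < B ∧ ∀ t ∈ Icc a b, |φ t| ≤ B := by
  obtain ⟨B, hB⟩ := isCompact_Icc.exists_bound_of_continuousOn h
  exact ⟨max B 1, by positivity, fun t ht => (hB t ht).trans (le_max_left _ _)⟩

namespace VerhulstModel

variable {M : VerhulstModel} {T Q K τ t x r : ℝ} {F P : ℝ → ℝ → ℝ} {rB : ℝ → ℝ}

namespace Admissible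

theorem ratio_pos (hM : M.Admissible Q) (ht : t ∈ Icc 0 Q) : 0 < M.κ t / M.σ t ^ 2 :=
  div_pos (hM.kappa_pos t ht) (pow_pos (hM.sigma_pos t ht) 2)

theorem continuousOn_shift (hM : M.Admissible Q) (hT : 0 < T) (hTQ : T ≤ Q) :
    ContinuousOn M.shift (Icc 0 T) :=
  (hM.contDiffOn_shift hT hTQ).continuousOn.mono (Icc_subset_Icc_right hTQ)

theorem continuousOn_discount (hM : M.Admissible Q) (hT : 0 < T) (hTQ : T ≤ Q) :
    ContinuousOn (fun t => ∫ k in T..t, M.s k) (Icc 0 T) :=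
  (contDiffOn_primitive (hT.trans_le hTQ) hM.s_cont ⟨hT.le, hTQ⟩).continuousOn.mono
    (Icc_subset_Icc_right hTQ)

theorem exists_rate_bound (hM : M.Admissible Q) (hT : 0 < T) (hTQ : T ≤ Q) :
    ∃ D, 1 ≤ D ∧ ∀ t ∈ Icc 0 T, ∀ x, 1 + M.rateOf t x ≤ D * Real.exp |x| := by
  obtain ⟨B, hB, h⟩ := (hM.continuousOn_shift hT hTQ).exists_pos_bound
  have h1 : 1 ≤ Real.exp B := Real.one_le_exp hB.le
  refine ⟨2 * Real.exp B, by linarith, fun t ht x => ?_⟩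
  have h2 : M.rateOf t x ≤ Real.exp B * Real.exp |x| := by
    rw [rateOf, ← Real.exp_add]
    refine Real.exp_le_exp.2 ?_
    linarith [neg_le_of_abs_le (h t ht), le_abs_self x]
  have h3 : 1 ≤ Real.exp |x| := Real.one_le_exp (abs_nonneg x)
  nlinarith

/-- Only the discount integral is estimated; the decay in `r`, genuine because `κ > 0`, is kept in
order to beat the polynomial growth of the price at infinity. -/
theorem exists_inv_gauge_bound (hM : M.Admissible Q) (hT : 0 < T) (hTQ : T ≤ Q) :
    ∃ D, 0 < D ∧ ∀ t ∈ Icc 0 T, ∀ r, 0 ≤ r →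
      (M.gauge T t r)⁻¹ ≤ D * Real.exp (-(M.κ t / M.σ t ^ 2 * r)) := by
  obtain ⟨B, hB, h⟩ := (hM.continuousOn_discount hT hTQ).exists_pos_bound
  refine ⟨Real.exp B, Real.exp_pos B, fun t ht r hr => ?_⟩
  rw [gauge, ← Real.exp_neg, ← Real.exp_add]
  refine Real.exp_le_exp.2 ?_
  linarith [neg_le_of_abs_le (h t ht)]

theorem exists_inv_gauge_bound' (hM : M.Admissible Q) (hT : 0 < T) (hTQ : T ≤ Q) :
    ∃ D, 0 < D ∧ ∀ t ∈ Icc 0 T, ∀ r, 0 ≤ r → (M.gauge T t r)⁻¹ ≤ D := by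
  obtain ⟨D, hD, h⟩ := hM.exists_inv_gauge_bound hT hTQ
  refine ⟨D, hD, fun t ht r hr => (h t ht r hr).trans (mul_le_of_le_one_right hD.le ?_)⟩
  rw [Real.exp_le_one_iff, neg_nonpos]
  exact mul_nonneg (hM.ratio_pos ⟨ht.1, ht.2.trans hTQ⟩).le hr

theorem continuousOn_gamma (hM : M.Admissible Q) (hT : 0 < T) (hTQ : T ≤ Q) :
    ContinuousOn (M.gammaCoeff T) (Icc 0 T) := by
  have hI : Icc 0 T ⊆ Icc 0 Q := Icc_subset_Icc_right hTQ
  exact (continuousOn_const.add ((((hM.kappa_smooth.continuousOn.pow 2).mul hM.theta_cont).div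
    hM.sigma_sq_cont fun t ht => (pow_pos (hM.sigma_pos t ht) 2).ne').mono hI)).add
    ((hM.contDiffOn_ratio.mono hI).continuousOn_derivWithin (uniqueDiffOn_Icc hT) le_rfl)

theorem continuousOn_alpha (hM : M.Admissible Q) (hT : 0 < T) (hTQ : T ≤ Q) :
    ContinuousOn (M.alpha T) (Icc 0 (M.clock T 0)) := by
  have h : ContinuousOn (fun t => 2 * M.gammaCoeff T t / M.σ t ^ 2 * Real.exp (-M.shift t))
      (Icc 0 T) :=
    ((continuousOn_const.mul (hM.continuousOn_gamma hT hTQ)).div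
      (hM.sigma_sq_cont.mono (Icc_subset_Icc_right hTQ)) fun t ht =>
        (pow_pos (hM.sigma_pos t ⟨ht.1, ht.2.trans hTQ⟩) 2).ne').mul
      (hM.continuousOn_shift hT hTQ).neg.rexp
  exact hM.continuousOn_comp_timeOf hT hTQ h

theorem _root_.VerhulstModel.beta_eq : M.beta T τ = -(M.κ (M.timeOf T τ) ^ 2
    / M.σ (M.timeOf T τ) ^ 4) * Real.exp (-(2 * M.shift (M.timeOf T τ))) := by
  rw [beta, shift, ← intervalIntegral.integral_const_mul]
  congr 4
  ext k
  ring

theorem continuousOn_beta (hM : M.Admissible Q) (hT : 0 < T) (hTQ : T ≤ Q) :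
    ContinuousOn (M.beta T) (Icc 0 (M.clock T 0)) := by
  have h : ContinuousOn (fun t => -(M.κ t ^ 2 / M.σ t ^ 4) * Real.exp (-(2 * M.shift t)))
      (Icc 0 T) :=
    ((hM.kappa_smooth.continuousOn.pow 2).div (hM.sigma_smooth.continuousOn.pow 4) fun t ht =>
      (pow_pos (hM.sigma_pos t ht) 4).ne').neg.mono (Icc_subset_Icc_right hTQ) |>.mul
      (continuousOn_const.mul (hM.continuousOn_shift hT hTQ)).neg.rexp
  exact (hM.continuousOn_comp_timeOf hT hTQ h).congr fun τ _ => beta_eq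

/-- The exponentials in `alpha` and `beta` are `e^{-shift}` and `e^{-2 shift}`; they combine with
`e^x` and `e^{2x}` to `r` and `r²`, so the potential is a quadratic in `r` without constant term. -/
theorem _root_.VerhulstModel.potential_eq : potential (M.alpha T) (M.beta T) τ x
    = 2 * M.gammaCoeff T (M.timeOf T τ) / M.σ (M.timeOf T τ) ^ 2 * M.rateOf (M.timeOf T τ) x
      - M.κ (M.timeOf T τ) ^ 2 / M.σ (M.timeOf T τ) ^ 4 * M.rateOf (M.timeOf T τ) x ^ 2 := by
  have h1 : Real.exp (-M.shift (M.timeOf T τ)) * Real.exp x = M.rateOf (M.timeOf T τ) x := by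
    rw [rateOf, ← Real.exp_add]; ring_nf
  have h2 : Real.exp (-(2 * M.shift (M.timeOf T τ))) * Real.exp (2 * x)
      = M.rateOf (M.timeOf T τ) x ^ 2 := by
    rw [rateOf, ← Real.exp_add, ← Real.exp_nat_mul]; push_cast; ring_nf
  rw [potential, beta_eq, alpha, ← shift, mul_assoc, h1, mul_assoc, h2]
  ring

/-- The change of variables, from the reduced to the original variables, is continuous. -/
theorem continuousOn_coordinates (hM : M.Admissible Q) (hT : 0 < T) (hTQ : T ≤ Q) :
    ContinuousOn (fun p : ℝ × ℝ => (M.timeOf T p.1, M.rateOf (M.timeOf T p.1) p.2))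
      {p | p.1 ∈ Icc 0 (M.clock T 0)} := by
  have h1 : ContinuousOn (fun p : ℝ × ℝ => M.timeOf T p.1) {p | p.1 ∈ Icc 0 (M.clock T 0)} :=
    (hM.continuousOn_timeOf hT hTQ).comp continuousOn_fst fun p hp => hp
  have h2 : ContinuousOn (fun p : ℝ × ℝ => M.shift (M.timeOf T p.1))
      {p | p.1 ∈ Icc 0 (M.clock T 0)} :=
    (hM.continuousOn_comp_timeOf hT hTQ (hM.continuousOn_shift hT hTQ)).comp continuousOn_fst
      fun p hp => hp
  exact h1.prodMk (continuousOn_snd.sub h2).rexp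

theorem continuousOn_gauge (hM : M.Admissible Q) (hT : 0 < T) (hTQ : T ≤ Q) :
    ContinuousOn (fun p : ℝ × ℝ => M.gauge T p.1 p.2) {p | p.1 ∈ Icc 0 T} := by
  have h1 : ContinuousOn (fun p : ℝ × ℝ => M.κ p.1 / M.σ p.1 ^ 2) {p | p.1 ∈ Icc 0 T} :=
    hM.contDiffOn_ratio.continuousOn.comp continuousOn_fst fun p hp => ⟨hp.1, hp.2.trans hTQ⟩
  have h2 : ContinuousOn (fun p : ℝ × ℝ => ∫ k in T..p.1, M.s k) {p | p.1 ∈ Icc 0 T} :=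
    (hM.continuousOn_discount hT hTQ).comp continuousOn_fst fun p hp => hp
  exact ((h1.mul continuousOn_snd).add h2).rexp

end Admissible

namespace IsBondPrice

variable {s : ℝ}

theorem fderiv_cont (hF : M.IsBondPrice Q F) (hQ : 0 < Q) :
    ContinuousOn (fderivWithin ℝ (fun p : ℝ × ℝ => F p.1 p.2) (Icc 0 Q ×ˢ Ioi 0))
      (Icc 0 Q ×ˢ Ioi 0) :=
  hF.c1.continuousOn_fderivWithin ((uniqueDiffOn_Icc hQ).prod (uniqueDiffOn_Ioi 0)) le_rfl

theorem hasDerivAt_rate (hF : M.IsBondPrice Q F) (ht : t ∈ Icc 0 Q) (hr : 0 < r) :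
    HasDerivAt (F t) (fderivWithin ℝ (fun p : ℝ × ℝ => F p.1 p.2) (Icc 0 Q ×ˢ Ioi 0) (t, r) (0, 1))
      r := by
  have h1 := (hF.c1.differentiableOn one_ne_zero (t, r) ⟨ht, hr⟩).hasFDerivWithinAt
  have h2 : HasDerivWithinAt (fun r => (t, r)) ((0 : ℝ), (1 : ℝ)) (Ioi 0) r :=
    (hasDerivWithinAt_const r _ t).prodMk (hasDerivWithinAt_id r _)
  exact (h1.comp_hasDerivWithinAt r h2 fun z hz => ⟨ht, hz⟩).hasDerivAt (Ioi_mem_nhds hr)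

end IsBondPrice

namespace IsAmericanPut

theorem continuousOn_bond_boundary (hF : M.IsBondPrice Q F) (hP : M.IsAmericanPut T K F P rB)
    (hTQ : T ≤ Q) : ContinuousOn (fun k => F k (rB k)) (Icc 0 T) :=
  hF.c1.continuousOn.comp (f := fun k => (k, rB k)) (continuousOn_id.prodMk hP.rB_cont)
    fun k hk => ⟨⟨hk.1, hk.2.trans hTQ⟩, hP.rB_pos k hk⟩

theorem continuousOn_fderiv_boundary (hF : M.IsBondPrice Q F) (hP : M.IsAmericanPut T K F P rB)
    (hT : 0 < T) (hTQ : T ≤ Q) :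
    ContinuousOn (fun k => fderivWithin ℝ (fun p : ℝ × ℝ => F p.1 p.2) (Icc 0 Q ×ˢ Ioi 0)
      (k, rB k)) (Icc 0 T) :=
  (hF.fderiv_cont (hT.trans_le hTQ)).comp (f := fun k => (k, rB k))
    (continuousOn_id.prodMk hP.rB_cont) fun k hk => ⟨⟨hk.1, hk.2.trans hTQ⟩, hP.rB_pos k hk⟩

theorem continuousOn_bond_delta_boundary (hF : M.IsBondPrice Q F)
    (hP : M.IsAmericanPut T K F P rB) (hT : 0 < T) (hTQ : T ≤ Q) :
    ContinuousOn (fun k => deriv (F k) (rB k)) (Icc 0 T) :=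
  ((hP.continuousOn_fderiv_boundary hF hT hTQ).clm_apply
    (continuousOn_const (c := ((0 : ℝ), (1 : ℝ))))).congr fun t ht =>
      (hF.hasDerivAt_rate ⟨ht.1, ht.2.trans hTQ⟩ (hP.rB_pos t ht)).deriv

theorem hasDerivAt_rB (hP : M.IsAmericanPut T K F P rB) (ht : t ∈ Ioo 0 T) :
    HasDerivAt rB (deriv rB t) t :=
  ((hP.rB_smooth.differentiableOn one_ne_zero t (Ioo_subset_Ico_self ht)).differentiableAt
    (Ico_mem_nhds ht.1 ht.2)).hasDerivAt

/-- The derivative is `DF` applied to `(1, rB')`, and `DF` is bounded along the compact curve. So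
`d/dt F(t, rB(t))` can blow up at maturity only as fast as `rB'`, which is integrable; the source
bound depends on this. -/
theorem exists_bond_boundary_speed_bound (hF : M.IsBondPrice Q F)
    (hP : M.IsAmericanPut T K F P rB) (hT : 0 < T) (hTQ : T ≤ Q) :
    ∃ C, 0 < C ∧ ∀ t ∈ Ioo 0 T, |deriv (fun k => F k (rB k)) t| ≤ C * (1 + |deriv rB t|) := by
  obtain ⟨C, hC⟩ := isCompact_Icc.exists_bound_of_continuousOn
    (hP.continuousOn_fderiv_boundary hF hT hTQ)
  refine ⟨max C 1, by positivity, fun t ht => ?_⟩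
  have hm : (t, rB t) ∈ Icc 0 Q ×ˢ Ioi (0 : ℝ) :=
    ⟨⟨ht.1.le, ht.2.le.trans hTQ⟩, hP.rB_pos t (Ioo_subset_Icc_self ht)⟩
  have h1 := (hF.c1.differentiableOn one_ne_zero (t, rB t) hm).hasFDerivWithinAt
  have h2 : HasDerivWithinAt (fun k => (k, rB k)) ((1 : ℝ), deriv rB t) (Ioo 0 T) t :=
    (hasDerivWithinAt_id t _).prodMk (hP.hasDerivAt_rB ht).hasDerivWithinAt
  have h0 : MapsTo (fun k => (k, rB k)) (Ioo 0 T) (Icc 0 Q ×ˢ Ioi (0 : ℝ)) := fun z hz =>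
    ⟨⟨hz.1.le, hz.2.le.trans hTQ⟩, hP.rB_pos z (Ioo_subset_Icc_self hz)⟩
  have h3 := (h1.comp_hasDerivWithinAt t h2 h0).hasDerivAt (Ioo_mem_nhds ht.1 ht.2)
  have h4 : deriv (fun k => F k (rB k)) t = _ := h3.deriv
  rw [h4]
  refine (ContinuousLinearMap.le_opNorm _ _).trans (mul_le_mul ((hC t
    (Ioo_subset_Icc_self ht)).trans (le_max_left _ _)) ?_ (norm_nonneg _) (by positivity))
  rw [Prod.norm_def]
  refine max_le ?_ ?_
  · rw [norm_one]; linarith [abs_nonneg (deriv rB t)]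
  · rw [Real.norm_eq_abs]; linarith

theorem contDiffOn_reducedBoundary (hM : M.Admissible Q) (hP : M.IsAmericanPut T K F P rB)
    (hT : 0 < T) (hTQ : T ≤ Q) :
    ContDiffOn ℝ 1 (M.reducedBoundary T rB) (Ioc 0 (M.clock T 0)) := by
  have h1 := (hM.contDiffOn_timeOf hT hTQ).mono Ioc_subset_Icc_self
  have hm : MapsTo (M.timeOf T) (Ioc 0 (M.clock T 0)) (Ico 0 T) :=
    fun τ hτ => hM.timeOf_mem_Ico hT hTQ hτ
  exact ((hP.rB_smooth.comp h1 hm).log fun τ hτ =>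
    (hP.rB_pos _ (Ico_subset_Icc_self (hm hτ))).ne').add
    ((hM.contDiffOn_shift hT hTQ).comp h1 fun τ hτ => ⟨(hm hτ).1, (hm hτ).2.le.trans hTQ⟩)

theorem continuousOn_reducedBoundary (hM : M.Admissible Q) (hP : M.IsAmericanPut T K F P rB)
    (hT : 0 < T) (hTQ : T ≤ Q) :
    ContinuousOn (M.reducedBoundary T rB) (Icc 0 (M.clock T 0)) :=
  hM.continuousOn_comp_timeOf hT hTQ (φ := fun t => M.logVar t (rB t))
    ((hP.rB_cont.log fun t ht => (hP.rB_pos t ht).ne').add (hM.continuousOn_shift hT hTQ))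

theorem intervalIntegrable_reducedBoundary_speed (hM : M.Admissible Q)
    (hP : M.IsAmericanPut T K F P rB) (hT : 0 < T) (hTQ : T ≤ Q) :
    IntervalIntegrable (deriv (M.reducedBoundary T rB)) volume 0 (M.clock T 0) := by
  have hI : Icc 0 T ⊆ Icc 0 Q := Icc_subset_Icc_right hTQ
  have hu : uIcc 0 T = Icc 0 T := uIcc_of_le hT.le
  have h1 : IntervalIntegrable (fun t => (deriv rB t * (rB t)⁻¹
      + (M.σ t ^ 2 / 2 - M.κ t * M.θ t)) * (-(2 / M.σ t ^ 2))) volume 0 T := by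
    refine ((hP.rB_speed.mul_continuousOn ?_).add (ContinuousOn.intervalIntegrable ?_)).mul_continuousOn
      ?_ <;> rw [hu]
    · exact hP.rB_cont.inv₀ fun t ht => (hP.rB_pos t ht).ne'
    · exact hM.drift_cont.mono hI
    · exact (continuousOn_const.div (hM.sigma_sq_cont.mono hI) fun t ht =>
        (pow_pos (hM.sigma_pos t (hI ht)) 2).ne').neg
  have hH := (hM.clock_zero_pos hT hTQ).le
  have h2 := hM.intervalIntegrable_comp_timeOf hT hTQ h1
  rw [intervalIntegrable_iff_integrableOn_Ioo_of_le hH] at h2 ⊢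
  refine h2.congr_fun (fun τ hτ => ?_) measurableSet_Ioo
  have ht := hM.timeOf_mem_Ioo hT hTQ hτ
  have h3 : HasDerivAt (fun t => Real.log (rB t) + M.shift t) _ (M.timeOf T τ) :=
    ((hP.hasDerivAt_rB ht).log (hP.rB_pos _ (Ioo_subset_Icc_self ht)).ne').add
    (hM.hasDerivAt_shift ⟨ht.1, ht.2.trans_le hTQ⟩)
  have h4 : deriv (M.reducedBoundary T rB) τ = _ := (h3.comp τ (hM.hasDerivAt_timeOf hT hTQ hτ)).deriv
  rw [h4, div_eq_mul_inv]

end IsAmericanPut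

end VerhulstModel


/-! ### Classical regularity of the reduced price and its boundary gradient. -/

namespace VerhulstModel

variable {M : VerhulstModel} {T Q K τ t x r : ℝ} {F P : ℝ → ℝ → ℝ} {rB : ℝ → ℝ}

namespace IsAmericanPut

theorem reducedBoundary_le_iff (hM : M.Admissible Q) (hP : M.IsAmericanPut T K F P rB)
    (hT : 0 < T) (hTQ : T ≤ Q) (hτ : τ ∈ Icc 0 (M.clock T 0)) :
    M.reducedBoundary T rB τ ≤ x ↔ rB (M.timeOf T τ) ≤ M.rateOf (M.timeOf T τ) x :=
  logVar_le_iff (hP.rB_pos _ (hM.timeOf_mem hT hTQ hτ))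

theorem reducedBoundary_lt_iff (hM : M.Admissible Q) (hP : M.IsAmericanPut T K F P rB)
    (hT : 0 < T) (hTQ : T ≤ Q) (hτ : τ ∈ Icc 0 (M.clock T 0)) :
    M.reducedBoundary T rB τ < x ↔ rB (M.timeOf T τ) < M.rateOf (M.timeOf T τ) x :=
  logVar_lt_iff (hP.rB_pos _ (hM.timeOf_mem hT hTQ hτ))

theorem continuousOn_reducedPrice (hM : M.Admissible Q) (hF : M.IsBondPrice Q F)
    (hP : M.IsAmericanPut T K F P rB) (hT : 0 < T) (hTQ : T ≤ Q) :
    ContinuousOn (fun p : ℝ × ℝ => M.reducedPrice T K F P rB p.1 p.2)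
      {p | p.1 ∈ Icc 0 (M.clock T 0) ∧ M.reducedBoundary T rB p.1 ≤ p.2} := by
  have h1 : ContinuousOn (fun p : ℝ × ℝ => (P p.1 p.2 - (K - F p.1 (rB p.1))) / M.gauge T p.1 p.2)
      {p | p.1 ∈ Icc 0 T ∧ rB p.1 ≤ p.2} :=
    (hP.cont.sub (continuousOn_const.sub ((hP.continuousOn_bond_boundary hF hTQ).comp
      continuousOn_fst fun p hp => hp.1))).div
      ((hM.continuousOn_gauge hT hTQ).mono fun p hp => hp.1) fun _ _ => gauge_pos.ne'
  exact h1.comp ((hM.continuousOn_coordinates hT hTQ).mono fun p hp => hp.1) fun p hp =>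
    ⟨hM.timeOf_mem hT hTQ hp.1, (hP.reducedBoundary_le_iff hM hT hTQ hp.1).1 hp.2⟩

theorem hasDerivWithinAt_reducedPrice (hM : M.Admissible Q) (hP : M.IsAmericanPut T K F P rB)
    (hT : 0 < T) (hTQ : T ≤ Q) (hτ : τ ∈ Ioc 0 (M.clock T 0))
    (hx : M.reducedBoundary T rB τ ≤ x) :
    HasDerivWithinAt (M.reducedPrice T K F P rB τ)
      (M.reducedDelta T K F P rB (M.timeOf T τ) (M.rateOf (M.timeOf T τ) x))
      (Ici (M.reducedBoundary T rB τ)) x :=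
  hP.hasDerivWithinAt_reduced_space (hM.timeOf_mem_Ico hT hTQ hτ)
    ((hP.reducedBoundary_le_iff hM hT hTQ (Ioc_subset_Icc_self hτ)).1 hx)

theorem derivWithin_reducedPrice (hM : M.Admissible Q) (hP : M.IsAmericanPut T K F P rB)
    (hT : 0 < T) (hTQ : T ≤ Q) (hτ : τ ∈ Ioc 0 (M.clock T 0))
    (hx : M.reducedBoundary T rB τ ≤ x) :
    derivWithin (M.reducedPrice T K F P rB τ) (Ici (M.reducedBoundary T rB τ)) x
      = M.reducedDelta T K F P rB (M.timeOf T τ) (M.rateOf (M.timeOf T τ) x) :=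
  (hP.hasDerivWithinAt_reducedPrice hM hT hTQ hτ hx).derivWithin (uniqueDiffOn_Ici _ x hx)

theorem hasDerivAt_reducedPrice_space (hM : M.Admissible Q) (hP : M.IsAmericanPut T K F P rB)
    (hT : 0 < T) (hTQ : T ≤ Q) (hτ : τ ∈ Ioo 0 (M.clock T 0))
    (hx : M.reducedBoundary T rB τ < x) :
    HasDerivAt (M.reducedPrice T K F P rB τ)
      (M.reducedDelta T K F P rB (M.timeOf T τ) (M.rateOf (M.timeOf T τ) x)) x :=
  (hP.hasDerivWithinAt_reducedPrice hM hT hTQ (Ioo_subset_Ioc_self hτ) hx.le).hasDerivAt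
    (Ici_mem_nhds hx)

theorem hasDerivAt_reducedPrice_space_two (hM : M.Admissible Q)
    (hP : M.IsAmericanPut T K F P rB) (hT : 0 < T) (hTQ : T ≤ Q)
    (hτ : τ ∈ Ioo 0 (M.clock T 0)) (hx : M.reducedBoundary T rB τ < x) :
    HasDerivAt (deriv (M.reducedPrice T K F P rB τ))
      (M.reducedGamma T K F P rB (M.timeOf T τ) (M.rateOf (M.timeOf T τ) x)) x := by
  refine (hP.hasDerivAt_reducedDelta (hM.timeOf_mem_Ioo hT hTQ hτ)
    ((hP.reducedBoundary_lt_iff hM hT hTQ (Ioo_subset_Icc_self hτ)).1 hx)).congr_of_eventuallyEq ?_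
  filter_upwards [Ioi_mem_nhds hx] with z hz
  exact (hP.hasDerivAt_reducedPrice_space hM hT hTQ hτ hz).deriv

theorem hasDerivAt_reducedPrice_time (hM : M.Admissible Q) (hF : M.IsBondPrice Q F)
    (hP : M.IsAmericanPut T K F P rB) (hT : 0 < T) (hTQ : T ≤ Q)
    (hτ : τ ∈ Ioo 0 (M.clock T 0)) (hx : M.reducedBoundary T rB τ < x) :
    HasDerivAt (fun s => M.reducedPrice T K F P rB s x)
      (-(2 / M.σ (M.timeOf T τ) ^ 2)
        * M.reducedTheta T K F P rB (M.timeOf T τ) (M.rateOf (M.timeOf T τ) x)) τ := by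
  have h := (hP.hasDerivAt_reduced_time hM hF hTQ (hM.timeOf_mem_Ioo hT hTQ hτ)
    ((hP.reducedBoundary_lt_iff hM hT hTQ (Ioo_subset_Icc_self hτ)).1 hx)).comp τ
      (hM.hasDerivAt_timeOf hT hTQ hτ)
  rw [mul_comm] at h
  exact h

theorem continuousOn_premium (hF : M.IsBondPrice Q F) (hP : M.IsAmericanPut T K F P rB)
    (hTQ : T ≤ Q) : ContinuousOn (fun p : ℝ × ℝ => P p.1 p.2 - (K - F p.1 (rB p.1)))
      {p | p.1 ∈ Icc 0 T ∧ rB p.1 ≤ p.2} :=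
  hP.cont.sub (continuousOn_const.sub ((hP.continuousOn_bond_boundary hF hTQ).comp
    continuousOn_fst fun _ hp => hp.1))

theorem continuousOn_ratio_fst (hM : M.Admissible Q) (hTQ : T ≤ Q) :
    ContinuousOn (fun p : ℝ × ℝ => M.κ p.1 / M.σ p.1 ^ 2) {p | p.1 ∈ Icc 0 T} :=
  hM.contDiffOn_ratio.continuousOn.comp continuousOn_fst fun _ hp => ⟨hp.1, hp.2.trans hTQ⟩

theorem continuousOn_reducedDelta (hM : M.Admissible Q) (hF : M.IsBondPrice Q F)
    (hP : M.IsAmericanPut T K F P rB) (hT : 0 < T) (hTQ : T ≤ Q) :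
    ContinuousOn (fun p : ℝ × ℝ => M.reducedDelta T K F P rB p.1 p.2)
      {p | p.1 ∈ Ico 0 T ∧ rB p.1 ≤ p.2} := by
  have hs : {p : ℝ × ℝ | p.1 ∈ Ico 0 T ∧ rB p.1 ≤ p.2} ⊆ {p | p.1 ∈ Icc 0 T ∧ rB p.1 ≤ p.2} :=
    fun p hp => ⟨Ico_subset_Icc_self hp.1, hp.2⟩
  exact (continuousOn_snd.mul (hP.delta_cont.sub
    (((continuousOn_ratio_fst hM hTQ).mono fun p hp => (hs hp).1).mul
      ((hP.continuousOn_premium hF hTQ).mono hs)))).div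
    ((hM.continuousOn_gauge hT hTQ).mono fun p hp => (hs hp).1) fun _ _ => gauge_pos.ne'

theorem continuousOn_reducedGamma (hM : M.Admissible Q) (hF : M.IsBondPrice Q F)
    (hP : M.IsAmericanPut T K F P rB) (hT : 0 < T) (hTQ : T ≤ Q) :
    ContinuousOn (fun p : ℝ × ℝ => M.reducedGamma T K F P rB p.1 p.2)
      {p | p.1 ∈ Ioo 0 T ∧ rB p.1 < p.2} := by
  have hs : {p : ℝ × ℝ | p.1 ∈ Ioo 0 T ∧ rB p.1 < p.2} ⊆ {p | p.1 ∈ Icc 0 T ∧ rB p.1 ≤ p.2} :=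
    fun p hp => ⟨Ioo_subset_Icc_self hp.1, hp.2.le⟩
  have hc := (continuousOn_ratio_fst hM hTQ).mono fun p hp => (hs hp).1
  have hp := (hP.continuousOn_premium hF hTQ).mono hs
  exact ((continuousOn_snd.mul (hP.c12.cont_space.sub (hc.mul hp))).add
    ((continuousOn_snd.pow 2).mul ((hP.c12.cont_space_two.sub
      ((continuousOn_const.mul hc).mul hP.c12.cont_space)).add ((hc.pow 2).mul hp)))).div
    ((hM.continuousOn_gauge hT hTQ).mono fun p hp => (hs hp).1) fun _ _ => gauge_pos.ne'

theorem continuousOn_reducedTheta (hM : M.Admissible Q) (hF : M.IsBondPrice Q F)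
    (hP : M.IsAmericanPut T K F P rB) (hT : 0 < T) (hTQ : T ≤ Q) :
    ContinuousOn (fun p : ℝ × ℝ => M.reducedTheta T K F P rB p.1 p.2)
      {p | p.1 ∈ Ioo 0 T ∧ rB p.1 < p.2} := by
  have hs : {p : ℝ × ℝ | p.1 ∈ Ioo 0 T ∧ rB p.1 < p.2} ⊆ {p | p.1 ∈ Icc 0 T ∧ rB p.1 ≤ p.2} :=
    fun p hp => ⟨Ioo_subset_Icc_self hp.1, hp.2.le⟩
  have hI : Icc 0 T ⊆ Icc 0 Q := Icc_subset_Icc_right hTQ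
  have lift : ∀ {φ : ℝ → ℝ}, ContinuousOn φ (Ioo 0 T) →
      ContinuousOn (fun p : ℝ × ℝ => φ p.1) {p | p.1 ∈ Ioo 0 T ∧ rB p.1 < p.2} :=
    fun h => h.comp continuousOn_fst fun p hp => hp.1
  have hc := (continuousOn_ratio_fst hM hTQ).mono fun p hp => (hs hp).1
  have hp := (hP.continuousOn_premium hF hTQ).mono hs
  have hd := lift ((hM.drift_cont.mono hI).mono Ioo_subset_Icc_self)
  have hsr := lift ((hM.s_cont.mono hI).mono Ioo_subset_Icc_self)
  have hc' := lift (((hM.contDiffOn_ratio.mono hI).continuousOn_derivWithin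
    (uniqueDiffOn_Icc hT) le_rfl).mono Ioo_subset_Icc_self)
  have hfb := lift (((hP.contDiffOn_bond_boundary hF hTQ).mono
    Ioo_subset_Ico_self).continuousOn_deriv_of_isOpen isOpen_Ioo le_rfl)
  exact (((hP.c12.cont_time.sub ((hd.mul continuousOn_snd).mul hP.c12.cont_space)).add hfb).sub
    (hp.mul (((hc'.mul continuousOn_snd).sub (hc.mul (hd.mul continuousOn_snd))).add hsr))).div
    ((hM.continuousOn_gauge hT hTQ).mono fun p hp => (hs hp).1) fun _ _ => gauge_pos.ne'

theorem isC12On_reducedPrice (hM : M.Admissible Q) (hF : M.IsBondPrice Q F)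
    (hP : M.IsAmericanPut T K F P rB) (hT : 0 < T) (hTQ : T ≤ Q) :
    IsC12On {p | p.1 ∈ Ioo 0 (M.clock T 0) ∧ M.reducedBoundary T rB p.1 < p.2}
      (M.reducedPrice T K F P rB) := by
  have hco : ContinuousOn (fun p : ℝ × ℝ => (M.timeOf T p.1, M.rateOf (M.timeOf T p.1) p.2))
      {p : ℝ × ℝ | p.1 ∈ Ioo 0 (M.clock T 0) ∧ M.reducedBoundary T rB p.1 < p.2} :=
    (hM.continuousOn_coordinates hT hTQ).mono fun p hp => Ioo_subset_Icc_self hp.1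
  have hm : MapsTo (fun p : ℝ × ℝ => (M.timeOf T p.1, M.rateOf (M.timeOf T p.1) p.2))
      {p : ℝ × ℝ | p.1 ∈ Ioo 0 (M.clock T 0) ∧ M.reducedBoundary T rB p.1 < p.2}
      {p | p.1 ∈ Ioo 0 T ∧ rB p.1 < p.2} := fun p hp =>
    ⟨hM.timeOf_mem_Ioo hT hTQ hp.1,
      (hP.reducedBoundary_lt_iff hM hT hTQ (Ioo_subset_Icc_self hp.1)).1 hp.2⟩
  have hσ : ContinuousOn (fun p : ℝ × ℝ => -(2 / M.σ (M.timeOf T p.1) ^ 2))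
      {p : ℝ × ℝ | p.1 ∈ Ioo 0 (M.clock T 0) ∧ M.reducedBoundary T rB p.1 < p.2} :=
    (hM.continuousOn_comp_timeOf hT hTQ (φ := fun t => -(2 / M.σ t ^ 2))
      ((continuousOn_const.div hM.sigma_sq_cont fun t ht =>
        (pow_pos (hM.sigma_pos t ht) 2).ne').neg.mono (Icc_subset_Icc_right hTQ))).comp
      continuousOn_fst fun p hp => Ioo_subset_Icc_self hp.1
  refine ⟨fun p hp => (hP.hasDerivAt_reducedPrice_time hM hF hT hTQ hp.1 hp.2).differentiableAt,
    fun p hp => (hP.hasDerivAt_reducedPrice_space hM hT hTQ hp.1 hp.2).differentiableAt,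
    fun p hp => (hP.hasDerivAt_reducedPrice_space_two hM hT hTQ hp.1 hp.2).differentiableAt,
    ?_, ?_, ?_⟩
  · exact (hσ.mul ((hP.continuousOn_reducedTheta hM hF hT hTQ).comp hco hm)).congr fun p hp =>
      (hP.hasDerivAt_reducedPrice_time hM hF hT hTQ hp.1 hp.2).deriv
  · exact (((hP.continuousOn_reducedDelta hM hF hT hTQ).mono fun p hp =>
      ⟨Ioo_subset_Ico_self hp.1, hp.2.le⟩).comp hco hm).congr fun p hp =>
      (hP.hasDerivAt_reducedPrice_space hM hT hTQ hp.1 hp.2).deriv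
  · exact ((hP.continuousOn_reducedGamma hM hF hT hTQ).comp hco hm).congr fun p hp =>
      (hP.hasDerivAt_reducedPrice_space_two hM hT hTQ hp.1 hp.2).deriv

theorem rateOf_reducedBoundary (hM : M.Admissible Q) (hP : M.IsAmericanPut T K F P rB)
    (hT : 0 < T) (hTQ : T ≤ Q) (hτ : τ ∈ Icc 0 (M.clock T 0)) :
    M.rateOf (M.timeOf T τ) (M.reducedBoundary T rB τ) = rB (M.timeOf T τ) :=
  rateOf_logVar (hP.rB_pos _ (hM.timeOf_mem hT hTQ hτ))

/-- The gradient of the reduced price at the exercise boundary, from the smooth fit. -/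
theorem boundaryGradient_reducedPrice (hM : M.Admissible Q) (hP : M.IsAmericanPut T K F P rB)
    (hT : 0 < T) (hTQ : T ≤ Q) (hτ : τ ∈ Ioc 0 (M.clock T 0)) :
    boundaryGradient (M.reducedPrice T K F P rB) (M.reducedBoundary T rB) τ
      = -(rB (M.timeOf T τ)) * deriv (F (M.timeOf T τ)) (rB (M.timeOf T τ))
        / M.gauge T (M.timeOf T τ) (rB (M.timeOf T τ)) := by
  have ht := hM.timeOf_mem_Ico hT hTQ hτ
  rw [boundaryGradient, hP.derivWithin_reducedPrice hM hT hTQ hτ le_rfl,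
    hP.rateOf_reducedBoundary hM hT hTQ (Ioc_subset_Icc_self hτ), reducedDelta,
    hP.smooth_fit _ ht, hP.value_matching _ (Ico_subset_Icc_self ht)]
  ring

/-- Nothing is known about `P_r` at maturity. The closed form obtained from the smooth fit involves
only `rB`, `F_r` and the gauge, which are continuous up to `t = T`. -/
theorem intervalIntegrable_boundaryGradient_reducedPrice (hM : M.Admissible Q)
    (hF : M.IsBondPrice Q F) (hP : M.IsAmericanPut T K F P rB) (hT : 0 < T) (hTQ : T ≤ Q) :
    IntervalIntegrable (boundaryGradient (M.reducedPrice T K F P rB) (M.reducedBoundary T rB))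
      volume 0 (M.clock T 0) := by
  have hH := hM.clock_zero_pos hT hTQ
  have h : ContinuousOn (fun t => -(rB t) * deriv (F t) (rB t) / M.gauge T t (rB t)) (Icc 0 T) :=
    (hP.rB_cont.neg.mul (hP.continuousOn_bond_delta_boundary hF hT hTQ)).div
      ((hM.continuousOn_gauge hT hTQ).comp (f := fun t => (t, rB t))
        (continuousOn_id.prodMk hP.rB_cont) fun t ht => ht) fun _ _ => gauge_pos.ne'
  have h1 := hM.continuousOn_comp_timeOf hT hTQ h
  rw [← uIcc_of_le hH.le] at h1
  refine h1.intervalIntegrable.congr fun τ hτ => ?_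
  rw [uIoc_of_le hH.le] at hτ
  exact (hP.boundaryGradient_reducedPrice hM hT hTQ hτ).symm

end IsAmericanPut

end VerhulstModel


/-! ### Growth, source and initial value; the reduction theorem. -/

namespace VerhulstModel

variable {M : VerhulstModel} {T Q K τ t x r : ℝ} {F P : ℝ → ℝ → ℝ} {rB : ℝ → ℝ}

namespace IsAmericanPut

theorem exists_premium_bound (hF : M.IsBondPrice Q F) (hP : M.IsAmericanPut T K F P rB)
    (hTQ : T ≤ Q) : ∃ (C : ℝ) (n : ℕ), 0 < C ∧ ∀ t ∈ Icc 0 T, ∀ r, rB t ≤ r →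
      |P t r - (K - F t (rB t))| ≤ C * (1 + r) ^ n := by
  obtain ⟨C, n, hC⟩ := hP.growth
  obtain ⟨B, hB, hb⟩ := (continuousOn_const.sub (hP.continuousOn_bond_boundary hF hTQ) :
    ContinuousOn (fun t => K - F t (rB t)) (Icc 0 T)).exists_pos_bound
  refine ⟨|C| + B, n, by positivity, fun t ht r hr => ?_⟩
  have hr0 := (hP.rB_pos t ht).trans_le hr
  have h1 : 1 ≤ (1 + r) ^ n := one_le_pow₀ (by linarith)
  calc |P t r - (K - F t (rB t))| ≤ |P t r| + |K - F t (rB t)| := abs_sub _ _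
    _ ≤ C * (1 + r) ^ n + B := add_le_add (hC t ht r hr) (hb t ht)
    _ ≤ |C| * (1 + r) ^ n + B * (1 + r) ^ n := by
        gcongr
        · exact le_abs_self C
        · exact le_mul_of_one_le_right hB.le h1
    _ = _ := by ring

/-- Polynomial growth of degree `n` in `r` is exponential growth of rate `n` in `x`; the inverse
gauge is simply bounded. -/
theorem growth_reducedPrice (hM : M.Admissible Q) (hF : M.IsBondPrice Q F)
    (hP : M.IsAmericanPut T K F P rB) (hT : 0 < T) (hTQ : T ≤ Q) :
    ∃ C A : ℝ, ∀ τ ∈ Icc 0 (M.clock T 0), ∀ x, M.reducedBoundary T rB τ ≤ x →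
      |M.reducedPrice T K F P rB τ x| ≤ C * Real.exp (A * |x|) := by
  obtain ⟨C, n, hC0, hC⟩ := hP.exists_premium_bound hF hTQ
  obtain ⟨D, hD0, hD⟩ := hM.exists_rate_bound hT hTQ
  obtain ⟨E, hE0, hE⟩ := hM.exists_inv_gauge_bound' hT hTQ
  refine ⟨C * D ^ n * E, n, fun τ hτ x hx => ?_⟩
  have ht := hM.timeOf_mem hT hTQ hτ
  have hr := (hP.reducedBoundary_le_iff hM hT hTQ hτ).1 hx
  have h0 : 0 < M.rateOf (M.timeOf T τ) x := rateOf_pos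
  rw [reducedPrice, abs_div, abs_of_pos gauge_pos, div_eq_mul_inv]
  calc _ ≤ C * (D * Real.exp |x|) ^ n * E := by
        gcongr
        · exact (inv_pos.2 gauge_pos).le
        · refine (hC _ ht _ hr).trans ?_
          gcongr
          exact hD _ ht x
        · exact hE _ ht _ h0.le
    _ = _ := by rw [mul_pow, ← Real.exp_nat_mul]; ring

theorem tendsto_reducedPrice (hM : M.Admissible Q) (hF : M.IsBondPrice Q F)
    (hP : M.IsAmericanPut T K F P rB) (hT : 0 < T) (hTQ : T ≤ Q)
    (hτ : τ ∈ Icc 0 (M.clock T 0)) :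
    Tendsto (M.reducedPrice T K F P rB τ) atTop (𝓝 0) := by
  obtain ⟨C, n, hC0, hC⟩ := hP.exists_premium_bound hF hTQ
  obtain ⟨D, hD0, hD⟩ := hM.exists_inv_gauge_bound hT hTQ
  have ht := hM.timeOf_mem hT hTQ hτ
  have hc := hM.ratio_pos (t := M.timeOf T τ) ⟨ht.1, ht.2.trans hTQ⟩
  set c := M.κ (M.timeOf T τ) / M.σ (M.timeOf T τ) ^ 2 with hcdef
  have h1 : Tendsto (fun s : ℝ => s ^ n * Real.exp (-(c * s))) atTop (𝓝 0) := by
    have := (isLittleO_pow_exp_pos_mul_atTop (k := n) hc).tendsto_div_nhds_zero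
    simpa only [Real.exp_neg, div_eq_mul_inv] using this
  have h2 : Tendsto (fun x => 1 + M.rateOf (M.timeOf T τ) x) atTop atTop :=
    tendsto_atTop_add_const_left _ _ (Real.tendsto_exp_atTop.comp
      (tendsto_atTop_add_const_right _ _ tendsto_id))
  -- The limit is taken in `s = 1 + r`; the factor `e^c` comes from writing `-cr = c - c(1 + r)`.
  have h3 := ((h1.comp h2).const_mul (C * D * Real.exp c))
  rw [mul_zero] at h3
  refine squeeze_zero_norm' ?_ h3
  filter_upwards [eventually_ge_atTop (M.reducedBoundary T rB τ)] with x hx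
  have hr := (hP.reducedBoundary_le_iff hM hT hTQ hτ).1 hx
  have h0 : 0 < M.rateOf (M.timeOf T τ) x := rateOf_pos
  rw [Real.norm_eq_abs, reducedPrice, abs_div, abs_of_pos gauge_pos, div_eq_mul_inv]
  calc _ ≤ (C * (1 + M.rateOf (M.timeOf T τ) x) ^ n)
        * (D * Real.exp (-(c * M.rateOf (M.timeOf T τ) x))) :=
        mul_le_mul (hC _ ht _ hr) (hD _ ht _ h0.le) (inv_pos.2 gauge_pos).le (by positivity)
    _ = _ := by
        rw [Function.comp_apply, show -(c * M.rateOf (M.timeOf T τ) x)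
          = c + -(c * (1 + M.rateOf (M.timeOf T τ) x)) by ring, Real.exp_add]
        ring

theorem bound_source (hM : M.Admissible Q) (hF : M.IsBondPrice Q F)
    (hP : M.IsAmericanPut T K F P rB) (hT : 0 < T) (hTQ : T ≤ Q) :
    ∃ (A : ℝ) (m : ℝ → ℝ), ContinuousOn m (Ioc 0 (M.clock T 0)) ∧
      IntervalIntegrable m volume 0 (M.clock T 0) ∧
      ∀ τ ∈ Ioo 0 (M.clock T 0), ∀ x, M.reducedBoundary T rB τ < x →
        |M.source T K F rB τ x| ≤ m τ * Real.exp (A * |x|) := by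
  have hI : Icc 0 T ⊆ Icc 0 Q := Icc_subset_Icc_right hTQ
  have hH := hM.clock_zero_pos hT hTQ
  obtain ⟨D, hD0, hD⟩ := hM.exists_rate_bound hT hTQ
  obtain ⟨E, hE0, hE⟩ := hM.exists_inv_gauge_bound' hT hTQ
  obtain ⟨L, hL0, hL⟩ := hP.exists_bond_boundary_speed_bound hF hT hTQ
  obtain ⟨B, hB0, hB⟩ := (continuousOn_const.sub (hP.continuousOn_bond_boundary hF hTQ) :
    ContinuousOn (fun t => K - F t (rB t)) (Icc 0 T)).exists_pos_bound
  obtain ⟨S, hS0, hS⟩ := (hM.s_cont.mono hI).exists_pos_bound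
  obtain ⟨V, hV0, hV⟩ := (continuousOn_const.div (hM.sigma_sq_cont.mono hI) fun t ht =>
    (pow_pos (hM.sigma_pos t (hI ht)) 2).ne' :
    ContinuousOn (fun t => 2 / M.σ t ^ 2) (Icc 0 T)).exists_pos_bound
  set C := V * ((S + |M.R|) * D * B + L) * E with hC
  have hC0 : 0 < C := by positivity
  have hds : ∀ t ∈ Ioo 0 T, derivWithin rB (Ico 0 T) t = deriv rB t := fun t ht =>
    derivWithin_of_mem_nhds (Ico_mem_nhds ht.1 ht.2)
  -- The rate `1` suffices because the source is affine in `r`, up to the bounded inverse gauge. The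
  -- one-sided derivative of `rB` replaces `deriv rB` because the bound must be continuous up to `τ
  -- = clock T 0`, that is at `t = 0`, where the two-sided derivative is not controlled.
  refine ⟨1, fun τ => C * (1 + |derivWithin rB (Ico 0 T) (M.timeOf T τ)|), ?_, ?_, ?_⟩
  · have h := hP.rB_smooth.continuousOn_derivWithin (uniqueDiffOn_Ico 0 T) le_rfl
    exact continuousOn_const.mul (continuousOn_const.add ((h.comp
      ((hM.continuousOn_timeOf hT hTQ).mono Ioc_subset_Icc_self) fun τ hτ =>
        hM.timeOf_mem_Ico hT hTQ hτ).abs))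
  · have h : IntervalIntegrable (fun t => C * (1 + |derivWithin rB (Ico 0 T) t|)) volume 0 T := by
      have h1 : IntervalIntegrable (derivWithin rB (Ico 0 T)) volume 0 T := by
        have h2 := hP.rB_speed
        rw [intervalIntegrable_iff_integrableOn_Ioo_of_le hT.le] at h2 ⊢
        exact h2.congr_fun (fun t ht => (hds t ht).symm) measurableSet_Ioo
      exact (intervalIntegrable_const.add h1.abs).const_mul C
    exact hM.intervalIntegrable_comp_timeOf hT hTQ h
  · intro τ hτ x hx
    have ht' := hM.timeOf_mem_Ioo hT hTQ hτ
    have ht := Ioo_subset_Icc_self ht'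
    have h0 : 0 < M.rateOf (M.timeOf T τ) x := rateOf_pos
    have he : 1 ≤ Real.exp |x| := Real.one_le_exp (abs_nonneg x)
    have h1 : |M.sourceBar K F rB (M.timeOf T τ) (M.rateOf (M.timeOf T τ) x)|
        ≤ ((S + |M.R|) * D * B + L) * (1 + |deriv rB (M.timeOf T τ)|) * Real.exp |x| := by
      have h2 : |M.s (M.timeOf T τ) + M.R * M.rateOf (M.timeOf T τ) x|
          ≤ (S + |M.R|) * (D * Real.exp |x|) := by
        calc _ ≤ S + |M.R| * M.rateOf (M.timeOf T τ) x := by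
              refine (abs_add_le _ _).trans (add_le_add (hS _ ht) ?_)
              rw [abs_mul, abs_of_pos h0]
          _ ≤ (S + |M.R|) * (1 + M.rateOf (M.timeOf T τ) x) := by
              nlinarith [abs_nonneg M.R, mul_pos hS0 h0]
          _ ≤ _ := by gcongr; exact hD _ ht x
      have h3 := hL _ ht'
      have h4 := abs_nonneg (deriv rB (M.timeOf T τ))
      calc _ ≤ (S + |M.R|) * (D * Real.exp |x|) * B + L * (1 + |deriv rB (M.timeOf T τ)|) := by
            refine (abs_add_le _ _).trans (add_le_add ?_ h3)
            rw [abs_mul]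
            exact mul_le_mul h2 (hB _ ht) (abs_nonneg _) (by positivity)
        _ ≤ (S + |M.R|) * (D * Real.exp |x|) * B * (1 + |deriv rB (M.timeOf T τ)|)
            + L * (1 + |deriv rB (M.timeOf T τ)|) * Real.exp |x| := by
            refine add_le_add (le_mul_of_one_le_right (by positivity) (by linarith))
              (le_mul_of_one_le_right (by positivity) he)
        _ = _ := by ring
    beta_reduce
    rw [source, hds _ ht', abs_div, abs_mul, abs_neg, abs_of_pos gauge_pos, div_eq_mul_inv]
    calc _ ≤ V * (((S + |M.R|) * D * B + L) * (1 + |deriv rB (M.timeOf T τ)|) * Real.exp |x|)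
          * E := by
          gcongr
          · exact (inv_pos.2 gauge_pos).le
          · exact hV _ ht
          · exact hE _ ht _ h0.le
      _ = _ := by rw [hC, one_mul]; ring

theorem lipschitz_initialValue (hM : M.Admissible Q) (hF : M.IsBondPrice Q F)
    (hP : M.IsAmericanPut T K F P rB) (hT : 0 < T) (hTQ : T ≤ Q) :
    ∃ C A : ℝ, ∀ x ∈ Ici (M.reducedBoundary T rB 0), ∀ z ∈ Ici (M.reducedBoundary T rB 0),
      |M.initialValue T K F rB x - M.initialValue T K F rB z|
        ≤ C * Real.exp (A * max |x| |z|) * |x - z| := by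
  have hTm : T ∈ Icc 0 T := ⟨hT.le, le_rfl⟩
  obtain ⟨C, n, hC0, hC⟩ := hP.exists_premium_bound hF hTQ
  obtain ⟨L, k, hL⟩ := hP.payoff_lipschitz
  obtain ⟨D, hD0, hD⟩ := hM.exists_rate_bound hT hTQ
  have hc := hM.ratio_pos (t := T) ⟨hT.le, hTQ⟩
  set c := M.κ T / M.σ T ^ 2 with hcdef
  -- The exponent counts `k` for the Lipschitz constant of the payoff and `n` for the size of the
  -- premium, taken together to cover both terms, and `1` for passing from `|r - q|` to `|x - z|`
  -- through the exponential.
  refine ⟨(|L| * D ^ k + C * D ^ n * c) * D, (k + n + 1 : ℕ), fun x hx z hz => ?_⟩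
  have hmem : ∀ x ∈ Ici (M.reducedBoundary T rB 0), rB T ≤ M.rateOf T x := fun x hx => by
    have := (hP.reducedBoundary_le_iff hM hT hTQ ⟨le_rfl, (hM.clock_zero_pos hT hTQ).le⟩).1 hx
    rwa [hM.timeOf_zero hT hTQ] at this
  have hr := hmem x hx
  have hq := hmem z hz
  have hr0 : 0 < M.rateOf T x := rateOf_pos
  have hq0 : 0 < M.rateOf T z := rateOf_pos
  set m := max |x| |z| with hm
  have hm0 : 0 ≤ m := (abs_nonneg x).trans (le_max_left _ _)
  have hDm : ∀ w, |w| ≤ m → 1 + M.rateOf T w ≤ D * Real.exp m := fun w hw =>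
    (hD T hTm w).trans (by gcongr)
  have hmax : 1 + max (M.rateOf T x) (M.rateOf T z) ≤ D * Real.exp m := by
    rcases max_choice (M.rateOf T x) (M.rateOf T z) with h | h <;> rw [h]
    · exact hDm x (le_max_left _ _)
    · exact hDm z (le_max_right _ _)
  have hexp : |M.rateOf T x - M.rateOf T z| ≤ D * Real.exp m * |x - z| := by
    refine (abs_exp_sub_exp_le _ _).trans ?_
    rw [sub_sub_sub_cancel_right]
    gcongr
    rw [Real.exp_monotone.map_max]
    simp only [rateOf] at hmax
    linarith
  have hem : 1 ≤ Real.exp m := Real.one_le_exp hm0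
  have hpow : ∀ j : ℕ, Real.exp m ^ j = Real.exp (j * m) := fun j => (Real.exp_nat_mul m j).symm
  -- the payoff and the exponential factor
  have h1 : |max (K - F T (M.rateOf T x)) 0 - max (K - F T (M.rateOf T z)) 0|
      ≤ |L| * (D * Real.exp m) ^ k * (D * Real.exp m * |x - z|) := by
    refine (hL _ hr _ hq).trans ?_
    have h0 : 0 ≤ 1 + max (M.rateOf T x) (M.rateOf T z) := by positivity
    gcongr
    exact le_abs_self L
  have h2 : |max (K - F T (M.rateOf T z)) 0 - (K - F T (rB T))| ≤ C * (D * Real.exp m) ^ n := by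
    rw [← hP.terminal _ hq]
    refine (hC T hTm _ hq).trans ?_
    gcongr
    exact hDm z (le_max_right _ _)
  have h3 : |Real.exp (-(c * M.rateOf T x)) - Real.exp (-(c * M.rateOf T z))|
      ≤ c * (D * Real.exp m * |x - z|) := by
    refine (abs_exp_sub_exp_le _ _).trans ?_
    rw [show -(c * M.rateOf T x) - -(c * M.rateOf T z) = -(c * (M.rateOf T x - M.rateOf T z)) by
      ring, abs_neg, abs_mul, abs_of_pos hc]
    refine (mul_le_of_le_one_left (by positivity) ?_).trans (by gcongr)
    rw [Real.exp_le_one_iff]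
    refine max_le ?_ ?_ <;> rw [neg_nonpos] <;> positivity
  have h4 : Real.exp (-(c * M.rateOf T x)) ≤ 1 := by
    rw [Real.exp_le_one_iff, neg_nonpos]; positivity
  have hk : Real.exp m ^ k ≤ Real.exp m ^ (k + n) := pow_le_pow_right₀ hem (Nat.le_add_right k n)
  have hn : Real.exp m ^ n ≤ Real.exp m ^ (k + n) := pow_le_pow_right₀ hem (Nat.le_add_left n k)
  rw [initialValue, initialValue, ← hpow]
  -- A discrete product rule separates the increment of the payoff from that of the exponential
  -- factor, which is bounded by `1` and Lipschitz in `r` with constant `c`.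
  rw [show ∀ a b e g f : ℝ, (a - f) * e - (b - f) * g = (a - b) * e + (b - f) * (e - g) from
    fun a b e g f => by ring]
  calc _ ≤ |L| * (D * Real.exp m) ^ k * (D * Real.exp m * |x - z|) * 1
        + C * (D * Real.exp m) ^ n * (c * (D * Real.exp m * |x - z|)) := by
        refine (abs_add_le _ _).trans (add_le_add ?_ ?_)
        · rw [abs_mul, abs_of_pos (Real.exp_pos _)]
          exact mul_le_mul h1 h4 (Real.exp_pos _).le (by positivity)
        · rw [abs_mul]
          exact mul_le_mul h2 h3 (abs_nonneg _) (by positivity)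
    _ = (|L| * D ^ k * Real.exp m ^ k + C * D ^ n * c * Real.exp m ^ n)
          * (D * Real.exp m * |x - z|) := by rw [mul_pow, mul_pow]; ring
    _ ≤ (|L| * D ^ k * Real.exp m ^ (k + n) + C * D ^ n * c * Real.exp m ^ (k + n))
          * (D * Real.exp m * |x - z|) := by gcongr
    _ = _ := by ring

/-- The reduced price and the reduced boundary solve the moving boundary problem. -/
theorem isMovingBoundarySolution (hM : M.Admissible Q) (hF : M.IsBondPrice Q F)
    (hP : M.IsAmericanPut T K F P rB) (hT : 0 < T) (hTQ : T ≤ Q) :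
    IsMovingBoundarySolution (M.clock T 0) (M.alpha T) (M.beta T) (M.source T K F rB)
      (M.initialValue T K F rB) (fun _ => 0) (M.reducedBoundary T rB)
      (M.reducedPrice T K F P rB) where
  horizon_pos := hM.clock_zero_pos hT hTQ
  alpha_cont := hM.continuousOn_alpha hT hTQ
  beta_cont := hM.continuousOn_beta hT hTQ
  y_cont := hP.continuousOn_reducedBoundary hM hT hTQ
  y_smooth := hP.contDiffOn_reducedBoundary hM hT hTQ
  y_speed := hP.intervalIntegrable_reducedBoundary_speed hM hT hTQ
  g_cont := continuousOn_const
  g_smooth := contDiffOn_const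
  g_speed := by simp
  f_lipschitz := hP.lipschitz_initialValue hM hF hT hTQ
  source_bound := hP.bound_source hM hF hT hTQ
  cont := hP.continuousOn_reducedPrice hM hF hT hTQ
  c12 := hP.isC12On_reducedPrice hM hF hT hTQ
  grad_diff := fun _ hτ _ hx =>
    (hP.hasDerivWithinAt_reducedPrice hM hT hTQ hτ hx).differentiableWithinAt
  grad_cont := by
    refine ((hP.continuousOn_reducedDelta hM hF hT hTQ).comp
      ((hM.continuousOn_coordinates hT hTQ).mono fun p hp => Ioc_subset_Icc_self hp.1)
      fun p hp => ?_).congr fun p hp => hP.derivWithin_reducedPrice hM hT hTQ hp.1 hp.2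
    exact ⟨hM.timeOf_mem_Ico hT hTQ hp.1,
      (hP.reducedBoundary_le_iff hM hT hTQ (Ioc_subset_Icc_self hp.1)).1 hp.2⟩
  grad_int := hP.intervalIntegrable_boundaryGradient_reducedPrice hM hF hT hTQ
  growth := hP.growth_reducedPrice hM hF hT hTQ
  pde := fun τ hτ x hx => by
    rw [(hP.hasDerivAt_reducedPrice_time hM hF hT hTQ hτ hx).deriv,
      (hP.hasDerivAt_reducedPrice_space_two hM hT hTQ hτ hx).deriv, potential_eq]
    exact hP.reduced_pde hM hTQ (hM.timeOf_mem_Ioo hT hTQ hτ)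
      ((hP.reducedBoundary_lt_iff hM hT hTQ (Ioo_subset_Icc_self hτ)).1 hx)
  initial := fun x hx => by
    have hr := (hP.reducedBoundary_le_iff hM hT hTQ ⟨le_rfl, (hM.clock_zero_pos hT hTQ).le⟩).1 hx
    rw [hM.timeOf_zero hT hTQ] at hr
    rw [reducedPrice, hM.timeOf_zero hT hTQ, hP.terminal _ hr, initialValue, gauge,
      intervalIntegral.integral_same, add_zero, Real.exp_neg, div_eq_mul_inv]
  boundary := fun τ hτ => by
    rw [reducedPrice, hP.rateOf_reducedBoundary hM hT hTQ hτ,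
      hP.value_matching _ (hM.timeOf_mem hT hTQ hτ), sub_self, zero_div]

theorem price_eq (hM : M.Admissible Q) (hP : M.IsAmericanPut T K F P rB) (hT : 0 < T)
    (hTQ : T ≤ Q) (ht : t ∈ Icc 0 T) (hr : rB t ≤ r) :
    P t r = M.gauge T t r * M.reducedPrice T K F P rB (M.clock T t) (M.logVar t r)
      + (K - F t (rB t)) := by
  rw [reducedPrice, hM.timeOf_clock hT hTQ ht, rateOf_logVar ((hP.rB_pos t ht).trans_le hr),
    mul_div_cancel₀ _ gauge_pos.ne', sub_add_cancel]

theorem tendsto_gauge_mul_reducedPrice (h : Tendsto (P (M.timeOf T τ)) atTop (𝓝 K)) :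
    Tendsto (fun x => M.gauge T (M.timeOf T τ) (M.rateOf (M.timeOf T τ) x)
      * M.reducedPrice T K F P rB τ x) atTop (𝓝 (F (M.timeOf T τ) (rB (M.timeOf T τ)))) := by
  have h1 : Tendsto (M.rateOf (M.timeOf T τ)) atTop atTop :=
    Real.tendsto_exp_atTop.comp (tendsto_atTop_add_const_right _ _ tendsto_id)
  have h2 := (h.comp h1).sub_const (K - F (M.timeOf T τ) (rB (M.timeOf T τ)))
  rw [sub_sub_cancel] at h2
  refine h2.congr fun x => ?_
  rw [reducedPrice, mul_div_cancel₀ _ gauge_pos.ne', Function.comp_apply]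

theorem initialValue_eq_zero (hM : M.Admissible Q) (hP : M.IsAmericanPut T K F P rB) (hT : 0 < T)
    (hTQ : T ≤ Q) (h : ∀ r, rB T ≤ r → K ≤ F T r) (hK : F T (rB T) = K)
    (hx : M.reducedBoundary T rB 0 ≤ x) : M.initialValue T K F rB x = 0 := by
  have hr := (hP.reducedBoundary_le_iff hM hT hTQ ⟨le_rfl, (hM.clock_zero_pos hT hTQ).le⟩).1 hx
  rw [hM.timeOf_zero hT hTQ] at hr
  rw [initialValue, max_eq_right (sub_nonpos.2 (h _ hr)), hK, sub_self, sub_self, zero_mul]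

end IsAmericanPut

end VerhulstModel


theorem mainTheorem5 :
    -- the coupled system for the moving boundary problem with the potential and general data
    (∀ (H : ℝ) (α β : ℝ → ℝ) (lam : ℝ → ℝ → ℝ) (f g y : ℝ → ℝ) (U : ℝ → ℝ → ℝ),
      IsMovingBoundarySolution H α β lam f g y U →
        SatisfiesPriceEquation H α β lam f g y U ∧
        SatisfiesBoundaryEquation H α β lam f g y U) ∧
    -- the American put on a zero-coupon bond in the Verhulst model
    (∀ (M : VerhulstModel) (T Q K : ℝ) (F P : ℝ → ℝ → ℝ) (rB : ℝ → ℝ),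
      0 < T → T ≤ Q → M.Admissible Q → M.IsBondPrice Q F → M.IsAmericanPut T K F P rB →
        -- the reduction to the equation with the potential
        IsMovingBoundarySolution (M.clock T 0) (M.alpha T) (M.beta T) (M.source T K F rB)
          (M.initialValue T K F rB) (fun _ => 0) (M.reducedBoundary T rB)
          (M.reducedPrice T K F P rB) ∧
        -- the price is recovered from the reduced price
        (∀ t ∈ Set.Icc 0 T, ∀ r, rB t ≤ r →
          P t r = M.gauge T t r * M.reducedPrice T K F P rB (M.clock T t) (M.logVar t r)
            + (K - F t (rB t))) ∧
        -- behaviour at infinity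
        (∀ τ ∈ Set.Icc 0 (M.clock T 0),
          Filter.Tendsto (M.reducedPrice T K F P rB τ) Filter.atTop (nhds 0)) ∧
        (∀ τ ∈ Set.Icc 0 (M.clock T 0),
          Filter.Tendsto (P (M.timeOf T τ)) Filter.atTop (nhds K) →
          Filter.Tendsto
            (fun x => M.gauge T (M.timeOf T τ) (M.rateOf (M.timeOf T τ) x)
              * M.reducedPrice T K F P rB τ x)
            Filter.atTop (nhds (F (M.timeOf T τ) (rB (M.timeOf T τ))))) ∧
        -- an out-of-the-money option at maturity has the zero initial value
        ((∀ r, rB T ≤ r → K ≤ F T r) → F T (rB T) = K →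
          ∀ x, M.reducedBoundary T rB 0 ≤ x → M.initialValue T K F rB x = 0) ∧
        -- the gradient at the boundary in closed form
        (∀ τ ∈ Set.Ioc 0 (M.clock T 0),
          boundaryGradient (M.reducedPrice T K F P rB) (M.reducedBoundary T rB) τ =
            -(rB (M.timeOf T τ)) * deriv (F (M.timeOf T τ)) (rB (M.timeOf T τ))
              / M.gauge T (M.timeOf T τ) (rB (M.timeOf T τ))) ∧
        -- the coupled system
        SatisfiesPriceEquation (M.clock T 0) (M.alpha T) (M.beta T) (M.source T K F rB)
          (M.initialValue T K F rB) (fun _ => 0) (M.reducedBoundary T rB)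
          (M.reducedPrice T K F P rB) ∧
        SatisfiesBoundaryEquation (M.clock T 0) (M.alpha T) (M.beta T) (M.source T K F rB)
          (M.initialValue T K F rB) (fun _ => 0) (M.reducedBoundary T rB)
          (M.reducedPrice T K F P rB)) := by
  refine ⟨fun H α β lam f g y U hU =>
    ⟨hU.satisfiesPriceEquation, hU.satisfiesBoundaryEquation⟩,
    fun M T Q K F P rB hT hTQ hM hF hP => ?_⟩
  have hu := hP.isMovingBoundarySolution hM hF hT hTQ
  exact ⟨hu, fun t ht r hr => hP.price_eq hM hT hTQ ht hr,
    fun τ hτ => hP.tendsto_reducedPrice hM hF hT hTQ hτ,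
    fun τ _ h => VerhulstModel.IsAmericanPut.tendsto_gauge_mul_reducedPrice h,
    fun h hK x hx => hP.initialValue_eq_zero hM hT hTQ h hK hx,
    fun τ hτ => hP.boundaryGradient_reducedPrice hM hT hTQ hτ,
    hu.satisfiesPriceEquation, hu.satisfiesBoundaryEquation⟩
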